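/- Let $\Gamma$ be a graph of rank $n$: a connected finite $1$-dimensional cell complex, all of whose vertices have valence $>2$, with $\pi_1(\Gamma)\cong F_n$. A \emph{loop} is an immersed closed edge path, and for $f:E(\Gamma)\to\mathbb R$ we write $f(\alpha)$ for the sum of $f(e)$ over the edges $e$ crossed by the loop $\alpha$, with multiplicity. Let $\ell:E(\Gamma)\to[0,1]$ be a metric on $\Gamma$, that is, $\sum_e\ell(e)=1$ and the edges with $\ell(e)=0$ form a forest, and let $\tau:E(\Gamma)\to\mathbb R$ be a tangent vector, that is, $\sum_e\tau(e)=0$. Put $$\|\tau\|^L=\|(\ell,\tau)\|^L=\sup_{\alpha}\frac{\tau(\alpha)}{\ell(\alpha)},$$ the supremum being over all loops $\alpha$ in $\Gamma$. Let $\Gamma_i\to\Gamma$ run over the nontrivial double covers of $\Gamma$ up to isomorphism over $\Gamma$, with the pulled-back weights $\ell_i,\tau_i$. For a nonzero class $a\in H_1(\Gamma_i;\mathbb Z/2)$ let $\ell_i(a)$ be the minimal length $\ell_i(\alpha)$ of a loop $\alpha$ in $\Gamma_i$ representing $a$; say that $\alpha$ realizes $\ell_i(a)$ if it represents $a$ and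 $\ell_i(\alpha)=\ell_i(a)$. Put $$N(\ell,\tau)=-\sum_{\Gamma_i}\ \sum_{0\ne a\in H_1(\Gamma_i;\mathbb Z/2)}\frac{\max\{\tau_i(\alpha):\alpha\text{ realizes }\ell_i(a)\}}{\ell_i(a)},\qquad K=(2^n-1)(2^{2n-1}-1),$$ $$\|\tau\|^N=\|(\ell,\tau)\|^N=\|(\ell,\tau)\|^L+\frac1{K+1}N(\ell,\tau).$$ Then these quantities are well defined (the supremum is finite, the minima and maxima are attained, $\ell_i(a)>0$, and the double sum has exactly $K$ summands), and $$\frac1{K+1}\max\{\|\tau\|^L,\|-\tau\|^L\}\ \le\ \|\tau\|^N\ \le\ 2\|\tau\|^L+\|-\tau\|^L .$$ Consequently $\|\cdot\|^N$ is quasi-symmetric: $$\|\tau\|^N\le 3(K+1)\,\|-\tau\|^N .$$ -/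

import Mathlib

/-- A one-dimensional cell complex with vertex set `V` and edge set `E`; each edge carries an
arbitrary reference orientation. Loop edges and multiple edges are allowed. -/
structure CellGraph (V E : Type*) where
  src : E → V
  tgt : E → V

namespace CellGraph

section Basic

variable {V E : Type*} (Γ : CellGraph V E)

/-- Oriented edges: `(e, true)` is `e` with its reference orientation, `(e, false)` is the
reversed edge. `start` is the initial vertex of an oriented edge. -/
def start (d : E × Bool) : V := if d.2 then Γ.src d.1 else Γ.tgt d.1

/-- Terminal vertex of an oriented edge. -/
def finish (d : E × Bool) : V := if d.2 then Γ.tgt d.1 else Γ.src d.1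

/-- Path-connected and nonempty. -/
def IsConnected : Prop :=
  Nonempty V ∧ ∀ u v : V, Relation.EqvGen (fun x y => ∃ e, Γ.src e = x ∧ Γ.tgt e = y) u v

/-- The valence of a vertex: the number of oriented edges issuing from it (so a loop edge counts
twice). -/
noncomputable def valence (v : V) : ℕ := Nat.card {d : E × Bool // Γ.start d = v}

/-- An immersed loop: a nonempty cyclic sequence of oriented edges, each one starting where the
previous one ends and never being the reverse of the previous one. There is no base point. -/
def Loop : Type _ :=
  {c : Cycle (E × Bool) // c ≠ Cycle.nil ∧
    c.Chain (fun d d' => Γ.finish d = Γ.start d' ∧ d' ≠ (d.1, !d.2))}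

variable {Γ}

/-- The edges crossed by a loop, with multiplicity. -/
def Loop.edges (α : Γ.Loop) : Multiset E := α.1.toMultiset.map Prod.fst

/-- `f(α)`: the sum of the weights `f e` over the edges crossed by the loop `α`, with
multiplicity. -/
def Loop.weight {R : Type*} [AddCommMonoid R] (α : Γ.Loop) (f : E → R) : R :=
  (α.edges.map f).sum

variable (Γ)

/-- `Γ` is a graph of rank `n`: connected, all vertices of valence greater than `2`, and Euler
characteristic `1 - n` (so that its fundamental group is free of rank `n`). -/
def IsGraphOfRank [Fintype V] [Fintype E] (n : ℕ) : Prop :=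
  Γ.IsConnected ∧ (∀ v, 2 < Γ.valence v) ∧ Fintype.card V + n = Fintype.card E + 1

/-- `ℓ` belongs to the simplex with missing faces `Σ_Γ`: lengths in `[0,1]` with total `1`, and the
edges of length `0` contain no loop (they form a forest). -/
def IsMetric [Fintype E] (ℓ : E → ℝ) : Prop :=
  (∀ e, 0 ≤ ℓ e ∧ ℓ e ≤ 1) ∧ ∑ e, ℓ e = 1 ∧ ∀ α : Γ.Loop, ∃ e ∈ α.edges, ℓ e ≠ 0

/-- `τ` belongs to the tangent space of `Σ_Γ` (which is the same at every point). -/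
def IsTangent [Fintype E] (τ : E → ℝ) : Prop := ∑ e, τ e = 0

/-- The set of all ratios `τ(α) / ℓ(α)`, `α` a loop. -/
def ratios (ℓ τ : E → ℝ) : Set ℝ := Set.range fun α : Γ.Loop => α.weight τ / α.weight ℓ

/-- The Lipschitz Finsler norm `‖(ℓ,τ)‖^L`. -/
noncomputable def normL (ℓ τ : E → ℝ) : ℝ := sSup (Γ.ratios ℓ τ)

end Basic

section Homology

variable {V E : Type*} [Fintype E] [DecidableEq V] [DecidableEq E] (Γ : CellGraph V E)

/-- The cellular boundary map `C₁(Γ; ℤ/2) → C₀(Γ; ℤ/2)`. -/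
def boundary : (E → ZMod 2) →ₗ[ZMod 2] (V → ZMod 2) :=
  ∑ e : E, (LinearMap.proj e).smulRight
    (Pi.single (Γ.tgt e) (1 : ZMod 2) - Pi.single (Γ.src e) (1 : ZMod 2))

/-- `H₁(Γ; ℤ/2)`: the cellular `1`-cycles (there are no `2`-cells). -/
abbrev H1 : Submodule (ZMod 2) (E → ZMod 2) := LinearMap.ker Γ.boundary

variable {Γ}

/-- The mod `2` chain carried by a loop: each edge with the parity of the number of times the loop
crosses it. -/
def Loop.chain (α : Γ.Loop) : E → ZMod 2 := α.weight fun e => Pi.single e (1 : ZMod 2)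

/-- The loop `α` represents the homology class `a`. -/
def Loop.Represents (α : Γ.Loop) (a : Γ.H1) : Prop := α.chain = (a : E → ZMod 2)

/-- `ℓ(a)`, the minimal length of a loop in the class `a`. -/
noncomputable def classLength (ℓ : E → ℝ) (a : Γ.H1) : ℝ :=
  sInf {x | ∃ α : Γ.Loop, α.Represents a ∧ α.weight ℓ = x}

/-- The loop `α` realizes `ℓ(a)`. -/
def Loop.Realizes (α : Γ.Loop) (ℓ : E → ℝ) (a : Γ.H1) : Prop :=
  α.Represents a ∧ α.weight ℓ = classLength ℓ a

/-- The values `τ(α)`, where `α` ranges over the loops that realize `ℓ(a)`. -/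
def realizedValues (ℓ τ : E → ℝ) (a : Γ.H1) : Set ℝ :=
  {x | ∃ α : Γ.Loop, α.Realizes ℓ a ∧ α.weight τ = x}

end Homology

section Covers

variable {V E : Type*}

/-- A double cover of `Γ`, normalized so that its vertex and edge sets are `V × Bool` and
`E × Bool` with the first projection as covering map (every two-sheeted covering is isomorphic to
such a one). The covering condition: each of the two preimages of the initial (terminal) vertex of
`e` is the initial (terminal) vertex of exactly one of the two lifts of `e`. -/
structure DoubleCover (Γ : CellGraph V E) where
  total : CellGraph (V × Bool) (E × Bool)
  src_fst : ∀ e, (total.src e).1 = Γ.src e.1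
  tgt_fst : ∀ e, (total.tgt e).1 = Γ.tgt e.1
  src_bij : ∀ e, Function.Bijective fun b => (total.src (e, b)).2
  tgt_bij : ∀ e, Function.Bijective fun b => (total.tgt (e, b)).2

variable (Γ : CellGraph V E)

/-- The trivial double cover: two disjoint copies of `Γ`. -/
def trivialCover : DoubleCover Γ where
  total := ⟨fun e => (Γ.src e.1, e.2), fun e => (Γ.tgt e.1, e.2)⟩
  src_fst _ := rfl
  tgt_fst _ := rfl
  src_bij _ := Function.bijective_id
  tgt_bij _ := Function.bijective_id

variable {Γ}

/-- Isomorphism of double covers over `Γ`. -/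
def DoubleCover.Iso (D D' : DoubleCover Γ) : Prop :=
  ∃ (f : V × Bool ≃ V × Bool) (g : E × Bool ≃ E × Bool),
    (∀ v, (f v).1 = v.1) ∧ (∀ e, (g e).1 = e.1) ∧
    (∀ e, D'.total.src (g e) = f (D.total.src e)) ∧
    (∀ e, D'.total.tgt (g e) = f (D.total.tgt e))

theorem DoubleCover.iso_equivalence : Equivalence (DoubleCover.Iso (Γ := Γ)) where
  refl D := ⟨Equiv.refl _, Equiv.refl _, by simp, by simp, by simp, by simp⟩
  symm := by
    rintro D D' ⟨f, g, hf, hg, hs, ht⟩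
    refine ⟨f.symm, g.symm, fun v => ?_, fun e => ?_, fun e => ?_, fun e => ?_⟩
    · rw [← hf, Equiv.apply_symm_apply]
    · rw [← hg, Equiv.apply_symm_apply]
    · rw [Equiv.eq_symm_apply, ← hs, Equiv.apply_symm_apply]
    · rw [Equiv.eq_symm_apply, ← ht, Equiv.apply_symm_apply]
  trans := by
    rintro D D' D'' ⟨f, g, hf, hg, hs, ht⟩ ⟨f', g', hf', hg', hs', ht'⟩
    refine ⟨f.trans f', g.trans g', ?_, ?_, ?_, ?_⟩ <;> simp [*]

variable (Γ)

instance DoubleCover.isoSetoid : Setoid (DoubleCover Γ) := ⟨_, DoubleCover.iso_equivalence⟩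

/-- The nontrivial double covers of `Γ`, up to isomorphism over `Γ`. -/
def NontrivialCover : Type _ :=
  {q : Quotient (DoubleCover.isoSetoid Γ) // q ≠ Quotient.mk _ (trivialCover Γ)}

variable {Γ}

/-- The total space of (a representative of) a nontrivial double cover; what follows does not
depend on the representative. -/
noncomputable def NontrivialCover.space (D : NontrivialCover Γ) :
    CellGraph (V × Bool) (E × Bool) := (Quotient.out D.1).total

instance DoubleCover.instFinite [Finite V] [Finite E] : Finite (DoubleCover Γ) := by
  apply Finite.of_injective
    (fun D : DoubleCover Γ => (D.total.src, D.total.tgt))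
  rintro ⟨⟨s, t⟩, _, _, _, _⟩ ⟨⟨s', t'⟩, _, _, _, _⟩ h
  simp only [Prod.mk.injEq] at h
  obtain ⟨rfl, rfl⟩ := h
  rfl

noncomputable instance NontrivialCover.instFintype [Finite V] [Finite E] :
    Fintype (NontrivialCover Γ) :=
  have : Finite (NontrivialCover Γ) := Subtype.finite
  Fintype.ofFinite _

/-- Pull-back to a double cover of a function on the edges (a metric or a tangent vector). -/
def pullback (f : E → ℝ) : E × Bool → ℝ := fun e => f e.1

end Covers

section Norm

variable {V E : Type*} [Fintype V] [Fintype E] [DecidableEq V] [DecidableEq E]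
  (Γ : CellGraph V E)

/-- The index set of the big sum: a nontrivial double cover together with a nonzero class in its
first homology with `ℤ/2` coefficients. -/
abbrev Summand : Type _ := Σ D : NontrivialCover Γ, {a : D.space.H1 // a ≠ 0}

noncomputable instance Summand.instFintype : Fintype Γ.Summand := by
  classical
  exact inferInstance

/-- `N(ℓ,τ)`, minus the sum of the quotients `max τ(α) / ℓ(a)`, the maximum being over all loops
`α` in the double cover that realize `ℓ(a)`. -/
noncomputable def correction (ℓ τ : E → ℝ) : ℝ :=
  -∑ i : Γ.Summand,
    sSup (realizedValues (pullback ℓ) (pullback τ) i.2.1) / classLength (pullback ℓ) i.2.1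

/-- `K = (2^n - 1) (2^(2n-1) - 1)`. -/
def numSummands (n : ℕ) : ℕ := (2 ^ n - 1) * (2 ^ (2 * n - 1) - 1)

/-- The corrected norm `‖(ℓ,τ)‖^N` on a graph of rank `n`. -/
noncomputable def normN (n : ℕ) (ℓ τ : E → ℝ) : ℝ :=
  Γ.normL ℓ τ + 1 / ((numSummands n : ℝ) + 1) * Γ.correction ℓ τ

end Norm

end CellGraph

/-! Write `M` for the Lipschitz norm of `τ` and put `g = M ℓ - τ`, a weight that is nonnegative on
every loop. If `β i` is a loop that realizes the `i`-th class length `L i` with maximal `τ`, pushed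
down to the graph, then `K M + N = ∑ g (β i) / L i`. The heart of the matter is the bound `g c ≤ (K
M + N) ℓ(c)` for every loop `c` (`sum_le_correction_mul`): dividing by `ℓ(c)` it says that the norm
of `-τ` is at most `K M + N - M`. The other estimates compare each summand of `N` with the norms of
`τ` and `-τ`, and use that these norms are nonnegative (`normL_nonneg`).

To prove the bound, note that a weight nonnegative on all loops becomes a nonnegative function of
turns once the coboundary of a potential is added (`exists_potential`). So `g c` is a sum of
nonnegative contributions of turns, and it suffices that every turn of `c` be made by enough of the
`β i` with `L i ≤ ℓ(c)` (`Circuit.mul_sum_le_of_turnCount`). One may assume that `c` repeats no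
oriented edge; then it makes a turn at most once in each direction, and two such `β i` per turn are
enough.

Given a turn of `c`, let `c'` be a shortest circuit that makes it. Cutting and pasting show that
`c'` visits no vertex more than twice. Hence there is a nontrivial double cover in which the two
visits to a vertex lie on different sheets, so that `c'` lifts to simple circuits
(`Circuit.IsShortest.exists_cover`). Its two lifts have different nonzero classes mod 2, since some
edge of `c'` is crossed only once.

A loop realizing the class of a simple circuit crosses all its edges, and no other edges of positive
length. It can miss the given turn only by a detour of length zero that leaves the simple circuit at
the vertex of the turn and comes back to it. By minimality of `c'`, and by the choice of sheet
changes on the edges off `c'`, such detours end on the wrong sheet or miss the circuit altogether.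
So all realizations of both classes make the turn.

Minima and maxima exist because only finitely many loops have bounded length, although edges of
length zero are allowed. The number `K` comes from identifying double covers with edge cochains mod
2 modulo coboundaries, and from the Euler characteristic of a connected double cover. -/

namespace CellGraph

open Finset

/-! ### Circuits: loops with a base point and an orientation -/

section Circuits

variable {V E : Type*}

/-- The reversed oriented edge. -/
def rev (d : E × Bool) : E × Bool := (d.1, !d.2)

@[simp] theorem rev_rev (d : E × Bool) : rev (rev d) = d := by simp [rev]

@[simp] theorem rev_fst (d : E × Bool) : (rev d).1 = d.1 := rfl

theorem rev_ne (d : E × Bool) : rev d ≠ d := by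
  rcases d with ⟨e, b⟩
  cases b <;> simp [rev]

theorem rev_injective : Function.Injective (rev : E × Bool → E × Bool) :=
  Function.LeftInverse.injective rev_rev

theorem eq_or_eq_rev_of_fst_eq {d d' : E × Bool} (h : d.1 = d'.1) : d = d' ∨ d = rev d' := by
  rcases d with ⟨e, b⟩
  rcases d' with ⟨e', b'⟩
  obtain rfl : e = e' := h
  cases b <;> cases b' <;> simp [rev]

variable (Γ : CellGraph V E)

@[simp] theorem start_rev (d : E × Bool) : Γ.start (rev d) = Γ.finish d := by
  rcases d with ⟨e, b⟩
  cases b <;> rfl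

@[simp] theorem finish_rev (d : E × Bool) : Γ.finish (rev d) = Γ.start d := by
  rcases d with ⟨e, b⟩
  cases b <;> rfl

/-- The oriented edge `d'` may follow `d` in an immersed path. -/
def Turn (d d' : E × Bool) : Prop := Γ.finish d = Γ.start d' ∧ d' ≠ rev d

variable {Γ}

theorem Turn.reverse {d d' : E × Bool} (h : Γ.Turn d d') : Γ.Turn (rev d') (rev d) := by
  refine ⟨by simp [h.1], fun h' => h.2 ?_⟩
  rw [h']
  simp

variable (Γ)

/-- An immersed closed path, as a periodic sequence of oriented edges. -/
structure Circuit where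
  len : ℕ
  pos : 0 < len
  dart : ℤ → E × Bool
  periodic : ∀ i, dart (i + len) = dart i
  turn : ∀ i, Γ.Turn (dart i) (dart (i + 1))

variable {Γ}

namespace Circuit

variable (c : Γ.Circuit)

theorem dart_add_mul (i k : ℤ) : c.dart (i + k * c.len) = c.dart i := by
  have h : Function.Periodic c.dart (c.len : ℤ) := c.periodic
  simpa using h.int_mul k i

theorem dart_emod (i : ℤ) : c.dart (i % c.len) = c.dart i := by
  conv_rhs => rw [← Int.emod_add_mul_ediv i c.len, mul_comm]
  rw [c.dart_add_mul]

theorem exists_nat (i : ℤ) : ∃ k : ℕ, k < c.len ∧ c.dart k = c.dart i := by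
  have h0 : (0 : ℤ) < c.len := by exact_mod_cast c.pos
  have h1 := Int.emod_nonneg i h0.ne'
  have h2 := Int.emod_lt_of_pos i h0
  refine ⟨(i % c.len).toNat, by omega, ?_⟩
  rw [Int.toNat_of_nonneg h1, c.dart_emod]

theorem exists_nat_turn (i : ℤ) :
    ∃ k : ℕ, k < c.len ∧ c.dart k = c.dart i ∧ c.dart (k + 1) = c.dart (i + 1) := by
  have h0 : (0 : ℤ) < c.len := by exact_mod_cast c.pos
  have h1 := Int.emod_nonneg i h0.ne'
  have h2 := Int.emod_lt_of_pos i h0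
  refine ⟨(i % c.len).toNat, by omega, ?_, ?_⟩ <;> rw [Int.toNat_of_nonneg h1]
  · rw [c.dart_emod]
  · conv_rhs => rw [← Int.emod_add_mul_ediv i c.len, mul_comm, add_right_comm]
    rw [c.dart_add_mul]

/-- The edges crossed by a circuit, with multiplicity. -/
def edges : Multiset E := (Multiset.range c.len).map fun i : ℕ => (c.dart i).1

/-- The sum of a weight along a circuit. -/
def sum {R : Type*} [AddCommMonoid R] (f : E → R) : R := ∑ i ∈ range c.len, f (c.dart i).1

theorem edges_sum {R : Type*} [AddCommMonoid R] (f : E → R) :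
    (c.edges.map f).sum = c.sum f := by
  simp [edges, sum, Finset.sum, Multiset.map_map, Finset.range]

theorem mem_edges (i : ℤ) : (c.dart i).1 ∈ c.edges := by
  obtain ⟨k, hk, h⟩ := c.exists_nat i
  exact Multiset.mem_map.2 ⟨k, Multiset.mem_range.2 hk, by rw [h]⟩

theorem exists_of_mem_edges {e : E} (h : e ∈ c.edges) : ∃ i : ℕ, i < c.len ∧ (c.dart i).1 = e := by
  obtain ⟨k, hk, h⟩ := Multiset.mem_map.1 h
  exact ⟨k, Multiset.mem_range.1 hk, h⟩

theorem exists_loop : ∃ α : Γ.Loop, α.edges = c.edges := by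
  obtain ⟨n, hn⟩ : ∃ n : ℕ, c.len = n.succ := Nat.exists_eq_succ_of_ne_zero c.pos.ne'
  let l : Cycle ℕ := (List.range n.succ : List ℕ)
  suffices h : l.map (fun i : ℕ => c.dart i) ≠ Cycle.nil ∧
      (l.map fun i : ℕ => c.dart i).Chain Γ.Turn by
    refine ⟨⟨_, h⟩, ?_⟩
    have e : c.edges = (Multiset.range n.succ).map fun i : ℕ => (c.dart i).1 := by rw [edges, hn]
    rw [e]
    change (((List.range n.succ).map fun i : ℕ => c.dart i).map Prod.fst : Multiset E) =
      ((List.range n.succ).map fun i : ℕ => (c.dart i).1 : List E)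
    rw [List.map_map]
    rfl
  refine ⟨?_, ?_⟩
  · intro h
    have := congrArg Cycle.length h
    simp [l] at this
  · rw [Cycle.chain_map, Cycle.chain_range_succ]
    refine ⟨?_, fun m _ => ?_⟩
    · have := c.turn n
      have h0 := c.periodic 0
      rw [hn] at h0
      push_cast at h0
      rw [zero_add] at h0
      rw [h0] at this
      exact this
    · have := c.turn m
      exact_mod_cast this

/-- The circuit of a cyclically immersed list. -/
def ofList (L : List (E × Bool)) (h : L ≠ []) (hc : L.IsChain Γ.Turn)
    (hl : Γ.Turn (L.getLast h) (L.head h)) : Γ.Circuit where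
  len := L.length
  pos := List.length_pos_iff.2 h
  dart i := L[(i % L.length).toNat]'(by
    have h0 : (0 : ℤ) < L.length := by exact_mod_cast List.length_pos_iff.2 h
    have h1 := Int.emod_nonneg i h0.ne'
    have h2 := Int.emod_lt_of_pos i h0
    omega)
  periodic i := by simp
  turn i := by
    have h0 : (0 : ℤ) < L.length := by exact_mod_cast List.length_pos_iff.2 h
    have h1 := Int.emod_nonneg i h0.ne'
    have h2 := Int.emod_lt_of_pos i h0
    have e : (i + 1) % L.length = if i % L.length + 1 = L.length then 0 else i % L.length + 1 := by
      rw [Int.add_emod]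
      split_ifs with h3
      · rcases eq_or_ne (L.length : ℤ) 1 with h4 | h4
        · simp [h4]
        · rw [Int.emod_eq_of_lt (a := 1) (by omega) (by omega), h3, Int.emod_self]
      · rw [Int.emod_eq_of_lt (a := 1) (by omega) (by omega), Int.emod_eq_of_lt] <;> omega
    have key : ∀ (a b : ℕ) (ha : a < L.length) (hb : b < L.length),
        (b = a + 1 ∨ a + 1 = L.length ∧ b = 0) → Γ.Turn L[a] L[b] := by
      rintro a b ha hb (rfl | ⟨ha', rfl⟩)
      · exact hc.getElem a hb
      · obtain rfl : a = L.length - 1 := by omega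
        rw [← List.getLast_eq_getElem h, ← List.head_eq_getElem h]
        exact hl
    apply key
    rw [e]
    split_ifs with h3 <;> omega

theorem dart_ofList {L : List (E × Bool)} (h : L ≠ []) (hc : L.IsChain Γ.Turn)
    (hl : Γ.Turn (L.getLast h) (L.head h)) (i : ℕ) (hi : i < L.length) :
    (ofList L h hc hl).dart i = L[i] := by
  have e : (((i : ℤ) % L.length).toNat) = i := by
    rw [Int.emod_eq_of_lt] <;> omega
  simp [ofList, e]

theorem edges_ofList {L : List (E × Bool)} (h : L ≠ []) (hc : L.IsChain Γ.Turn)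
    (hl : Γ.Turn (L.getLast h) (L.head h)) :
    (ofList L h hc hl).edges = (L.map Prod.fst : List E) := by
  have e : L.map Prod.fst = (List.range L.length).map
      fun i : ℕ => ((ofList L h hc hl).dart i).1 := by
    apply List.ext_getElem
    · simp
    · intro i h1 h2
      simp only [List.getElem_map, List.getElem_range]
      rw [dart_ofList]
  rw [e]
  rfl

theorem sum_ofList {R : Type*} [AddCommMonoid R] {L : List (E × Bool)} (h : L ≠ [])
    (hc : L.IsChain Γ.Turn) (hl : Γ.Turn (L.getLast h) (L.head h)) (f : E → R) :
    (ofList L h hc hl).sum f = (L.map fun d => f d.1).sum := by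
  rw [← edges_sum, edges_ofList]
  simp [Function.comp_def]

/-- The list of the oriented edges in a period. -/
def toList : List (E × Bool) := (List.range c.len).map fun i : ℕ => c.dart i

@[simp] theorem length_toList : c.toList.length = c.len := by simp [toList]

theorem toList_ne_nil : c.toList ≠ [] := by
  rw [← List.length_pos_iff, length_toList]
  exact c.pos

theorem getElem_toList (i : ℕ) (hi : i < c.toList.length) : c.toList[i] = c.dart i := by
  simp [toList]

theorem isChain_toList : c.toList.IsChain Γ.Turn := by
  rw [List.isChain_iff_getElem]
  intro i hi
  rw [getElem_toList, getElem_toList]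
  exact_mod_cast c.turn i

theorem head_toList : c.toList.head c.toList_ne_nil = c.dart 0 := by
  rw [List.head_eq_getElem, getElem_toList]
  rfl

theorem getLast_toList : c.toList.getLast c.toList_ne_nil = c.dart (-1) := by
  rw [List.getLast_eq_getElem, getElem_toList, length_toList]
  have := c.periodic (-1)
  rw [← this]
  congr 1
  have := c.pos
  omega

theorem turn_toList :
    Γ.Turn (c.toList.getLast c.toList_ne_nil) (c.toList.head c.toList_ne_nil) := by
  rw [head_toList, getLast_toList]
  exact c.turn (-1)

theorem sum_toList {R : Type*} [AddCommMonoid R] (f : E → R) :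
    (c.toList.map fun d => f d.1).sum = c.sum f := by
  rw [sum, Finset.sum, Finset.range_val, toList, List.map_map]
  rfl

/-- The circuit with the opposite orientation. -/
def reverse : Γ.Circuit where
  len := c.len
  pos := c.pos
  dart i := rev (c.dart (-i))
  periodic i := by
    have := c.periodic (-i - c.len)
    rw [show -(i + (c.len : ℤ)) = -i - c.len by ring, ← this]
    congr 2
    ring
  turn i := by
    have := (c.turn (-(i + 1))).reverse
    rwa [show -(i + 1) + 1 = -i by ring] at this

/-- The circuit with another starting point. -/
def shift (k : ℤ) : Γ.Circuit where
  len := c.len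
  pos := c.pos
  dart i := c.dart (i + k)
  periodic i := by rw [add_right_comm, c.periodic]
  turn i := by
    have := c.turn (i + k)
    rwa [add_right_comm] at this

end Circuit

/-- With `Circuit.exists_loop` this allows every statement about sums over loops to be proved for
circuits, where times are integers and cutting is available. -/
theorem Loop.exists_circuit (α : Γ.Loop) : ∃ c : Γ.Circuit, c.edges = α.edges := by
  rcases α with ⟨α, h, hc⟩
  induction α using Quotient.inductionOn with | h L =>
  have hL : L ≠ [] := fun h' => h (by subst h'; rfl)
  obtain ⟨a, l, rfl⟩ := List.exists_cons_of_ne_nil hL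
  have hc' : Cycle.Chain Γ.Turn ((a :: l : List (E × Bool)) : Cycle (E × Bool)) := hc
  rw [Cycle.chain_coe_cons] at hc'
  have h1 : (a :: l).IsChain Γ.Turn := by
    rw [← List.cons_append] at hc'
    exact hc'.left_of_append
  have h2 : Γ.Turn ((a :: l).getLast hL) ((a :: l).head hL) := by
    rw [← List.cons_append] at hc'
    exact hc'.rel_getLast_head_of_append hL (by simp)
  exact ⟨Circuit.ofList (a :: l) hL h1 h2, Circuit.edges_ofList hL h1 h2⟩

theorem Loop.weight_eq {R : Type*} [AddCommMonoid R] {α : Γ.Loop} {c : Γ.Circuit}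
    (h : α.edges = c.edges) (f : E → R) : α.weight f = c.sum f := by
  rw [Loop.weight, h, Circuit.edges_sum]

end Circuits

end CellGraph

namespace CellGraph

open Finset

/-! ### Cutting circuits at repeated edges; potentials -/

section Splitting

variable {V E : Type*} {Γ : CellGraph V E}

theorem _root_.List.exists_eq_append_of_not_nodup {α : Type*} {L : List α} (h : ¬ L.Nodup) :
    ∃ A x B C, L = A ++ (x :: B) ++ (x :: C) := by
  induction L with
  | nil => simp at h
  | cons a l ih =>
    by_cases ha : a ∈ l
    · obtain ⟨B, C, rfl⟩ := List.append_of_mem ha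
      exact ⟨[], a, B, C, by simp⟩
    · rw [List.nodup_cons, not_and] at h
      obtain ⟨A, x, B, C, rfl⟩ := ih (h ha)
      exact ⟨a :: A, x, B, C, by simp⟩

/-- Cutting at a repeated entry creates no new adjacency: the closed piece `x :: B` closes up by the
step into the second `x`, and what is left enters the second `x` by the step into the first. -/
theorem isChain_of_repeat {α : Type*} {R : α → α → Prop} {A B C : List α} {x : α}
    (h : (A ++ (x :: B) ++ (x :: C)).IsChain R) :
    (x :: B).IsChain R ∧ R ((x :: B).getLast (by simp)) ((x :: B).head (by simp)) ∧
      (A ++ (x :: C)).IsChain R := by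
  refine ⟨h.left_of_append.right_of_append, ?_, ?_⟩
  · exact h.rel_getLast_head_of_append (l₁ := A ++ (x :: B)) (by simp) (by simp) |> fun h => by
      simpa using h
  · refine List.isChain_append.2 ⟨h.left_of_append.left_of_append, h.right_of_append, ?_⟩
    intro y hy z hz
    have := (List.isChain_append.1 h.left_of_append).2.2 y hy
    simp only [List.head?_cons, Option.mem_def, Option.some.injEq] at this hz
    exact this z hz

/-- A circuit that repeats an oriented edge splits there into two shorter circuits, and the sums add
up. -/
theorem Circuit.sum_nonneg_of_nodup {g : E → ℝ}
    (h : ∀ c : Γ.Circuit, c.toList.Nodup → 0 ≤ c.sum g) (c : Γ.Circuit) : 0 ≤ c.sum g := by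
  induction hn : c.len using Nat.strong_induction_on generalizing c with
  | _ n ih =>
    by_cases hc : c.toList.Nodup
    · exact h c hc
    obtain ⟨A, x, B, C, hL⟩ := List.exists_eq_append_of_not_nodup hc
    have h0 := c.isChain_toList
    have h1 := c.turn_toList
    have h2 := c.length_toList
    rw [hL] at h0 h2
    obtain ⟨hB, hBx, hAC⟩ := isChain_of_repeat h0
    have hl : Γ.Turn ((A ++ (x :: C)).getLast (by simp)) ((A ++ (x :: C)).head (by simp)) := by
      have e1 : (A ++ (x :: C)).getLast (by simp) = c.toList.getLast c.toList_ne_nil := by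
        simp [hL]
      have e2 : (A ++ (x :: C)).head (by simp) = c.toList.head c.toList_ne_nil := by
        cases A <;> simp [hL]
      rw [e1, e2]
      exact h1
    simp only [List.length_append, List.length_cons] at h2
    have i1 := ih (x :: B).length (by simp only [List.length_cons]; omega)
      (Circuit.ofList (x :: B) (by simp) hB hBx) rfl
    have i2 := ih (A ++ (x :: C)).length
      (by simp only [List.length_cons, List.length_append]; omega)
      (Circuit.ofList (A ++ (x :: C)) (by simp) hAC hl) rfl
    rw [Circuit.sum_ofList] at i1 i2
    rw [← c.sum_toList, hL]
    simp only [List.map_append, List.sum_append, List.map_cons, List.sum_cons] at i1 i2 ⊢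
    linarith

variable [Fintype E]

theorem neg_sum_abs_le_of_nodup (g : E → ℝ) {W : List (E × Bool)} (hW : W.Nodup) :
    -∑ d : E × Bool, |g d.1| ≤ (W.map fun d => g d.1).sum := by
  classical
  rw [← List.sum_toFinset (fun d => g d.1) hW]
  have h1 : ∑ d ∈ W.toFinset, |g d.1| ≤ ∑ d : E × Bool, |g d.1| :=
    Finset.sum_le_sum_of_subset_of_nonneg (Finset.subset_univ _) fun _ _ _ => abs_nonneg _
  have h2 := Finset.abs_sum_le_sum_abs (fun d : E × Bool => g d.1) W.toFinset
  have h3 := neg_abs_le (∑ d ∈ W.toFinset, g d.1)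
  linarith

/-- Removing closed pieces, which have nonnegative weight, leaves a path without repetition, which
is bounded below by `neg_sum_abs_le_of_nodup`. -/
theorem neg_sum_abs_le_of_isChain {g : E → ℝ} (hg : ∀ c : Γ.Circuit, 0 ≤ c.sum g)
    {d : E × Bool} (W : List (E × Bool)) (hW : (W ++ [d]).IsChain Γ.Turn) :
    -∑ d : E × Bool, |g d.1| ≤ (W.map fun d => g d.1).sum := by
  induction hn : W.length using Nat.strong_induction_on generalizing W with
  | _ n ih =>
    by_cases hd : W.Nodup
    · exact neg_sum_abs_le_of_nodup g hd
    obtain ⟨A, x, B, C, rfl⟩ := List.exists_eq_append_of_not_nodup hd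
    rw [List.append_assoc, List.cons_append] at hW
    obtain ⟨hB, hBx, hAC⟩ := isChain_of_repeat hW
    have i1 := hg (Circuit.ofList (x :: B) (by simp) hB hBx)
    rw [Circuit.sum_ofList] at i1
    have i2 := ih (A ++ (x :: C)).length (by simp at hn ⊢; omega) _ (by simpa using hAC) rfl
    simp only [List.map_append, List.sum_append, List.map_cons, List.sum_cons] at i1 i2 ⊢
    linarith

/-- A weight which is nonnegative on all circuits becomes nonnegative on all turns after adding the
coboundary of a potential. -/
theorem exists_potential {g : E → ℝ} (hg : ∀ c : Γ.Circuit, 0 ≤ c.sum g) :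
    ∃ h : E × Bool → ℝ, ∀ d d', Γ.Turn d d' → 0 ≤ g d.1 + h d - h d' := by
  -- The potential at `d` is the least weight of a path leading up to `d`, with `d` itself not
  -- counted. It is finite because closed pieces have nonnegative weight. For a turn from `d` to
  -- `d'`, appending `d` to a path leading up to `d` gives one leading up to `d'`.
  let S : E × Bool → Set ℝ := fun d =>
    {s | ∃ W : List (E × Bool), (W ++ [d]).IsChain Γ.Turn ∧ (W.map fun d => g d.1).sum = s}
  have hb : ∀ d, BddBelow (S d) := fun d => ⟨-∑ d : E × Bool, |g d.1|, by
    rintro s ⟨W, hW, rfl⟩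
    exact neg_sum_abs_le_of_isChain hg W hW⟩
  have hne : ∀ d, (S d).Nonempty := fun d => ⟨0, [], by simp, by simp⟩
  refine ⟨fun d => sInf (S d), fun d d' hd => ?_⟩
  have : sInf (S d') - g d.1 ≤ sInf (S d) := by
    refine le_csInf (hne d) ?_
    rintro s ⟨W, hW, rfl⟩
    have : sInf (S d') ≤ (W.map fun d => g d.1).sum + g d.1 := by
      refine csInf_le (hb d') ⟨W ++ [d], ?_, by simp⟩
      refine List.isChain_append.2 ⟨hW, by simp, ?_⟩
      intro y hy z hz
      simp only [List.getLast?_append, List.getLast?_singleton, Option.some_or,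
        Option.mem_def, Option.some.injEq, List.head?_cons] at hy hz
      rw [← hy, ← hz]
      exact hd
    linarith
  linarith

end Splitting

/-! ### Comparing circuits turn by turn -/

section Domination

variable {V E : Type*} {Γ : CellGraph V E}

/-- The turn `t`, crossed in the opposite direction. -/
def revTurn : (E × Bool) × (E × Bool) ≃ (E × Bool) × (E × Bool) where
  toFun t := (rev t.2, rev t.1)
  invFun t := (rev t.2, rev t.1)
  left_inv t := by simp
  right_inv t := by simp

/-- The turns made by a circuit. -/
def Circuit.turnAt (c : Γ.Circuit) (i : ℤ) : (E × Bool) × (E × Bool) := (c.dart i, c.dart (i + 1))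

open Classical in
/-- The number of times that a circuit makes a given turn. -/
noncomputable def Circuit.turnCount (c : Γ.Circuit) (t : (E × Bool) × (E × Bool)) : ℕ :=
  #{i ∈ range c.len | c.turnAt (i : ℕ) = t}

theorem Circuit.turnCount_pos {c : Γ.Circuit} {t : (E × Bool) × (E × Bool)} {i : ℤ}
    (h : c.turnAt i = t) : 1 ≤ c.turnCount t := by
  classical
  obtain ⟨k, hk, h1, h2⟩ := c.exists_nat_turn i
  refine Finset.card_pos.2 ⟨k, Finset.mem_filter.2 ⟨Finset.mem_range.2 hk, ?_⟩⟩
  rw [← h, turnAt, turnAt, h1, h2]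

theorem Circuit.turnCount_le_one {c : Γ.Circuit} (hc : c.toList.Nodup)
    (t : (E × Bool) × (E × Bool)) : c.turnCount t ≤ 1 := by
  classical
  refine Finset.card_le_one.2 fun i hi j hj => ?_
  simp only [Finset.mem_filter, Finset.mem_range] at hi hj
  have h : c.dart i = c.dart j := by
    have := hi.2.trans hj.2.symm
    exact congrArg Prod.fst this
  have e := (List.Nodup.getElem_inj_iff hc (i := i) (j := j) (hi := by simpa using hi.1)
    (hj := by simpa using hj.1)).1 (by rw [c.getElem_toList, c.getElem_toList, h])
  exact e

theorem Circuit.exists_of_turnCount_ne_zero {c : Γ.Circuit} {t : (E × Bool) × (E × Bool)}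
    (h : c.turnCount t ≠ 0) : ∃ k : ℕ, c.turnAt k = t := by
  classical
  obtain ⟨k, hk⟩ := Finset.card_ne_zero.1 h
  exact ⟨k, (Finset.mem_filter.1 hk).2⟩

variable [Fintype E]

theorem Circuit.sum_turnAt (c : Γ.Circuit) (R : (E × Bool) × (E × Bool) → ℝ) :
    ∑ i ∈ range c.len, R (c.turnAt (i : ℕ)) = ∑ t, c.turnCount t * R t := by
  classical
  rw [← Finset.sum_fiberwise_of_maps_to (t := Finset.univ)
    (g := fun i : ℕ => c.turnAt i) (fun _ _ => Finset.mem_univ _)]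
  refine Finset.sum_congr rfl fun t _ => ?_
  rw [Finset.sum_congr rfl fun i hi => by rw [(Finset.mem_filter.1 hi).2], Finset.sum_const,
    nsmul_eq_mul]
  rfl

/-- If each turn of `α` is made often enough by the circuits `β i`, then a weight which is
nonnegative on all circuits is no larger on `α` than on the `β i` together. -/
theorem Circuit.mul_sum_le_of_turnCount {ι : Type*} [Fintype ι] {g : E → ℝ}
    (hg : ∀ c : Γ.Circuit, 0 ≤ c.sum g) (α : Γ.Circuit) (hα : α.toList.Nodup)
    (β : ι → Γ.Circuit) (q : ℝ) (p : ι → ℝ) (hq : 0 ≤ q) (hp : ∀ i, 0 ≤ p i)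
    (h : ∀ k : ℕ, 2 * q ≤ ∑ i, p i * ((β i).turnCount (α.turnAt k) +
      (β i).turnCount (revTurn (α.turnAt k)))) :
    q * α.sum g ≤ ∑ i, p i * (β i).sum g := by
  classical
  obtain ⟨u, hu⟩ := exists_potential hg
  -- The corrected weight of a turn; pairs that are not turns get zero, so `r` is nonnegative
  -- everywhere. Along a circuit the potential telescopes away, in either direction of travel.
  let r : (E × Bool) × (E × Bool) → ℝ := fun t =>
    if Γ.Turn t.1 t.2 then g t.1.1 + u t.1 - u t.2 else 0
  have hr : ∀ t, 0 ≤ r t := by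
    intro t
    by_cases ht : Γ.Turn t.1 t.2
    · simpa [r, ht] using hu _ _ ht
    · simp [r, ht]
  -- The weight `g` ignores orientation but the potential does not; symmetrizing allows a turn to be
  -- replaced by its reverse.
  let R : (E × Bool) × (E × Bool) → ℝ := fun t => r t + r (revTurn t)
  have hR : ∀ t, 0 ≤ R t := fun t => add_nonneg (hr _) (hr _)
  have hR' : ∀ t, R (revTurn t) = R t := fun t => by
    have : revTurn (revTurn t) = t := revTurn.left_inv t
    simp only [R, this, add_comm]
  have h1 : ∀ c : Γ.Circuit, ∑ i ∈ range c.len, r (c.turnAt (i : ℕ)) = c.sum g := by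
    intro c
    have e : ∀ i ∈ range c.len, r (c.turnAt (i : ℕ)) =
        g (c.dart i).1 + (u (c.dart i) - u (c.dart ((i + 1 : ℕ) : ℤ))) := by
      intro i _
      have := c.turn i
      simp only [r, turnAt, this, if_true]
      push_cast
      ring
    rw [Finset.sum_congr rfl e, Finset.sum_add_distrib,
      Finset.sum_range_sub' (fun i : ℕ => u (c.dart i))]
    have := c.periodic 0
    rw [zero_add] at this
    simp [this, sum]
  have h2 : ∀ c : Γ.Circuit, ∑ i ∈ range c.len, r (revTurn (c.turnAt (i : ℕ))) = c.sum g := by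
    intro c
    have e : ∀ i ∈ range c.len, r (revTurn (c.turnAt (i : ℕ))) = g (c.dart i).1 +
        ((g (c.dart ((i + 1 : ℕ) : ℤ)).1 + u (rev (c.dart ((i + 1 : ℕ) : ℤ)))) -
          (g (c.dart i).1 + u (rev (c.dart i)))) := by
      intro i _
      have := (c.turn i).reverse
      simp only [r, turnAt, revTurn, Equiv.coe_fn_mk, this, if_true, rev_fst]
      push_cast
      ring
    rw [Finset.sum_congr rfl e, Finset.sum_add_distrib,
      Finset.sum_range_sub (fun i : ℕ => g (c.dart i).1 + u (rev (c.dart i)))]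
    have := c.periodic 0
    rw [zero_add] at this
    simp [this, sum]
  have h3 : ∀ c : Γ.Circuit,
      4 * c.sum g = ∑ t, ((c.turnCount t : ℝ) + c.turnCount (revTurn t)) * R t := by
    intro c
    have e1 : 2 * c.sum g = ∑ t, c.turnCount t * R t := by
      rw [← c.sum_turnAt, Finset.sum_add_distrib, h1, h2]
      ring
    have e2 : ∑ t, (c.turnCount (revTurn t) : ℝ) * R t = ∑ t, c.turnCount t * R t := by
      rw [← Equiv.sum_comp revTurn fun t => (c.turnCount t : ℝ) * R t]
      exact Finset.sum_congr rfl fun t _ => by rw [hR']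
    simp only [add_mul, Finset.sum_add_distrib]
    rw [e2, ← e1]
    ring
  have key : q * (4 * α.sum g) ≤ ∑ i, p i * (4 * (β i).sum g) := by
    simp only [h3, Finset.mul_sum]
    rw [Finset.sum_comm]
    refine Finset.sum_le_sum fun t _ => ?_
    have e : ∀ i, p i * (((β i).turnCount t + (β i).turnCount (revTurn t)) * R t) =
        p i * ((β i).turnCount t + (β i).turnCount (revTurn t)) * R t := fun i => by ring
    rw [Finset.sum_congr rfl fun i _ => e i, ← Finset.sum_mul, ← mul_assoc]
    refine mul_le_mul_of_nonneg_right ?_ (hR t)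
    -- Here the absence of repeated oriented edges enters: `α` makes the turn at most once in each
    -- direction. This is the source of the factor `2` in the hypothesis `h`.
    have hb : ((α.turnCount t : ℝ) + α.turnCount (revTurn t)) ≤ 2 := by
      have i1 := turnCount_le_one hα t
      have i2 := turnCount_le_one hα (revTurn t)
      exact_mod_cast (by omega : α.turnCount t + α.turnCount (revTurn t) ≤ 2)
    have hb' : q * ((α.turnCount t : ℝ) + α.turnCount (revTurn t)) ≤ 2 * q := by nlinarith
    by_cases ht : α.turnCount t ≠ 0
    · obtain ⟨k, rfl⟩ := exists_of_turnCount_ne_zero ht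
      exact hb'.trans (h k)
    by_cases ht' : α.turnCount (revTurn t) ≠ 0
    · obtain ⟨k, hk⟩ := exists_of_turnCount_ne_zero ht'
      refine hb'.trans ((h k).trans_eq ?_)
      have : revTurn (revTurn t) = t := revTurn.left_inv t
      rw [hk, this]
      exact Finset.sum_congr rfl fun i _ => by ring
    · push Not at ht ht'
      rw [ht, ht']
      simp only [Nat.cast_zero, add_zero, mul_zero]
      exact Finset.sum_nonneg fun i _ => mul_nonneg (hp i) (by positivity)
  have e : ∑ i, p i * (4 * (β i).sum g) = 4 * ∑ i, p i * (β i).sum g := by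
    rw [Finset.mul_sum]
    exact Finset.sum_congr rfl fun i _ => by ring
  rw [e] at key
  linarith

end Domination

end CellGraph

namespace CellGraph

open Finset

/-! ### Finiteness and boundedness in the presence of zero-length edges -/

section Lengths

variable {V E : Type*} {Γ : CellGraph V E} {ℓ : E → ℝ}

/-- The edges of length zero contain no loop. -/
def IsForestMetric (Γ : CellGraph V E) (ℓ : E → ℝ) : Prop :=
  (∀ e, 0 ≤ ℓ e) ∧ ∀ c : Γ.Circuit, ∃ i, ℓ (c.dart i).1 ≠ 0

theorem IsForestMetric.sum_pos (h : IsForestMetric Γ ℓ) (c : Γ.Circuit) : 0 < c.sum ℓ := by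
  obtain ⟨i, hi⟩ := h.2 c
  obtain ⟨k, hk, hd⟩ := c.exists_nat i
  refine Finset.sum_pos' (fun _ _ => h.1 _) ⟨k, Finset.mem_range.2 hk, ?_⟩
  rw [hd]
  exact lt_of_le_of_ne (h.1 _) hi.symm

theorem IsMetric.isForestMetric [Fintype E] (h : Γ.IsMetric ℓ) : IsForestMetric Γ ℓ := by
  refine ⟨fun e => (h.1 e).1, fun c => ?_⟩
  obtain ⟨α, hα⟩ := c.exists_loop
  obtain ⟨e, he, h0⟩ := h.2.2 α
  rw [hα] at he
  obtain ⟨i, -, rfl⟩ := c.exists_of_mem_edges he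
  exact ⟨i, h0⟩

theorem IsForestMetric.weight_pos (h : IsForestMetric Γ ℓ) (α : Γ.Loop) : 0 < α.weight ℓ := by
  obtain ⟨c, hc⟩ := α.exists_circuit
  rw [Loop.weight_eq hc.symm]
  exact h.sum_pos c

theorem Circuit.sum_sub {c : Γ.Circuit} (f g : E → ℝ) :
    c.sum (fun e => f e - g e) = c.sum f - c.sum g := Finset.sum_sub_distrib ..

theorem Circuit.sum_const_mul {c : Γ.Circuit} (a : ℝ) (f : E → ℝ) :
    c.sum (fun e => a * f e) = a * c.sum f := (Finset.mul_sum ..).symm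

theorem Loop.card_edges (α : Γ.Loop) : α.edges.card = α.1.length := by
  rw [Loop.edges, Multiset.card_map, Cycle.card_toMultiset]

theorem Circuit.card_edges (c : Γ.Circuit) : c.edges.card = c.len := by
  rw [Circuit.edges, Multiset.card_map, Multiset.card_range]

variable [Fintype E]

theorem exists_pos_forall_le (h : ∀ e, 0 ≤ ℓ e) : ∃ ε > 0, ∀ e, ℓ e ≠ 0 → ε ≤ ℓ e := by
  classical
  rcases (Finset.univ.filter fun e => ℓ e ≠ 0).eq_empty_or_nonempty with h0 | h0
  · refine ⟨1, one_pos, fun e he => ?_⟩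
    have : e ∈ Finset.univ.filter fun e => ℓ e ≠ 0 := by simpa using he
    simp [h0] at this
  · obtain ⟨e, he, hm⟩ := Finset.exists_min_image _ ℓ h0
    refine ⟨ℓ e, lt_of_le_of_ne (h e) (Finset.mem_filter.1 he).2.symm, fun e' he' => ?_⟩
    exact hm e' (by simpa using he')

/-- A circuit without repeated oriented edges has at most `card (E × Bool)` edges and length at
least the smallest positive edge length `ε`; splitting extends the resulting linear bound to all
circuits. -/
theorem IsForestMetric.exists_len_le (h : IsForestMetric Γ ℓ) :
    ∃ C : ℝ, 0 ≤ C ∧ ∀ c : Γ.Circuit, (c.len : ℝ) ≤ C * c.sum ℓ := by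
  obtain ⟨ε, hε, hε'⟩ := exists_pos_forall_le h.1
  refine ⟨Fintype.card (E × Bool) / ε, by positivity, fun c => ?_⟩
  have key := Circuit.sum_nonneg_of_nodup (Γ := Γ)
    (g := fun e => Fintype.card (E × Bool) * ℓ e - ε * 1) ?_ c
  · rw [Circuit.sum_sub, Circuit.sum_const_mul, Circuit.sum_const_mul] at key
    have e : c.sum (fun _ => (1 : ℝ)) = c.len := by simp [Circuit.sum]
    rw [e] at key
    rw [div_mul_eq_mul_div, le_div_iff₀ hε]
    linarith
  · intro c hc
    rw [Circuit.sum_sub, Circuit.sum_const_mul, Circuit.sum_const_mul]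
    have e : c.sum (fun _ => (1 : ℝ)) = c.len := by simp [Circuit.sum]
    have h1 : (c.len : ℝ) ≤ Fintype.card (E × Bool) := by
      rw [← c.length_toList]
      exact_mod_cast hc.length_le_card
    have h2 : ε ≤ c.sum ℓ := by
      obtain ⟨i, hi⟩ := h.2 c
      obtain ⟨k, hk, hd⟩ := c.exists_nat i
      refine (hε' _ hi).trans ?_
      rw [← hd]
      exact Finset.single_le_sum (f := fun i : ℕ => ℓ (c.dart i).1) (fun _ _ => h.1 _)
        (Finset.mem_range.2 hk)
    rw [e]
    nlinarith [Nat.cast_nonneg (α := ℝ) c.len]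

theorem IsForestMetric.finite_loops (h : IsForestMetric Γ ℓ) (B : ℝ) :
    {α : Γ.Loop | α.weight ℓ ≤ B}.Finite := by
  obtain ⟨C, hC, hlen⟩ := h.exists_len_le
  obtain ⟨n, hn⟩ := exists_nat_ge (C * B)
  refine Set.Finite.of_finite_image (f := Subtype.val) ?_ Subtype.val_injective.injOn
  refine ((List.finite_length_le (E × Bool) n).image
    (fun l : List (E × Bool) => (l : Cycle (E × Bool)))).subset ?_
  rintro _ ⟨α, hα, rfl⟩
  obtain ⟨c, hc⟩ := α.exists_circuit
  have h1 : (α.1.length : ℝ) ≤ n := by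
    rw [← Loop.card_edges, ← hc, Circuit.card_edges]
    rw [Set.mem_ofPred_eq, Loop.weight_eq hc.symm] at hα
    exact ((hlen c).trans (mul_le_mul_of_nonneg_left hα hC)).trans hn
  have h2 : α.1.length ≤ n := by exact_mod_cast h1
  revert h2
  induction α.1 using Quotient.inductionOn with | h l =>
  exact fun h2 => ⟨l, h2, rfl⟩

theorem IsForestMetric.bddAbove_ratios (h : IsForestMetric Γ ℓ) (τ : E → ℝ) :
    BddAbove (Γ.ratios ℓ τ) := by
  obtain ⟨C, hC, hlen⟩ := h.exists_len_le
  refine ⟨(∑ e, |τ e|) * C, ?_⟩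
  rintro _ ⟨α, rfl⟩
  obtain ⟨c, hc⟩ := α.exists_circuit
  simp only [Loop.weight_eq hc.symm]
  rw [div_le_iff₀ (h.sum_pos c)]
  have h1 : c.sum τ ≤ ∑ i ∈ range c.len, ∑ e, |τ e| :=
    Finset.sum_le_sum fun i _ => (le_abs_self _).trans
      (Finset.single_le_sum (f := fun e => |τ e|) (fun _ _ => abs_nonneg _) (Finset.mem_univ _))
  rw [Finset.sum_const, Finset.card_range, nsmul_eq_mul] at h1
  have h2 : 0 ≤ ∑ e, |τ e| := Finset.sum_nonneg fun _ _ => abs_nonneg _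
  nlinarith [hlen c]

theorem IsForestMetric.sum_le_normL_mul (h : IsForestMetric Γ ℓ) (τ : E → ℝ) (c : Γ.Circuit) :
    c.sum τ ≤ Γ.normL ℓ τ * c.sum ℓ := by
  obtain ⟨α, hα⟩ := c.exists_loop
  rw [← div_le_iff₀ (h.sum_pos c), ← Loop.weight_eq hα, ← Loop.weight_eq hα]
  exact le_csSup (h.bddAbove_ratios τ) ⟨α, rfl⟩

end Lengths

/-! ### Consequences of the valence condition -/

section Valence

variable {V E : Type*} {Γ : CellGraph V E}

/-- If no vertex is an end of the graph then every oriented edge has a successor, such that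
the successor map is a permutation. -/
theorem exists_turn_perm [Finite E] (h : ∀ v, 2 < Γ.valence v) :
    ∃ φ : Equiv.Perm (E × Bool), ∀ d, Γ.Turn d (φ d) := by
  classical
  -- A single cycle through all oriented edges issuing from `v` has no fixed point, as there are at
  -- least two of them.
  have hπ : ∀ v, ∃ π : Equiv.Perm {d : E × Bool // Γ.start d = v}, ∀ d, π d ≠ d := by
    intro v
    have := Fintype.ofFinite {d : E × Bool // Γ.start d = v}
    obtain ⟨π, hπ, -⟩ := (Finset.univ : Finset {d : E × Bool // Γ.start d = v}).exists_cycleOn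
    refine ⟨π, fun d => hπ.apply_ne ?_ (by simp)⟩
    have h2 := h v
    rw [valence, Nat.card_eq_fintype_card] at h2
    rw [Finset.coe_univ, Set.nontrivial_univ_iff, ← Fintype.one_lt_card_iff_nontrivial]
    omega
  choose π hπ using hπ
  let ψ : Equiv.Perm (E × Bool) := (Equiv.sigmaFiberEquiv Γ.start).symm.trans
    ((Equiv.sigmaCongrRight π).trans (Equiv.sigmaFiberEquiv Γ.start))
  have hψ : ∀ d, ψ d = (π (Γ.start d) ⟨d, rfl⟩).1 := fun d => rfl
  let r : Equiv.Perm (E × Bool) := ⟨rev, rev, rev_rev, rev_rev⟩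
  -- Reverse `d`, then rotate around the vertex: the result issues from the end of `d` and is not
  -- the reverse of `d`.
  refine ⟨r.trans ψ, fun d => ⟨?_, ?_⟩⟩
  · change Γ.finish d = Γ.start (ψ (rev d))
    rw [hψ, (π (Γ.start (rev d)) ⟨rev d, rfl⟩).2, start_rev]
  · change ψ (rev d) ≠ rev d
    rw [hψ]
    exact fun h => hπ _ _ (Subtype.ext h)

theorem exists_circuit_through [Finite E] (h : ∀ v, 2 < Γ.valence v) (d : E × Bool) :
    ∃ c : Γ.Circuit, c.dart 0 = d := by
  obtain ⟨φ, hφ⟩ := exists_turn_perm h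
  refine ⟨⟨orderOf φ, orderOf_pos φ, fun i => (φ ^ i) d, fun i => ?_, fun i => ?_⟩, by simp⟩
  · rw [zpow_add, zpow_natCast, pow_orderOf_eq_one, mul_one]
  · rw [add_comm, zpow_add, zpow_one]
    exact hφ _

theorem nonempty_edges [Finite E] [Nonempty V] (h : ∀ v, 2 < Γ.valence v) : Nonempty E := by
  obtain ⟨v⟩ := ‹Nonempty V›
  have h2 := h v
  by_contra hE
  rw [not_nonempty_iff] at hE
  simp [valence] at h2

/-- The orbits of the permutation from `exists_turn_perm` are circuits that together cross every
edge once in each direction. On this family `τ` sums to zero and `ℓ` to `2`; summing `g` plus the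
coboundary of its potential over all oriented edges gives `0 ≤ 2 M`. -/
theorem normL_nonneg [Fintype E] (h : ∀ v, 2 < Γ.valence v) {ℓ τ : E → ℝ}
    (hℓ : IsForestMetric Γ ℓ) (h1 : ∑ e, ℓ e = 1) (hτ : ∑ e, τ e = 0) : 0 ≤ Γ.normL ℓ τ := by
  obtain ⟨φ, hφ⟩ := exists_turn_perm h
  obtain ⟨u, hu⟩ := exists_potential (Γ := Γ) (g := fun e => Γ.normL ℓ τ * ℓ e - τ e) fun c => by
    rw [Circuit.sum_sub, Circuit.sum_const_mul]
    exact sub_nonneg.2 (hℓ.sum_le_normL_mul τ c)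
  have h2 : 0 ≤ ∑ d : E × Bool, (Γ.normL ℓ τ * ℓ d.1 - τ d.1 + u d - u (φ d)) :=
    Finset.sum_nonneg fun d _ => hu d _ (hφ d)
  rw [Finset.sum_sub_distrib, Equiv.sum_comp φ u, Finset.sum_add_distrib, add_sub_cancel_right,
    Fintype.sum_prod_type] at h2
  simp only [Finset.sum_const, Finset.card_univ, Fintype.card_bool, ← Finset.smul_sum,
    Finset.sum_sub_distrib, ← Finset.mul_sum, h1, hτ] at h2
  simpa using h2

end Valence

end CellGraph

namespace CellGraph

open Finset

/-! ### Simple circuits and forced turns -/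

section SimpleCircuits

variable {V E : Type*} {Γ : CellGraph V E}

theorem Circuit.dart_congr (c : Γ.Circuit) {i j : ℤ} (h : (c.len : ℤ) ∣ j - i) :
    c.dart i = c.dart j := by
  obtain ⟨k, hk⟩ := h
  rw [show j = i + k * c.len by linarith, c.dart_add_mul]

/-- A circuit is simple if it visits no vertex twice in a period. -/
def Circuit.IsSimple (c : Γ.Circuit) : Prop :=
  ∀ i j, Γ.start (c.dart i) = Γ.start (c.dart j) → (c.len : ℤ) ∣ j - i

/-- A second crossing in the opposite direction would make the vertices at times `i` and `j + 1`
agree, hence also the oriented edges, and the circuit would backtrack at time `j`. -/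
theorem Circuit.IsSimple.dvd_of_fst_eq {c : Γ.Circuit} (hc : c.IsSimple) {i j : ℤ}
    (h : (c.dart i).1 = (c.dart j).1) : (c.len : ℤ) ∣ j - i := by
  rcases eq_or_eq_rev_of_fst_eq h with h | h
  · exact hc _ _ (by rw [h])
  · have h1 : Γ.start (c.dart i) = Γ.start (c.dart (j + 1)) := by
      rw [h, start_rev, (c.turn j).1]
    have h2 := c.dart_congr (hc _ _ h1)
    exact absurd (h2.symm.trans h) (c.turn j).2

theorem Circuit.IsSimple.nodup_edges {c : Γ.Circuit} (hc : c.IsSimple) : c.edges.Nodup := by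
  refine Multiset.Nodup.map_on ?_ (Multiset.nodup_range _)
  intro i hi j hj h
  rw [Multiset.mem_range] at hi hj
  obtain ⟨k, hk⟩ := hc.dvd_of_fst_eq h
  have : k = 0 := by
    by_contra hk0
    have : |(c.len : ℤ)| ≤ |(j : ℤ) - i| := by
      rw [hk, abs_mul]
      exact le_mul_of_one_le_right (abs_nonneg _) (Int.one_le_abs hk0)
    rw [Nat.abs_cast] at this
    have : |(j : ℤ) - i| < c.len := by
      rw [abs_lt]
      omega
    omega
  rw [this, mul_zero] at hk
  omega

variable {ℓ : E → ℝ}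

/-- If `β` leaves `c` at the end of the last edge of `c`, follow it up to its next edge of positive
length. That edge lies on `c`, so the zero-length stretch in between returns to `c`, against `hw`.
If the stretch is empty, the next edge lies on the simple circuit `c` itself, and can only be the
first edge of `c` or a backtrack. -/
theorem Circuit.dart_succ_eq_of_forced {c β : Γ.Circuit} (hℓ : IsForestMetric Γ ℓ)
    (hc : c.IsSimple)
    (hw : ∀ W : List (E × Bool), ∀ hW : W ≠ [], W.IsChain Γ.Turn →
      Γ.start (W.head hW) = Γ.start (c.dart 0) → W.head hW ≠ c.dart 0 →
      W.head hW ≠ rev (c.dart (-1)) → (∀ d ∈ W, ℓ d.1 = 0) →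
      ∀ j, Γ.finish (W.getLast hW) ≠ Γ.start (c.dart j))
    (hβ : ∀ i, ℓ (β.dart i).1 ≠ 0 → ∃ j, (β.dart i).1 = (c.dart j).1)
    {k : ℤ} (hk : β.dart k = c.dart (-1)) : β.dart (k + 1) = c.dart 0 := by
  classical
  by_contra hne
  have hst : Γ.start (β.dart (k + 1)) = Γ.start (c.dart 0) := by
    rw [← (β.turn k).1, hk]
    exact (c.turn (-1)).1
  have hnr : β.dart (k + 1) ≠ rev (c.dart (-1)) := by
    rw [← hk]
    exact (β.turn k).2
  have hex : ∃ n : ℕ, ℓ (β.dart (k + 1 + n)).1 ≠ 0 := by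
    obtain ⟨i, hi⟩ := hℓ.2 (β.shift (k + 1))
    obtain ⟨n, -, hn⟩ := (β.shift (k + 1)).exists_nat i
    refine ⟨n, ?_⟩
    rw [← hn] at hi
    rwa [add_comm]
  obtain ⟨n, hn, hmin⟩ : ∃ n : ℕ, ℓ (β.dart (k + 1 + n)).1 ≠ 0 ∧
      ∀ m < n, ℓ (β.dart (k + 1 + m)).1 = 0 :=
    ⟨Nat.find hex, Nat.find_spec hex, fun m hm => not_not.1 (Nat.find_min hex hm)⟩
  obtain ⟨j, hj⟩ := hβ _ hn
  rcases Nat.eq_zero_or_pos n with rfl | hn0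
  · rw [Nat.cast_zero, add_zero] at hj
    rcases eq_or_eq_rev_of_fst_eq hj with h | h
    · refine hne (h.trans (c.dart_congr (hc _ _ ?_)))
      rw [← h, hst]
    · refine hnr (h.trans (congrArg rev (c.dart_congr ?_)))
      have h1 : Γ.start (c.dart (j + 1)) = Γ.start (c.dart 0) := by
        rw [← hst, h, start_rev, (c.turn j).1]
      have := hc _ _ h1
      convert this using 1
      ring
  · let W : List (E × Bool) := (List.range n).map fun i : ℕ => β.dart (k + 1 + i)
    have hlen : W.length = n := by simp [W]
    have hW : W ≠ [] := by
      rw [← List.length_pos_iff, hlen]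
      exact hn0
    have hhead : W.head hW = β.dart (k + 1) := by
      rw [List.head_eq_getElem]
      simp [W]
    have hlast : W.getLast hW = β.dart (k + n) := by
      rw [List.getLast_eq_getElem]
      simp only [W, List.getElem_map, List.getElem_range, List.length_map, List.length_range]
      congr 1
      omega
    have hfin : Γ.finish (W.getLast hW) = Γ.start (β.dart (k + 1 + n)) := by
      rw [hlast, (β.turn _).1]
      congr 2
      ring
    have hkey := hw W hW ?_ (by rw [hhead, hst]) (by rwa [hhead]) (by rwa [hhead]) ?_
    · rcases eq_or_eq_rev_of_fst_eq hj with h | h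
      · exact hkey j (by rw [hfin, h])
      · exact hkey (j + 1) (by rw [hfin, h, start_rev, (c.turn j).1])
    · rw [List.isChain_map, List.isChain_range]
      intro m _
      have := β.turn (k + 1 + m)
      rw [add_assoc (k + 1)] at this
      exact_mod_cast this
    · intro d hd
      obtain ⟨m, hm, rfl⟩ := List.mem_map.1 hd
      exact hmin m (List.mem_range.1 hm)

/-- Suppose that no path of length zero leaves a simple circuit `c` at the vertex of the turn
`c.turnAt (-1)` and returns to it. Then this turn is made by all circuits which have the same edges
of positive length as `c` and which cross all edges of `c`. -/
theorem Circuit.exists_turnAt_of_forced {c β : Γ.Circuit} (hℓ : IsForestMetric Γ ℓ)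
    (hc : c.IsSimple)
    (hw : ∀ W : List (E × Bool), ∀ hW : W ≠ [], W.IsChain Γ.Turn →
      Γ.start (W.head hW) = Γ.start (c.dart 0) → W.head hW ≠ c.dart 0 →
      W.head hW ≠ rev (c.dart (-1)) → (∀ d ∈ W, ℓ d.1 = 0) →
      ∀ j, Γ.finish (W.getLast hW) ≠ Γ.start (c.dart j))
    (hβ : ∀ i, ℓ (β.dart i).1 ≠ 0 → ∃ j, (β.dart i).1 = (c.dart j).1)
    (hβ' : ∃ i, (β.dart i).1 = (c.dart (-1)).1) :
    ∃ k, β.turnAt k = c.turnAt (-1) ∨ β.turnAt k = revTurn (c.turnAt (-1)) := by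
  obtain ⟨k, hk⟩ := hβ'
  rcases eq_or_eq_rev_of_fst_eq hk with h | h
  · refine ⟨k, Or.inl ?_⟩
    rw [turnAt, turnAt, h, dart_succ_eq_of_forced hℓ hc hw hβ h]
    rfl
  · refine ⟨k - 1, Or.inr ?_⟩
    have h1 : β.reverse.dart (-k) = c.dart (-1) := by
      simp [reverse, h]
    have h2 := dart_succ_eq_of_forced hℓ hc hw (fun i hi => hβ (-i) hi) h1
    have h3 : rev (β.dart (k - 1)) = c.dart 0 := by
      rw [← h2]
      simp only [reverse]
      congr 2
      ring
    simp only [turnAt, revTurn, Equiv.coe_fn_mk, sub_add_cancel, h, neg_add_cancel, ← h3, rev_rev]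

end SimpleCircuits

/-! ### Comparing loops with equal chains mod 2 -/

section Parity

variable {V E : Type*} [DecidableEq E] {Γ : CellGraph V E}

theorem Multiset.sum_map_single_apply (m : Multiset E) (e : E) :
    (m.map fun e => (Pi.single e (1 : ZMod 2) : E → ZMod 2)).sum e = (m.count e : ZMod 2) := by
  induction m using Multiset.induction_on with
  | empty => simp
  | cons a m ih =>
    rw [Multiset.map_cons, Multiset.sum_cons, Pi.add_apply, ih, Multiset.count_cons, Pi.single_apply]
    push_cast
    rw [add_comm]

theorem _root_.Nat.le_of_cast_zmod_two_eq {m n : ℕ} (hm : m ≤ 1)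
    (h : (n : ZMod 2) = (m : ZMod 2)) : m ≤ n := by
  rcases Nat.eq_zero_or_pos n with rfl | hn
  · interval_cases m
    · exact le_rfl
    · exact absurd h (by decide)
  · omega

theorem Circuit.mem_edges_of_parity' {c β : Γ.Circuit} (hc : c.edges.Nodup)
    (h : ∀ e, (β.edges.count e : ZMod 2) = c.edges.count e) {e : E}
    (he : e ∈ c.edges) : e ∈ β.edges := by
  rw [← Multiset.count_pos] at he ⊢
  have := Nat.le_of_cast_zmod_two_eq (Multiset.nodup_iff_count_le_one.1 hc e) (h e)
  omega

theorem Loop.chain_apply (α : Γ.Loop) (e : E) : α.chain e = (α.edges.count e : ZMod 2) :=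
  Multiset.sum_map_single_apply _ _

variable [Fintype E]

theorem Circuit.sum_eq_sum_count (c : Γ.Circuit) (f : E → ℝ) :
    c.sum f = ∑ e, c.edges.count e * f e := by
  rw [← c.edges_sum, Finset.sum_multiset_map_count]
  simp only [nsmul_eq_mul]
  refine Finset.sum_subset (Finset.subset_univ _) fun e _ he => ?_
  rw [Multiset.mem_toFinset] at he
  rw [Multiset.count_eq_zero_of_notMem he, Nat.cast_zero, zero_mul]

variable {ℓ : E → ℝ}

/-- An edge that `c` crosses is crossed exactly once by `c` and an odd number of times by `β`. -/
theorem Circuit.sum_le_of_parity {c β : Γ.Circuit} (hℓ : ∀ e, 0 ≤ ℓ e) (hc : c.edges.Nodup)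
    (h : ∀ e, (β.edges.count e : ZMod 2) = c.edges.count e) : c.sum ℓ ≤ β.sum ℓ := by
  rw [c.sum_eq_sum_count, β.sum_eq_sum_count]
  refine Finset.sum_le_sum fun e _ => mul_le_mul_of_nonneg_right ?_ (hℓ e)
  exact_mod_cast Nat.le_of_cast_zmod_two_eq (Multiset.nodup_iff_count_le_one.1 hc e) (h e)

/-- Equality of the total lengths forces equality edge by edge, so on edges of positive length the
multiplicities agree. -/
theorem Circuit.mem_edges_of_parity {c β : Γ.Circuit} (hℓ : ∀ e, 0 ≤ ℓ e) (hc : c.edges.Nodup)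
    (h : ∀ e, (β.edges.count e : ZMod 2) = c.edges.count e) (hs : β.sum ℓ = c.sum ℓ) {e : E}
    (he : e ∈ β.edges) (h0 : ℓ e ≠ 0) : e ∈ c.edges := by
  rw [c.sum_eq_sum_count, β.sum_eq_sum_count] at hs
  have hle : ∀ e ∈ Finset.univ, (c.edges.count e : ℝ) * ℓ e ≤ β.edges.count e * ℓ e := by
    refine fun e _ => mul_le_mul_of_nonneg_right ?_ (hℓ e)
    exact_mod_cast Nat.le_of_cast_zmod_two_eq (Multiset.nodup_iff_count_le_one.1 hc e) (h e)
  have := (Finset.sum_eq_sum_iff_of_le hle).1 hs.symm e (Finset.mem_univ e)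
  have := mul_right_cancel₀ h0 this
  rw [← Multiset.count_pos] at he ⊢
  have : c.edges.count e = β.edges.count e := by exact_mod_cast this
  omega

theorem boundary_single [DecidableEq V] (e : E) :
    Γ.boundary (Pi.single e 1) = Pi.single (Γ.tgt e) 1 - Pi.single (Γ.src e) 1 := by
  rw [boundary, LinearMap.sum_apply, Finset.sum_eq_single e]
  · simp
  · intro b _ hb
    simp [Pi.single_eq_of_ne hb]
  · simp

theorem boundary_single_dart [DecidableEq V] (d : E × Bool) :
    Γ.boundary (Pi.single d.1 1) = Pi.single (Γ.finish d) 1 - Pi.single (Γ.start d) 1 := by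
  rw [boundary_single]
  rcases d with ⟨e, b⟩
  cases b
  · change _ = Pi.single (Γ.src e) 1 - Pi.single (Γ.tgt e) 1
    ext v
    simp only [Pi.sub_apply]
    rw [← neg_sub, ZMod.neg_eq_self_mod_two]
  · rfl

theorem Loop.chain_mem_H1 [DecidableEq V] (α : Γ.Loop) : α.chain ∈ Γ.H1 := by
  obtain ⟨c, hc⟩ := α.exists_circuit
  rw [Loop.chain, Loop.weight_eq hc.symm, LinearMap.mem_ker, Circuit.sum, map_sum]
  have e : ∀ i ∈ range c.len, Γ.boundary (Pi.single (c.dart i).1 1) =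
      Pi.single (Γ.start (c.dart ((i + 1 : ℕ) : ℤ))) 1 - Pi.single (Γ.start (c.dart (i : ℕ))) 1 := by
    intro i _
    rw [boundary_single_dart, (c.turn i).1]
    push_cast
    rfl
  rw [Finset.sum_congr rfl e,
    Finset.sum_range_sub fun i : ℕ => (Pi.single (Γ.start (c.dart i)) (1 : ZMod 2) : V → ZMod 2)]
  have := c.periodic 0
  rw [zero_add] at this
  simp [this]

end Parity

end CellGraph

namespace CellGraph

open Finset

/-! ### Double covers as sheet-change functions; lifting circuits -/

section Lifts

variable {V E : Type*} {Γ : CellGraph V E}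

theorem _root_.Bool.apply_eq_xor_of_bijective {f : Bool → Bool} (hf : Function.Bijective f)
    (b : Bool) : f b = (b ^^ f false) := by
  have h : f true ≠ f false := fun h => by simpa using hf.1 h
  cases b
  · simp
  · cases h1 : f true <;> cases h2 : f false <;> simp_all

namespace DoubleCover

variable (D : DoubleCover Γ)

/-- Whether the lifts of an edge change the sheet. -/
def mono (e : E) : Bool := (D.total.src (e, false)).2 ^^ (D.total.tgt (e, false)).2

theorem src_snd (e : E) (b : Bool) : (D.total.src (e, b)).2 = (b ^^ (D.total.src (e, false)).2) :=
  Bool.apply_eq_xor_of_bijective (D.src_bij e) b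

theorem tgt_snd (e : E) (b : Bool) : (D.total.tgt (e, b)).2 = (b ^^ (D.total.tgt (e, false)).2) :=
  Bool.apply_eq_xor_of_bijective (D.tgt_bij e) b

/-- The projection of an oriented edge of the cover. -/
def proj (d : (E × Bool) × Bool) : E × Bool := (d.1.1, d.2)

/-- The lift of an oriented edge that starts on the sheet `x`. -/
def lift (d : E × Bool) (x : Bool) : (E × Bool) × Bool :=
  ((d.1, x ^^ (D.total.start ((d.1, false), d.2)).2), d.2)

@[simp] theorem proj_lift (d : E × Bool) (x : Bool) : proj (D.lift d x) = d := rfl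

@[simp] theorem proj_rev (d : (E × Bool) × Bool) : proj (rev d) = rev (proj d) := rfl

theorem start_fst (d : (E × Bool) × Bool) : (D.total.start d).1 = Γ.start (proj d) := by
  rcases d with ⟨e, b⟩
  cases b
  · exact D.tgt_fst e
  · exact D.src_fst e

theorem finish_fst (d : (E × Bool) × Bool) : (D.total.finish d).1 = Γ.finish (proj d) := by
  rw [← start_rev, start_fst, proj_rev, start_rev]

theorem start_snd (e : E) (b o : Bool) :
    (D.total.start ((e, b), o)).2 = (b ^^ (D.total.start ((e, false), o)).2) := by
  cases o
  · exact D.tgt_snd e b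
  · exact D.src_snd e b

theorem start_lift (d : E × Bool) (x : Bool) : D.total.start (D.lift d x) = (Γ.start d, x) := by
  refine Prod.ext (by rw [start_fst, proj_lift]) ?_
  rw [lift, start_snd]
  simp

theorem finish_snd (d : (E × Bool) × Bool) :
    (D.total.finish d).2 = ((D.total.start d).2 ^^ D.mono d.1.1) := by
  rcases d with ⟨⟨e, b⟩, o⟩
  have h1 := D.src_snd e b
  have h2 := D.tgt_snd e b
  cases o
  · change (D.total.src (e, b)).2 = ((D.total.tgt (e, b)).2 ^^ _)
    rw [h1, h2, mono]
    cases b <;> cases (D.total.src (e, false)).2 <;> cases (D.total.tgt (e, false)).2 <;> rfl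
  · change (D.total.tgt (e, b)).2 = ((D.total.src (e, b)).2 ^^ _)
    rw [h1, h2, mono]
    cases b <;> cases (D.total.src (e, false)).2 <;> cases (D.total.tgt (e, false)).2 <;> rfl

theorem finish_lift (d : E × Bool) (x : Bool) :
    D.total.finish (D.lift d x) = (Γ.finish d, x ^^ D.mono d.1) := by
  refine Prod.ext (by rw [finish_fst, proj_lift]) ?_
  rw [finish_snd, start_lift]
  rfl

theorem lift_proj (d : (E × Bool) × Bool) : D.lift (proj d) (D.total.start d).2 = d := by
  rcases d with ⟨⟨e, b⟩, o⟩
  rw [lift, start_snd]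
  simp [proj]

theorem eq_of_proj_eq {d d' : (E × Bool) × Bool} (h : proj d = proj d')
    (hs : (D.total.start d).2 = (D.total.start d').2) : d = d' := by
  rw [← D.lift_proj d, ← D.lift_proj d', h, hs]

theorem turn_proj {d d' : (E × Bool) × Bool} (h : D.total.Turn d d') :
    Γ.Turn (proj d) (proj d') := by
  refine ⟨?_, fun h' => h.2 ?_⟩
  · rw [← finish_fst, ← start_fst, h.1]
  · refine D.eq_of_proj_eq (by rw [h', proj_rev]) ?_
    rw [start_rev, h.1]

theorem turn_lift {d d' : E × Bool} (h : Γ.Turn d d') (x : Bool) :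
    D.total.Turn (D.lift d x) (D.lift d' (x ^^ D.mono d.1)) := by
  refine ⟨?_, fun h' => h.2 ?_⟩
  · rw [finish_lift, start_lift, h.1]
  · have := congrArg proj h'
    rwa [proj_lift, proj_rev, proj_lift] at this

/-- The projection of a circuit in a double cover. -/
def projCircuit (c : D.total.Circuit) : Γ.Circuit where
  len := c.len
  pos := c.pos
  dart i := proj (c.dart i)
  periodic i := by rw [c.periodic]
  turn i := D.turn_proj (c.turn i)

theorem turnAt_projCircuit (c : D.total.Circuit) (i : ℤ) :
    (D.projCircuit c).turnAt i = ((c.turnAt i).map proj proj) := rfl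

/-- The lift of a circuit along a compatible choice of sheets. -/
def liftCircuit (c : Γ.Circuit) (x : ℤ → Bool) (hp : ∀ i, x (i + c.len) = x i)
    (hx : ∀ i, x (i + 1) = (x i ^^ D.mono (c.dart i).1)) : D.total.Circuit where
  len := c.len
  pos := c.pos
  dart i := D.lift (c.dart i) (x i)
  periodic i := by rw [c.periodic, hp]
  turn i := by
    rw [hx]
    exact D.turn_lift (c.turn i) _

theorem isForestMetric {ℓ : E → ℝ} (h : IsForestMetric Γ ℓ) :
    IsForestMetric D.total (pullback ℓ) :=
  ⟨fun e => h.1 e.1, fun c => h.2 (D.projCircuit c)⟩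

/-- A double cover with given sheet changes. -/
def ofMono (w : E → Bool) : DoubleCover Γ where
  total := ⟨fun e => (Γ.src e.1, e.2), fun e => (Γ.tgt e.1, e.2 ^^ w e.1)⟩
  src_fst _ := rfl
  tgt_fst _ := rfl
  src_bij _ := Function.bijective_id
  tgt_bij e := by
    change Function.Bijective fun b => (b ^^ w e)
    refine Function.Involutive.bijective fun b => ?_
    cases b <;> cases w e <;> rfl

@[simp] theorem mono_ofMono (w : E → Bool) : (ofMono w : DoubleCover Γ).mono = w := by
  funext e
  simp [mono, ofMono]

theorem ofMono_false : (ofMono fun _ => false : DoubleCover Γ) = trivialCover Γ := by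
  simp [ofMono, trivialCover]

@[simp] theorem mono_trivialCover : (trivialCover Γ).mono = fun _ => false := by
  rw [← ofMono_false, mono_ofMono]

/-- An isomorphism over the base either keeps or swaps the two points over each vertex. Recording
where it swaps gives `f`, and compatibility with both ends of an edge is the coboundary relation. -/
theorem iso_iff {D D' : DoubleCover Γ} : D.Iso D' ↔ ∃ f : V → Bool,
    ∀ e, D'.mono e = (D.mono e ^^ f (Γ.src e) ^^ f (Γ.tgt e)) := by
  constructor
  · rintro ⟨φ, ψ, hφ, hψ, hs, ht⟩
    have hb : ∀ v b, (φ (v, b)).2 = (b ^^ (φ (v, false)).2) := by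
      intro v b
      refine Bool.apply_eq_xor_of_bijective (f := fun b => (φ (v, b)).2) ?_ b
      refine Finite.injective_iff_bijective.1 fun b b' h => ?_
      have : φ (v, b) = φ (v, b') := Prod.ext (by rw [hφ, hφ]) h
      simpa using φ.injective this
    refine ⟨fun v => (φ (v, false)).2, fun e => ?_⟩
    have h1 : (D'.total.src (ψ (e, false))).2 = (φ (D.total.src (e, false))).2 := by rw [hs]
    have h2 : (D'.total.tgt (ψ (e, false))).2 = (φ (D.total.tgt (e, false))).2 := by rw [ht]
    have h3 := hb (D.total.src (e, false)).1 (D.total.src (e, false)).2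
    have h4 := hb (D.total.tgt (e, false)).1 (D.total.tgt (e, false)).2
    rw [Prod.mk.eta, ← h1, D.src_fst] at h3
    rw [Prod.mk.eta, ← h2, D.tgt_fst] at h4
    have h5 : ψ (e, false) = (e, (ψ (e, false)).2) := Prod.ext (hψ _) rfl
    rw [h5, D'.src_snd] at h3
    rw [h5, D'.tgt_snd] at h4
    simp only [mono]
    clear h5
    generalize (ψ (e, false)).2 = b at *
    generalize (D'.total.src (e, false)).2 = p1 at *
    generalize (D'.total.tgt (e, false)).2 = p2 at *
    generalize (D.total.src (e, false)).2 = p3 at *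
    generalize (D.total.tgt (e, false)).2 = p4 at *
    generalize (φ (Γ.src e, false)).2 = p5 at *
    generalize (φ (Γ.tgt e, false)).2 = p6 at *
    revert b p1 p2 p3 p4 p5 p6
    decide
  · rintro ⟨f, hf⟩
    let φ : V × Bool ≃ V × Bool :=
      ⟨fun v => (v.1, v.2 ^^ f v.1), fun v => (v.1, v.2 ^^ f v.1), fun v => by simp,
        fun v => by simp⟩
    -- Compatibility with initial vertices determines which pairs of lifted edges must be swapped;
    -- compatibility with terminal vertices then is `hf`.
    let g : E → Bool := fun e => (D.total.src (e, false)).2 ^^ f (Γ.src e) ^^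
      (D'.total.src (e, false)).2
    let ψ : E × Bool ≃ E × Bool :=
      ⟨fun e => (e.1, e.2 ^^ g e.1), fun e => (e.1, e.2 ^^ g e.1), fun e => by simp,
        fun e => by simp⟩
    refine ⟨φ, ψ, fun _ => rfl, fun _ => rfl, ?_, ?_⟩
    · rintro ⟨e, b⟩
      refine Prod.ext ?_ ?_
      · rw [D'.src_fst]
        exact (D.src_fst (e, b)).symm
      · change (D'.total.src (e, b ^^ g e)).2 = ((D.total.src (e, b)).2 ^^ f (D.total.src (e, b)).1)
        rw [D.src_fst, D.src_snd, D'.src_snd]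
        simp only [g]
        generalize (D'.total.src (e, false)).2 = p1
        generalize (D.total.src (e, false)).2 = p2
        generalize f (Γ.src e) = p3
        revert b p1 p2 p3
        decide
    · rintro ⟨e, b⟩
      refine Prod.ext ?_ ?_
      · rw [D'.tgt_fst]
        exact (D.tgt_fst (e, b)).symm
      · change (D'.total.tgt (e, b ^^ g e)).2 = ((D.total.tgt (e, b)).2 ^^ f (D.total.tgt (e, b)).1)
        have := hf e
        rw [D.tgt_fst, D.tgt_snd, D'.tgt_snd]
        simp only [g, mono] at this ⊢
        generalize (D'.total.src (e, false)).2 = p1 at *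
        generalize (D.total.src (e, false)).2 = p2 at *
        generalize (D'.total.tgt (e, false)).2 = p3 at *
        generalize (D.total.tgt (e, false)).2 = p4 at *
        generalize f (Γ.src e) = p5 at *
        generalize f (Γ.tgt e) = p6 at *
        revert b p1 p2 p3 p4 p5 p6
        decide

end DoubleCover

/-- A sheet change function that is not a coboundary belongs, up to a coboundary, to some nontrivial
double cover. -/
theorem exists_nontrivialCover {w : E → Bool}
    (hw : ¬ ∃ f : V → Bool, ∀ e, w e = (f (Γ.src e) ^^ f (Γ.tgt e))) :
    ∃ (N : NontrivialCover Γ) (f : V → Bool),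
      ∀ e, (Quotient.out N.1).mono e = (w e ^^ f (Γ.src e) ^^ f (Γ.tgt e)) := by
  let q : Quotient (DoubleCover.isoSetoid Γ) := Quotient.mk _ (DoubleCover.ofMono w)
  have hq : q ≠ Quotient.mk _ (trivialCover Γ) := by
    intro h
    obtain ⟨f, hf⟩ := DoubleCover.iso_iff.1 (Quotient.exact h.symm)
    rw [DoubleCover.mono_ofMono, DoubleCover.mono_trivialCover] at hf
    exact hw ⟨f, fun e => by simpa using hf e⟩
  refine ⟨⟨q, hq⟩, ?_⟩
  have h : (DoubleCover.ofMono w : DoubleCover Γ).Iso (Quotient.out q) :=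
    Quotient.exact (Quotient.out_eq q).symm
  obtain ⟨f, hf⟩ := DoubleCover.iso_iff.1 h
  rw [DoubleCover.mono_ofMono] at hf
  exact ⟨f, hf⟩

theorem NontrivialCover.mono_ne (N : NontrivialCover Γ) :
    ¬ ∃ f : V → Bool, ∀ e, (Quotient.out N.1).mono e = (f (Γ.src e) ^^ f (Γ.tgt e)) := by
  rintro ⟨f, hf⟩
  refine N.2 ?_
  rw [← Quotient.out_eq N.1]
  refine Quotient.sound (DoubleCover.iso_equivalence.symm (DoubleCover.iso_iff.2 ⟨f, fun e => ?_⟩))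
  rw [hf, DoubleCover.mono_trivialCover]
  simp

end Lifts

end CellGraph

namespace CellGraph

open Finset

/-! ### Shortest circuits through a turn -/

section Shortest

variable {V E : Type*} {Γ : CellGraph V E} {ℓ : E → ℝ}

/-- The path may backtrack at its base point. Stripping an inverse pair from its two ends leaves a
shorter closed path, which is not empty because `x` and its reverse cannot be consecutive;
eventually a circuit remains. -/
theorem IsForestMetric.exists_ne_zero_of_closed (hℓ : IsForestMetric Γ ℓ)
    (W : List (E × Bool)) (hW : W ≠ []) (hc : W.IsChain Γ.Turn)
    (hcl : Γ.finish (W.getLast hW) = Γ.start (W.head hW)) : ∃ d ∈ W, ℓ d.1 ≠ 0 := by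
  induction hn : W.length using Nat.strong_induction_on generalizing W with
  | _ n ih =>
    by_cases h : W.head hW = rev (W.getLast hW)
    · obtain ⟨x, W₁, rfl⟩ := List.exists_cons_of_ne_nil hW
      rcases List.eq_nil_or_concat' W₁ with rfl | ⟨W₂, y, rfl⟩
      · exact absurd h.symm (rev_ne x)
      · have hxy : x = rev y := by
          rw [List.head_cons] at h
          simpa using h
        have hW₂ : W₂ ≠ [] := by
          rintro rfl
          simp only [List.nil_append, List.isChain_cons_cons] at hc
          exact hc.1.2 (by rw [hxy, rev_rev])
        have h1 := (List.isChain_cons.1 hc)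
        have h2 := h1.2.rel_getLast_head_of_append hW₂ (by simp)
        have h3 : Γ.Turn x (W₂.head hW₂) := h1.1 _ (by
          rw [List.head?_append_of_ne_nil _ hW₂]
          simp [List.head?_eq_some_head hW₂])
        obtain ⟨d, hd, h0⟩ := ih W₂.length (by simp at hn; omega) W₂ hW₂ h1.2.left_of_append
          (by
            have := h2.1
            rw [List.head_singleton] at this
            rw [this, ← h3.1, hxy, finish_rev]) rfl
        exact ⟨d, by simp [hd], h0⟩
    · have hl : Γ.Turn (W.getLast hW) (W.head hW) := ⟨hcl, h⟩
      obtain ⟨i, hi⟩ := hℓ.2 (Circuit.ofList W hW hc hl)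
      have := Circuit.mem_edges (Circuit.ofList W hW hc hl) i
      rw [Circuit.edges_ofList, Multiset.mem_coe, List.mem_map] at this
      obtain ⟨d, hd, he⟩ := this
      exact ⟨d, hd, by rwa [he]⟩

namespace Circuit

/-- The same circuit with the opposite orientation, such that the turn between the last and the
first oriented edges stays at its place. -/
def flip (c : Γ.Circuit) : Γ.Circuit := c.reverse.shift 1

theorem flip_dart (c : Γ.Circuit) (i : ℤ) : c.flip.dart i = rev (c.dart (-i - 1)) := by
  change rev (c.dart (-(i + 1))) = _
  congr 2
  ring

theorem sum_flip (c : Γ.Circuit) (f : E → ℝ) : c.flip.sum f = c.sum f := by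
  rw [sum, sum, ← Finset.sum_range_reflect (fun i => f (c.dart i).1)]
  refine Finset.sum_congr rfl fun i hi => ?_
  rw [flip_dart, rev_fst, ← c.periodic]
  have : i < c.len := Finset.mem_range.1 hi
  congr 3
  omega

/-- A circuit is shortest if it is the shortest one, and among these has the least number of edges,
that makes the same turn between its last and first oriented edges. -/
def IsShortest (c : Γ.Circuit) (ℓ : E → ℝ) : Prop :=
  ∀ c' : Γ.Circuit, c'.dart 0 = c.dart 0 → c'.dart (-1) = c.dart (-1) →
    c.sum ℓ < c'.sum ℓ ∨ c.sum ℓ = c'.sum ℓ ∧ c.len ≤ c'.len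

/-- A bound on the length bounds the number of edges, so only finitely many pairs of length and
number of edges compete, and a lexicographic minimum exists. -/
theorem exists_isShortest [Fintype E] (hℓ : IsForestMetric Γ ℓ) (c : Γ.Circuit) :
    ∃ c' : Γ.Circuit, c'.dart 0 = c.dart 0 ∧ c'.dart (-1) = c.dart (-1) ∧
      c'.sum ℓ ≤ c.sum ℓ ∧ c'.IsShortest ℓ := by
  obtain ⟨C, hC, hlen⟩ := hℓ.exists_len_le
  obtain ⟨n, hn⟩ := exists_nat_ge (C * c.sum ℓ)
  let S : Set Γ.Circuit := {c' | c'.dart 0 = c.dart 0 ∧ c'.dart (-1) = c.dart (-1) ∧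
    c'.sum ℓ ≤ c.sum ℓ}
  let F : Γ.Circuit → ℝ ×ₗ ℕ := fun c' => toLex (c'.sum ℓ, c'.len)
  have hF : (F '' S).Finite := by
    refine Set.Finite.subset (((List.finite_length_le (E × Bool) n).image fun L =>
      (toLex ((L.map fun d => ℓ d.1).sum, L.length) : ℝ ×ₗ ℕ))) ?_
    rintro _ ⟨c', hc', rfl⟩
    refine ⟨c'.toList, ?_, by simp only [F, c'.sum_toList, c'.length_toList]⟩
    have h1 : (c'.len : ℝ) ≤ n :=
      ((hlen c').trans (mul_le_mul_of_nonneg_left hc'.2.2 hC)).trans hn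
    have h2 : c'.len ≤ n := by exact_mod_cast h1
    simpa using h2
  obtain ⟨_, ⟨c', hc', rfl⟩, hm⟩ := Set.exists_min_image (F '' S) id hF ⟨_, c, ⟨rfl, rfl, le_rfl⟩, rfl⟩
  refine ⟨c', hc'.1, hc'.2.1, hc'.2.2, fun c'' h0 h1 => ?_⟩
  by_cases hle : c''.sum ℓ ≤ c.sum ℓ
  · have := hm _ ⟨c'', ⟨h0.trans hc'.1, h1.trans hc'.2.1, hle⟩, rfl⟩
    simpa [F, Prod.Lex.toLex_le_toLex] using this
  · exact Or.inl (hc'.2.2.trans_lt (not_le.1 hle))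

variable {c : Γ.Circuit}

theorem IsShortest.flip (h : c.IsShortest ℓ) : c.flip.IsShortest ℓ := by
  intro c' h0 h1
  have := h c'.flip (by rw [flip_dart, neg_zero, zero_sub, h1, flip_dart]; simp)
    (by rw [flip_dart, neg_neg, sub_self, h0, flip_dart]; simp)
  rwa [sum_flip, ← sum_flip c] at this

theorem IsShortest.lt_or_le_length (h : c.IsShortest ℓ) {L : List (E × Bool)} (hL : L ≠ [])
    (hc : L.IsChain Γ.Turn) (h0 : L.head hL = c.dart 0) (h1 : L.getLast hL = c.dart (-1)) :
    c.sum ℓ < (L.map fun d => ℓ d.1).sum ∨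
      c.sum ℓ = (L.map fun d => ℓ d.1).sum ∧ c.len ≤ L.length := by
  have hl : Γ.Turn (L.getLast hL) (L.head hL) := by
    rw [h0, h1]
    exact c.turn (-1)
  have := h (ofList L hL hc hl) ?_ ?_
  · rwa [sum_ofList] at this
  · rw [← h0, List.head_eq_getElem, ← dart_ofList hL hc hl]
    rfl
  · have h2 := (ofList L hL hc hl).getLast_toList
    rw [← h2, ← h1, List.getLast_eq_getElem, List.getLast_eq_getElem, getElem_toList,
      dart_ofList]
    · simp only [length_toList]
      rfl
    · rw [length_toList]
      exact Nat.sub_lt (List.length_pos_iff.2 hL) one_pos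

theorem sum_map_nonneg (hℓ : ∀ e, 0 ≤ ℓ e) (L : List (E × Bool)) :
    0 ≤ (L.map fun d => ℓ d.1).sum :=
  List.sum_nonneg fun x hx => by
    obtain ⟨d, -, rfl⟩ := List.mem_map.1 hx
    exact hℓ _

/-- Cutting out the closed piece between two crossings keeps the first and last oriented edges, does
not increase the length, and lowers the number of edges. -/
theorem IsShortest.nodup (h : c.IsShortest ℓ) (hℓ : ∀ e, 0 ≤ ℓ e) : c.toList.Nodup := by
  by_contra hd
  obtain ⟨A, x, B, C, hL⟩ := List.exists_eq_append_of_not_nodup hd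
  have hc := c.isChain_toList
  rw [hL] at hc
  obtain ⟨-, -, hAC⟩ := isChain_of_repeat hc
  have e1 : (A ++ (x :: C)).head (by simp) = c.dart 0 := by
    rw [← c.head_toList]
    cases A <;> simp [hL]
  have e2 : (A ++ (x :: C)).getLast (by simp) = c.dart (-1) := by
    rw [← c.getLast_toList]
    simp [hL]
  have h1 := h.lt_or_le_length (by simp) hAC e1 e2
  have h2 := c.length_toList
  have h3 := c.sum_toList ℓ
  have h4 := sum_map_nonneg hℓ (x :: B)
  rw [hL] at h2 h3
  simp only [List.map_append, List.sum_append, List.length_append, List.map_cons, List.sum_cons,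
    List.length_cons] at h1 h2 h3 h4
  rcases h1 with h1 | h1
  · linarith
  · omega

theorem IsShortest.eq_of_dart_eq (h : c.IsShortest ℓ) (hℓ : ∀ e, 0 ≤ ℓ e) {i j : ℕ}
    (hi : i < c.len) (hj : j < c.len) (hd : c.dart i = c.dart j) : i = j :=
  (List.Nodup.getElem_inj_iff (h.nodup hℓ) (i := i) (j := j) (hi := by simpa using hi)
    (hj := by simpa using hj)).1 (by rw [c.getElem_toList, c.getElem_toList, hd])

/-- Cutting out the closed piece between times `i + 1` and `j` would contradict minimality, so the
cut must create a backtrack. -/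
theorem IsShortest.dart_eq_rev (h : c.IsShortest ℓ) (hℓ : ∀ e, 0 ≤ ℓ e) {i j : ℕ} (hij : i + 1 < j)
    (hj : j < c.len) (hs : Γ.start (c.dart (i + 1)) = Γ.start (c.dart j)) :
    c.dart j = rev (c.dart i) := by
  by_contra hne
  have hl := c.length_toList
  have n1 : c.toList.take (i + 1) ≠ [] := by
    rw [← List.length_pos_iff, List.length_take]
    omega
  have n2 : c.toList.drop j ≠ [] := by
    rw [← List.length_pos_iff, List.length_drop]
    omega
  have l1 : (c.toList.take (i + 1)).getLast n1 = c.dart i := by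
    rw [List.getLast_eq_getElem, List.getElem_take, getElem_toList]
    congr 2
    rw [List.length_take]
    omega
  have l2 : (c.toList.drop j).head n2 = c.dart j := by
    rw [List.head_eq_getElem, List.getElem_drop, getElem_toList]
    congr 2
  have hc : (c.toList.take (i + 1) ++ c.toList.drop j).IsChain Γ.Turn := by
    refine List.isChain_append.2 ⟨c.isChain_toList.take _, c.isChain_toList.drop _, ?_⟩
    intro x hx y hy
    rw [List.getLast?_eq_some_getLast n1, l1] at hx
    rw [List.head?_eq_some_head n2, l2] at hy
    obtain rfl : c.dart i = x := by simpa using hx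
    obtain rfl : c.dart j = y := by simpa using hy
    exact ⟨by rw [(c.turn i).1, hs], hne⟩
  have h1 := h.lt_or_le_length (by simp [n1]) hc
    (by
      rw [List.head_append_of_ne_nil n1, ← c.head_toList]
      simp [List.head_take])
    (by
      rw [List.getLast_append_of_ne_nil _ n2, ← c.getLast_toList]
      simp [List.getLast_drop])
  have h2 : c.toList = c.toList.take (i + 1) ++ (c.toList.drop (i + 1)).take (j - (i + 1)) ++
      c.toList.drop j := by
    conv_lhs => rw [← List.take_append_drop (i + 1) c.toList,
      ← List.take_append_drop (j - (i + 1)) (c.toList.drop (i + 1)), List.drop_drop]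
    rw [List.append_assoc]
    congr 3
    omega
  have h3 := c.sum_toList ℓ
  rw [h2] at h3
  have h4 := sum_map_nonneg hℓ ((c.toList.drop (i + 1)).take (j - (i + 1)))
  simp only [List.map_append, List.sum_append, List.length_append, List.length_take,
    List.length_drop, hl] at h1 h3 h4
  rcases h1 with h1 | h1
  · linarith
  · omega

theorem dart_len (c : Γ.Circuit) : c.dart c.len = c.dart 0 := by
  simpa using c.periodic 0

theorem start_dart_succ (c : Γ.Circuit) (i : ℕ) :
    Γ.start (c.dart ((i + 1 : ℕ) : ℤ)) = Γ.finish (c.dart i) := by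
  push_cast
  exact (c.turn i).1.symm

theorem turn_nat (c : Γ.Circuit) (i : ℕ) :
    Γ.Turn (c.dart i) (c.dart ((i + 1 : ℕ) : ℤ)) := by
  push_cast
  exact c.turn i

/-- Once `dart_eq_rev` applies, the vertices one step earlier and one step later agree again, and it
applies to them: the circuit has the shape of a lollipop whose stick is retraced. -/
theorem IsShortest.dart_eq_rev_of_add (h : c.IsShortest ℓ) (hℓ : ∀ e, 0 ≤ ℓ e) {i j : ℕ}
    (hij : i + 1 < j) (hs : Γ.start (c.dart ((i + 1 : ℕ) : ℤ)) = Γ.start (c.dart j)) (s : ℕ)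
    (hsi : s ≤ i) (hsj : j + s < c.len) :
    c.dart ((j + s : ℕ) : ℤ) = rev (c.dart ((i - s : ℕ) : ℤ)) := by
  induction s with
  | zero => exact h.dart_eq_rev hℓ hij hsj (by exact_mod_cast hs)
  | succ s ih =>
    have := ih (by omega) (by omega)
    refine h.dart_eq_rev hℓ (i := i - (s + 1)) (by omega) (by omega) ?_
    have e : (((i - (s + 1) : ℕ) : ℤ) + 1) = ((i - s : ℕ) : ℤ) := by omega
    rw [e, ← add_assoc, start_dart_succ, this, finish_rev]

/-- A shortest circuit visits no vertex more than twice. -/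
theorem IsShortest.not_three (h : c.IsShortest ℓ) (hℓ : ∀ e, 0 ≤ ℓ e) {i j k : ℕ} (hij : i < j)
    (hjk : j < k) (hk : k < c.len) (h1 : Γ.start (c.dart i) = Γ.start (c.dart j))
    (h2 : Γ.start (c.dart j) = Γ.start (c.dart k)) : False := by
  -- If the first visit is not at time `0`, the edges leaving at the second and third visits are
  -- both the reverse of the edge arriving at the first, so they coincide.
  have key : ∀ {i j k : ℕ}, i + 1 < j → j < k → k < c.len →
      Γ.start (c.dart ((i + 1 : ℕ) : ℤ)) = Γ.start (c.dart j) →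
      Γ.start (c.dart j) = Γ.start (c.dart k) → False := by
    intro i j k hij hjk hk h1 h2
    have e1 := h.dart_eq_rev_of_add hℓ hij h1 0 (by omega) (by omega)
    have e2 := h.dart_eq_rev_of_add hℓ (hij.trans hjk) (h1.trans h2) 0 (by omega) (by omega)
    have := h.eq_of_dart_eq hℓ (by omega) (by omega) (e1.trans e2.symm)
    omega
  obtain ⟨j, rfl⟩ : ∃ j', j = j' + 1 := ⟨j - 1, by omega⟩
  rcases Nat.eq_zero_or_pos i with rfl | hi
  -- The first visit is at time `0`. From time `k` on, the circuit retraces the segment before the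
  -- second visit. If it gets back to time `0` within the period, this is a still later visit, or a
  -- backtrack at the closing point. Otherwise the period ends on the way, which gives another visit
  -- at a positive time before the second. Both reduce to `key`.
  · rcases lt_or_ge (k + j) c.len with hlt | hge
    · have e := h.dart_eq_rev_of_add hℓ hjk h2 j le_rfl hlt
      rw [Nat.sub_self] at e
      have e' := c.turn_nat (k + j)
      rcases eq_or_ne (k + j + 1) c.len with hN | hN
      · rw [hN, c.dart_len, e] at e'
        exact e'.2 (by simp)
      · refine key hjk (k := k + j + 1) (by omega) (by omega) h2 ?_
        rw [← e'.1, e, finish_rev, h1, h2]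
    · have e := h.dart_eq_rev_of_add hℓ hjk h2 (c.len - 1 - k) (by omega) (by omega)
      have e' := c.turn_nat (k + (c.len - 1 - k))
      rw [show k + (c.len - 1 - k) + 1 = c.len by omega, c.dart_len, e] at e'
      have e3 := e'.1
      rw [finish_rev] at e3
      obtain ⟨m, hm⟩ : ∃ m, j - (c.len - 1 - k) = m + 1 := ⟨j - (c.len - 1 - k) - 1, by omega⟩
      rw [hm] at e3
      exact key (i := m) (j := j + 1) (by omega) hjk hk (by rw [e3]; exact h1) h2
  · obtain ⟨i, rfl⟩ : ∃ i', i = i' + 1 := ⟨i - 1, by omega⟩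
    exact key hij hjk hk h1 h2

end Circuit

end Shortest

end CellGraph

namespace CellGraph

open Finset

/-! ### Zero-length detours from a shortest circuit -/

section Chords

variable {V E : Type*} {Γ : CellGraph V E} {ℓ : E → ℝ}

theorem _root_.List.exists_common_prefix {α : Type*} (W R : List α) :
    ∃ P W' R', W = P ++ W' ∧ R = P ++ R' ∧ ∀ x ∈ W'.head?, ∀ y ∈ R'.head?, x ≠ y := by
  classical
  induction W generalizing R with
  | nil => exact ⟨[], [], R, rfl, rfl, by simp⟩
  | cons a W ih =>
    rcases R with _ | ⟨b, R⟩
    · exact ⟨[], a :: W, [], rfl, rfl, by simp⟩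
    · by_cases hab : a = b
      · subst hab
        obtain ⟨P, W', R', rfl, rfl, h⟩ := ih R
        exact ⟨a :: P, W', R', rfl, rfl, h⟩
      · exact ⟨[], a :: W, b :: R, rfl, rfl, by simpa using hab⟩

theorem Circuit.finish_getLast_take (c : Γ.Circuit) {i j : ℕ} (hij : i < j) (hj : j ≤ c.len)
    (h : ((c.toList.take j).drop i) ≠ []) :
    Γ.finish (((c.toList.take j).drop i).getLast h) = Γ.start (c.dart j) := by
  rw [List.getLast_drop, List.getLast_eq_getElem, List.getElem_take, Circuit.getElem_toList,
    ← start_dart_succ]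
  congr 3
  rw [List.length_take, length_toList]
  omega

namespace Circuit

variable {c : Γ.Circuit}

/-- A path of length zero that leaves the first vertex of a shortest circuit does not lead to
a vertex that the circuit visits twice while going back and forth along its initial segment. -/
theorem IsShortest.finish_ne_of_add_lt (h : c.IsShortest ℓ) (hℓ : IsForestMetric Γ ℓ)
    (W : List (E × Bool)) (hW : W ≠ []) (hc : W.IsChain Γ.Turn)
    (hs : Γ.start (W.head hW) = Γ.start (c.dart 0)) (hne : W.head hW ≠ c.dart 0)
    (h0 : ∀ d ∈ W, ℓ d.1 = 0) {i j : ℕ} (hij : i + 1 < j) (hj : i + 1 + j < c.len)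
    (hst : Γ.start (c.dart ((i + 1 : ℕ) : ℤ)) = Γ.start (c.dart j)) :
    Γ.finish (W.getLast hW) ≠ Γ.start (c.dart j) := by
  induction hn : W.length using Nat.strong_induction_on generalizing W i j with
  | _ n ih =>
    intro hfin
    have hpos := hℓ.1
    have hlen := c.length_toList
    have hZ : ∀ W' : List (E × Bool), ∀ hW' : W' ≠ [], W'.IsChain Γ.Turn → (∀ d ∈ W', ℓ d.1 = 0) →
        Γ.finish (W'.getLast hW') ≠ Γ.start (W'.head hW') := by
      intro W' hW' hc' h0' hcl
      obtain ⟨d, hd, hd0⟩ := hℓ.exists_ne_zero_of_closed W' hW' hc' hcl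
      exact hd0 (h0' d hd)
    have hexp := h.dart_eq_rev_of_add hpos hij hst
    -- the path returns to the first vertex at time `m`
    set m := i + 1 + j with hm
    have hvm : Γ.start (c.dart m) = Γ.start (c.dart 0) := by
      have e := hexp i le_rfl (by omega)
      rw [Nat.sub_self] at e
      rw [hm, show i + 1 + j = j + i + 1 by omega, start_dart_succ, e, finish_rev]
      rfl
    have hne0 : Γ.start (c.dart j) ≠ Γ.start (c.dart 0) := by
      intro e
      exact h.not_three hpos (i := 0) (j := i + 1) (k := j) (by omega) (by omega) (by omega)
        (by rw [hst, e]; rfl) hst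
    -- the last oriented edge of `W` is not the one before time `i + 1`
    have hlast : W.getLast hW ≠ c.dart i := by
      intro e
      obtain ⟨W₀, x, rfl⟩ := (List.eq_nil_or_concat' W).resolve_left hW
      rw [List.getLast_append_singleton] at e hfin
      rcases Nat.eq_zero_or_pos i with rfl | hi
      · rcases eq_or_ne W₀ [] with rfl | hW₀
        · exact hne (by simpa using e)
        · refine hZ W₀ hW₀ hc.left_of_append (fun d hd => h0 d (by simp [hd])) ?_
          rw [List.head_append_of_ne_nil hW₀] at hs
          have := (hc.rel_getLast_head_of_append hW₀ (by simp)).1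
          rw [hs, this, List.head_singleton, e]
          rfl
      -- Dropping the last edge of `W` leaves a shorter path to the vertex at time `i`, which the
      -- circuit visits again at time `j + 1`, so induction applies. If nothing is left, the base
      -- vertex would be visited three times.
      · obtain ⟨i, rfl⟩ : ∃ i', i = i' + 1 := ⟨i - 1, by omega⟩
        have e1 := hexp 0 (by omega) (by omega)
        have e2 : Γ.start (c.dart ((i + 1 : ℕ) : ℤ)) = Γ.start (c.dart ((j + 1 : ℕ) : ℤ)) := by
          rw [start_dart_succ c j]
          simp only [add_zero, Nat.sub_zero] at e1
          rw [e1, finish_rev]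
        rcases eq_or_ne W₀ [] with rfl | hW₀
        · refine h.not_three hpos (i := 0) (j := i + 1) (k := j + 1) (by omega) (by omega)
            (by omega) ?_ e2
          rw [← e]
          simpa using hs.symm
        · refine ih W₀.length (by simp at hn; omega) W₀ hW₀ hc.left_of_append ?_ ?_
            (fun d hd => h0 d (by simp [hd])) (i := i) (j := j + 1) (by omega) (by omega) e2 rfl ?_
          · rwa [List.head_append_of_ne_nil hW₀] at hs
          · rwa [List.head_append_of_ne_nil hW₀] at hne
          · have := (hc.rel_getLast_head_of_append hW₀ (by simp)).1
            rw [this, List.head_singleton, e, ← e2]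
    -- The path `W` and the rest of the circuit after time `m` start at the same vertex. Cancelling
    -- their common beginning `P` prevents a backtrack where the reverse of `W'` is followed by
    -- `R'`. Neither remainder is empty: otherwise there is a third visit, or a return to the base
    -- vertex before the rest of the circuit is used, or a closed path of length zero.
    obtain ⟨P, W', R', hWP, hRP, hhead⟩ := List.exists_common_prefix W (c.toList.drop m)
    have hRne : c.toList.drop m ≠ [] := by
      rw [← List.length_pos_iff, List.length_drop]
      omega
    have hRhead : (c.toList.drop m).head hRne = c.dart m := by
      rw [List.head_eq_getElem, List.getElem_drop, getElem_toList, add_zero]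
    have hRlast : (c.toList.drop m).getLast hRne = c.dart (-1) := by
      rw [List.getLast_drop, c.getLast_toList]
    have hW' : W' ≠ [] := by
      rintro rfl
      rw [List.append_nil] at hWP
      subst hWP
      have hle : m + W.length ≤ c.len := by
        have := congrArg List.length hRP
        rw [List.length_drop, List.length_append] at this
        omega
      have hWt : W = (c.toList.take (m + W.length)).drop m := by
        rw [List.drop_take, add_tsub_cancel_left, hRP, List.take_left]
      have hWlen := List.length_pos_iff.2 hW
      have hu : Γ.start (c.dart ((m + W.length : ℕ) : ℤ)) = Γ.start (c.dart j) := by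
        rw [← hfin, ← c.finish_getLast_take (i := m) (by omega) hle (by rwa [← hWt])]
        congr 1
        congr 1
        exact hWt.symm
      rcases eq_or_lt_of_le hle with heq | hlt
      · rw [heq, c.dart_len] at hu
        exact hne0 hu.symm
      · exact h.not_three hpos (i := i + 1) (j := j) (k := m + W.length) hij (by omega) hlt hst hu.symm
    have hR' : R' ≠ [] := by
      rintro rfl
      rw [List.append_nil] at hRP
      refine hZ _ hRne (c.isChain_toList.drop m) (fun d hd => h0 d ?_) ?_
      · rw [hRP] at hd
        rw [hWP]
        exact List.mem_append_left _ hd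
      · rw [hRlast, hRhead, hvm]
        exact (c.turn (-1)).1
    let Wr := (W'.map rev).reverse
    have hWr : Wr ≠ [] := by simpa [Wr] using hW'
    have hWrhead : Wr.head hWr = rev (W.getLast hW) := by
      have : W.getLast hW = W'.getLast hW' := by
        subst hWP
        rw [List.getLast_append_of_ne_nil _ hW']
      rw [this]
      simp [Wr]
    have hWrlast : Wr.getLast hWr = rev (W'.head hW') := by
      simp [Wr]
    have n1 : c.toList.take (i + 1) ≠ [] := by
      rw [← List.length_pos_iff, List.length_take]
      omega
    have hAlast : (c.toList.take (i + 1)).getLast n1 = c.dart i := by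
      rw [List.getLast_eq_getElem, List.getElem_take, getElem_toList]
      congr 2
      rw [List.length_take]
      omega
    have hWrchain : Wr.IsChain Γ.Turn := by
      rw [List.isChain_reverse, List.isChain_map]
      rw [hWP] at hc
      exact hc.right_of_append.imp fun a b hab => hab.reverse
    have hstart : Γ.start (W'.head hW') = Γ.start (R'.head hR') := by
      rcases eq_or_ne P [] with rfl | hP
      · rw [List.nil_append] at hWP hRP
        subst hWP
        have : R'.head hR' = c.dart m := by
          rw [← hRhead]
          congr 1
          exact hRP.symm
        rw [hs, this, hvm]
      · have e1 := hc
        rw [hWP] at e1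
        have e2 := c.isChain_toList.drop m
        rw [hRP] at e2
        rw [← (e1.rel_getLast_head_of_append hP hW').1, ← (e2.rel_getLast_head_of_append hP hR').1]
    -- The competitor goes out along the stick of the lollipop, comes back along the reverse of
    -- `W'`, and continues with `R'`. The detour is free, and the candy of the lollipop, of positive
    -- length, is saved.
    have hchain : (c.toList.take (i + 1) ++ (Wr ++ R')).IsChain Γ.Turn := by
      refine (c.isChain_toList.take _).append (hWrchain.append ?_ ?_) ?_
      · have e2 := c.isChain_toList.drop m
        rw [hRP] at e2
        exact e2.right_of_append
      · intro x hx y hy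
        rw [List.getLast?_eq_some_getLast hWr, hWrlast] at hx
        rw [List.head?_eq_some_head hR'] at hy
        obtain rfl : rev (W'.head hW') = x := by simpa using hx
        obtain rfl : R'.head hR' = y := by simpa using hy
        refine ⟨by rw [finish_rev, hstart], ?_⟩
        rw [rev_rev]
        exact (hhead _ (by simp [List.head?_eq_some_head hW'])
          _ (by simp [List.head?_eq_some_head hR'])).symm
      · intro x hx y hy
        rw [List.getLast?_eq_some_getLast n1, hAlast] at hx
        rw [List.head?_append_of_ne_nil _ hWr, List.head?_eq_some_head hWr, hWrhead] at hy
        obtain rfl : c.dart i = x := by simpa using hx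
        obtain rfl : rev (W.getLast hW) = y := by simpa using hy
        refine ⟨?_, fun e => hlast (rev_injective e)⟩
        rw [start_rev, hfin, ← hst, start_dart_succ]
    have hne' : c.toList.take (i + 1) ++ (Wr ++ R') ≠ [] := by simp [n1]
    have key := h.lt_or_le_length hne' hchain
      (by
        rw [List.head_append_of_ne_nil n1, ← c.head_toList]
        simp [List.head_take])
      (by
        rw [List.getLast_append_of_ne_nil _ (by simp [hR']), List.getLast_append_of_ne_nil _ hR',
          ← hRlast]
        have : (P ++ R').getLast (by simp [hR']) = R'.getLast hR' :=
          List.getLast_append_of_ne_nil _ hR'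
        rw [← this]
        congr 1
        exact hRP.symm)
    -- the piece between times `i + 1` and `j` is closed, hence has positive length
    let S := (c.toList.take j).drop (i + 1)
    have hSne : S ≠ [] := by
      rw [← List.length_pos_iff, List.length_drop, List.length_take]
      omega
    have hSpos : 0 < (S.map fun d => ℓ d.1).sum := by
      obtain ⟨d, hd, hd0⟩ := hℓ.exists_ne_zero_of_closed S hSne ((c.isChain_toList.take j).drop _) (by
        rw [c.finish_getLast_take hij (by omega) hSne, ← hst]
        congr 1
        rw [List.head_eq_getElem, List.getElem_drop, List.getElem_take, getElem_toList, add_zero])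
      refine lt_of_lt_of_le (lt_of_le_of_ne (hpos d.1) hd0.symm) ?_
      exact List.single_le_sum (fun x hx => by
        obtain ⟨d, -, rfl⟩ := List.mem_map.1 hx
        exact hpos _) _ (List.mem_map.2 ⟨d, hd, rfl⟩)
    have hdecomp : c.toList = c.toList.take (i + 1) ++ S ++ ((c.toList.take m).drop j ++ (P ++ R')) := by
      rw [← hRP]
      have e1 : c.toList.take (i + 1) ++ S = c.toList.take j := by
        conv_rhs => rw [← List.take_append_drop (i + 1) (c.toList.take j), List.take_take]
        rw [min_eq_left hij.le]
      have e2 : c.toList.take j ++ (c.toList.take m).drop j = c.toList.take m := by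
        conv_rhs => rw [← List.take_append_drop j (c.toList.take m), List.take_take]
        rw [min_eq_left (by omega)]
      rw [e1, ← List.append_assoc, e2, List.take_append_drop]
    have hsum := c.sum_toList ℓ
    have hWr0 : (Wr.map fun d => ℓ d.1).sum = 0 := by
      refine List.sum_eq_zero fun x hx => ?_
      obtain ⟨d, hd, rfl⟩ := List.mem_map.1 hx
      have hd' : rev d ∈ W' := by
        simp only [Wr, List.mem_reverse, List.mem_map] at hd
        obtain ⟨a, ha, rfl⟩ := hd
        rwa [rev_rev]
      exact h0 (rev d) (by rw [hWP]; exact List.mem_append_right _ hd')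
    rw [hdecomp] at hsum
    have p1 := sum_map_nonneg hpos ((c.toList.take m).drop j)
    have p2 := sum_map_nonneg hpos P
    simp only [List.map_append, List.sum_append] at key hsum
    rw [hWr0] at key
    rcases key with key | key <;> linarith [key]

theorem flip_start (c : Γ.Circuit) {i : ℕ} (hi : i ≤ c.len) :
    Γ.start (c.flip.dart i) = Γ.start (c.dart ((c.len - i : ℕ) : ℤ)) := by
  rw [flip_dart, start_rev, (c.turn _).1, ← c.periodic]
  congr 2
  omega

/-- A path of length zero that leaves a shortest circuit at its first vertex does not lead to a
vertex that the circuit visits twice. -/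
theorem IsShortest.finish_ne (h : c.IsShortest ℓ) (hℓ : IsForestMetric Γ ℓ)
    (W : List (E × Bool)) (hW : W ≠ []) (hc : W.IsChain Γ.Turn)
    (hs : Γ.start (W.head hW) = Γ.start (c.dart 0)) (hne : W.head hW ≠ c.dart 0)
    (hne' : W.head hW ≠ rev (c.dart (-1))) (h0 : ∀ d ∈ W, ℓ d.1 = 0) {i j : ℕ} (hij : i < j)
    (hj : j < c.len) (hst : Γ.start (c.dart i) = Γ.start (c.dart j)) :
    Γ.finish (W.getLast hW) ≠ Γ.start (c.dart j) := by
  rcases Nat.eq_zero_or_pos i with rfl | hi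
  · intro hfin
    obtain ⟨d, hd, hd0⟩ := hℓ.exists_ne_zero_of_closed W hW hc (by rw [hfin, ← hst, hs]; rfl)
    exact hd0 (h0 d hd)
  obtain ⟨i, rfl⟩ : ∃ i', i = i' + 1 := ⟨i - 1, by omega⟩
  -- Retracing would bring the circuit back to its first vertex at time `i + 1 + j`. If that is the
  -- end of the period, the closing turn is a backtrack; if it lies beyond, the reversed circuit,
  -- with times `c.len - j` and `c.len - (i + 1)`, falls under the first case.
  rcases lt_trichotomy (i + 1 + j) c.len with hlt | heq | hgt
  · exact h.finish_ne_of_add_lt hℓ W hW hc hs hne h0 hij hlt hst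
  · exfalso
    have e := h.dart_eq_rev_of_add hℓ.1 hij hst i le_rfl (by omega)
    rw [Nat.sub_self] at e
    have e' := c.turn_nat (j + i)
    rw [show j + i + 1 = c.len by omega, c.dart_len, e] at e'
    exact e'.2 (by simp)
  · have hf : Γ.start (c.flip.dart ((c.len - j - 1 + 1 : ℕ) : ℤ)) =
        Γ.start (c.flip.dart ((c.len - (i + 1) : ℕ) : ℤ)) := by
      rw [flip_start _ (by omega), flip_start _ (by omega)]
      rw [show c.len - (c.len - j - 1 + 1) = j by omega,
        show c.len - (c.len - (i + 1)) = i + 1 by omega, hst]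
    have := h.flip.finish_ne_of_add_lt hℓ W hW hc (by
        rw [hs]
        have := c.flip_start (i := 0) (by omega)
        rw [Nat.cast_zero, Nat.sub_zero, c.dart_len] at this
        rw [this]) (by
        rw [flip_dart, neg_zero, zero_sub]
        exact hne') h0 (i := c.len - j - 1) (j := c.len - (i + 1)) (by omega)
        (by change _ < c.len; omega) hf
    rwa [← hf, flip_start _ (by omega), show c.len - (c.len - j - 1 + 1) = j by omega] at this

/-- Some edge of a shortest circuit is crossed only once. -/
theorem IsShortest.exists_edge_once (h : c.IsShortest ℓ) (hℓ : ∀ e, 0 ≤ ℓ e) :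
    ∃ i < c.len, ∀ k < c.len, (c.dart (k : ℕ)).1 = (c.dart (i : ℕ)).1 → k = i := by
  classical
  -- a closed piece with the least number of edges; if there is none, the circuit is simple
  have hfin : ∀ k < c.len, ∃ k' < c.len, Γ.start (c.dart (k' : ℕ)) = Γ.finish (c.dart (k : ℕ)) ∧
      c.dart ((k + 1 : ℕ) : ℤ) = c.dart (k' : ℕ) ∧ (k' = k + 1 ∨ k' = 0 ∧ k + 1 = c.len) := by
    intro k hk
    rcases eq_or_ne (k + 1) c.len with e | e
    · refine ⟨0, c.pos, ?_, ?_, Or.inr ⟨rfl, e⟩⟩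
      · rw [← start_dart_succ, e, c.dart_len]
        rfl
      · rw [e, c.dart_len]
        rfl
    · exact ⟨k + 1, by omega, start_dart_succ c k, rfl, Or.inl rfl⟩
  by_cases hex : ∃ n, ∃ i, i + n + 1 < c.len ∧
      Γ.start (c.dart (i : ℕ)) = Γ.start (c.dart ((i + n + 1 : ℕ) : ℤ))
  · obtain ⟨i, hi, hs⟩ := Nat.find_spec hex
    set n := Nat.find hex with hn
    refine ⟨i, by omega, fun k hk hki => ?_⟩
    by_contra hne
    rcases eq_or_eq_rev_of_fst_eq hki with e | e
    · exact hne (h.eq_of_dart_eq hℓ hk (by omega) e)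
    obtain ⟨k', hk', e1, e2, e3⟩ := hfin k hk
    rw [e, finish_rev] at e1
    have hk'i : k' ≠ i := by
      rintro rfl
      have := (c.turn_nat k).2
      rw [e2, e, rev_rev] at this
      exact this rfl
    -- With a third visit excluded, a second crossing of the edge must be the last edge of the
    -- closed piece. Removing both crossings leaves a closed piece with two edges fewer, or exposes
    -- a backtrack.
    have hk'j : k' = i + n + 1 := by
      by_contra hne'
      rcases lt_trichotomy k' i with h1 | h1 | h1
      · exact h.not_three hℓ h1 (by omega) hi e1 hs
      · exact hk'i h1
      · rcases lt_or_gt_of_ne hne' with h2 | h2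
        · exact h.not_three hℓ h1 h2 hi e1.symm (e1.trans hs)
        · exact h.not_three hℓ (by omega : i < i + n + 1) h2 hk' hs (hs.symm.trans e1.symm)
    obtain rfl : k = i + n := by omega
    have hst : Γ.start (c.dart ((i + 1 : ℕ) : ℤ)) = Γ.start (c.dart ((i + n : ℕ) : ℤ)) := by
      rw [start_dart_succ, e, start_rev]
    rcases Nat.lt_or_ge n 2 with h2 | h2
    · have h1 : n = 1 := by omega
      rw [h1] at e
      have := (c.turn_nat i).2
      rw [e] at this
      exact this rfl
    · refine Nat.find_min hex (m := n - 2) (by omega) ⟨i + 1, by omega, ?_⟩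
      rw [show i + 1 + (n - 2) + 1 = i + n by omega]
      exact hst
  · push Not at hex
    refine ⟨0, c.pos, fun k hk hk0 => ?_⟩
    by_contra hne
    rcases eq_or_eq_rev_of_fst_eq hk0 with e | e
    · exact hne (h.eq_of_dart_eq hℓ hk c.pos e)
    obtain ⟨k', hk', e1, e2, e3⟩ := hfin k hk
    rw [e, finish_rev] at e1
    rcases Nat.eq_zero_or_pos k' with rfl | h1
    · have := (c.turn_nat k).2
      rw [e2, e, rev_rev] at this
      exact this rfl
    · refine hex (k' - 1) 0 (by omega) ?_
      rw [show 0 + (k' - 1) + 1 = k' by omega, e1]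

end Circuit

end Chords

end CellGraph

namespace CellGraph

open Finset

/-! ### The double cover that separates repeated visits -/

section Unfolding

variable {V E : Type*} {Γ : CellGraph V E} {ℓ : E → ℝ}

/-- The total sheet change of a list of oriented edges. -/
def xorSum (w : E → Bool) (W : List (E × Bool)) : Bool := W.foldr (fun d b => w d.1 ^^ b) false

@[simp] theorem xorSum_nil (w : E → Bool) : xorSum w [] = false := rfl

@[simp] theorem xorSum_cons (w : E → Bool) (d : E × Bool) (W : List (E × Bool)) :
    xorSum w (d :: W) = (w d.1 ^^ xorSum w W) := rfl

theorem apply_start_xor_apply_finish (f : V → Bool) (d : E × Bool) :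
    (f (Γ.src d.1) ^^ f (Γ.tgt d.1)) = (f (Γ.start d) ^^ f (Γ.finish d)) := by
  rcases d with ⟨e, b⟩
  cases b
  · exact Bool.xor_comm _ _
  · rfl

/-- Along a path the sheet change of a coboundary telescopes. -/
theorem xorSum_add_coboundary {w w' : E → Bool} {f : V → Bool}
    (h : ∀ e, w' e = (w e ^^ f (Γ.src e) ^^ f (Γ.tgt e))) (W : List (E × Bool)) (hW : W ≠ [])
    (hc : W.IsChain Γ.Turn) :
    xorSum w' W = (xorSum w W ^^ f (Γ.start (W.head hW)) ^^ f (Γ.finish (W.getLast hW))) := by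
  induction W with
  | nil => exact absurd rfl hW
  | cons d W ih =>
    have h1 := h d.1
    have h2 := apply_start_xor_apply_finish (Γ := Γ) f d
    rw [Bool.xor_assoc, h2] at h1
    rcases eq_or_ne W [] with rfl | hW'
    · simp [h1]
    · have h3 := ih hW' hc.tail
      have h4 := (List.IsChain.rel_getLast_head_of_append (l₁ := [d]) hc (by simp) hW').1
      rw [List.getLast_singleton] at h4
      rw [xorSum_cons, xorSum_cons, h1, h3, List.getLast_cons hW', List.head_cons, h4]
      generalize f (Γ.start (W.head hW')) = p
      generalize f (Γ.finish (W.getLast hW')) = q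
      generalize xorSum w W = r
      generalize f (Γ.start d) = s
      generalize w d.1 = t
      revert p q r s t
      decide

theorem DoubleCover.finish_getLast_snd (D : DoubleCover Γ) (W : List ((E × Bool) × Bool))
    (hW : W ≠ []) (hc : W.IsChain D.total.Turn) :
    (D.total.finish (W.getLast hW)).2 =
      ((D.total.start (W.head hW)).2 ^^ xorSum D.mono (W.map proj)) := by
  induction W with
  | nil => exact absurd rfl hW
  | cons d W ih =>
    rcases eq_or_ne W [] with rfl | hW'
    · have := D.finish_snd d
      simpa [proj] using this
    · have h3 := ih hW' hc.tail
      have h4 := (List.IsChain.rel_getLast_head_of_append (l₁ := [d]) hc (by simp) hW').1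
      rw [List.getLast_singleton] at h4
      rw [List.getLast_cons hW', h3, ← h4, D.finish_snd, Bool.xor_assoc]
      rfl

namespace Circuit

variable {c : Γ.Circuit}

open Classical in
/-- Whether the circuit has visited its `i`-th vertex before, in the same period. -/
noncomputable def level (c : Γ.Circuit) (i : ℤ) : Bool :=
  decide (∃ a : ℕ, (a : ℤ) < i % c.len ∧ Γ.start (c.dart a) = Γ.start (c.dart i))

theorem level_eq_true {i : ℤ} : c.level i = true ↔
    ∃ a : ℕ, (a : ℤ) < i % c.len ∧ Γ.start (c.dart a) = Γ.start (c.dart i) := by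
  simp [level]

theorem level_congr {i j : ℤ} (h : (c.len : ℤ) ∣ j - i) : c.level i = c.level j := by
  have h1 : i % c.len = j % c.len := Int.modEq_iff_dvd.2 h
  rw [level, level, h1, c.dart_congr h]

theorem level_zero (c : Γ.Circuit) : c.level 0 = false := by
  rw [← Bool.not_eq_true, level_eq_true]
  rintro ⟨a, ha, -⟩
  rw [Int.zero_emod] at ha
  omega

/-- A vertex is visited at most twice in a period, so two different visits are the first and the
second one. -/
theorem IsShortest.level_eq_not (h : c.IsShortest ℓ) (hℓ : ∀ e, 0 ≤ ℓ e) {i j : ℤ}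
    (hs : Γ.start (c.dart i) = Γ.start (c.dart j)) (hij : ¬ (c.len : ℤ) ∣ j - i) :
    c.level i = !c.level j := by
  have h0 : (0 : ℤ) < c.len := by exact_mod_cast c.pos
  have key : ∀ {i j : ℤ}, i % c.len < j % c.len → Γ.start (c.dart i) = Γ.start (c.dart j) →
      c.level i = false ∧ c.level j = true := by
    intro i j hlt hs
    have h1 := Int.emod_nonneg i h0.ne'
    have h2 := Int.emod_lt_of_pos j h0
    have e1 : ((i % c.len).toNat : ℤ) = i % c.len := Int.toNat_of_nonneg h1
    have e2 : ((j % c.len).toNat : ℤ) = j % c.len := Int.toNat_of_nonneg (by omega)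
    refine ⟨?_, level_eq_true.2 ⟨(i % c.len).toNat, by omega, by rw [e1, c.dart_emod, hs]⟩⟩
    rw [← Bool.not_eq_true, level_eq_true]
    rintro ⟨a, ha, has⟩
    refine h.not_three hℓ (i := a) (j := (i % c.len).toNat) (k := (j % c.len).toNat)
      (by omega) (by omega) (by omega) ?_ ?_
    · rw [e1, c.dart_emod, has]
    · rw [e1, e2, c.dart_emod, c.dart_emod, hs]
  rcases lt_trichotomy (i % c.len) (j % c.len) with hlt | heq | hlt
  · obtain ⟨e1, e2⟩ := key hlt hs
    rw [e1, e2]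
    rfl
  · exact absurd (Int.ModEq.dvd heq) hij
  · obtain ⟨e1, e2⟩ := key hlt hs.symm
    rw [e1, e2]
    rfl

theorem exists_of_level {i : ℤ} (h : c.level i = true) : ∃ a b : ℕ, a < b ∧ b < c.len ∧
    Γ.start (c.dart a) = Γ.start (c.dart b) ∧ Γ.start (c.dart b) = Γ.start (c.dart i) := by
  have h0 : (0 : ℤ) < c.len := by exact_mod_cast c.pos
  have h2 := Int.emod_lt_of_pos i h0
  obtain ⟨a, ha, hs⟩ := level_eq_true.1 h
  have e1 : ((i % c.len).toNat : ℤ) = i % c.len := Int.toNat_of_nonneg (by omega)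
  refine ⟨a, (i % c.len).toNat, by omega, by omega, ?_, ?_⟩ <;> rw [e1, c.dart_emod]
  exact hs

/-- Two different crossings of an edge have opposite directions, and at each end they belong to
different visits. Both levels are negated, so their sum is the same; this makes `unfold` independent
of the chosen crossing. -/
theorem IsShortest.level_xor_congr (h : c.IsShortest ℓ) (hℓ : ∀ e, 0 ≤ ℓ e) {i j : ℤ}
    (he : (c.dart i).1 = (c.dart j).1) :
    (c.level i ^^ c.level (i + 1)) = (c.level j ^^ c.level (j + 1)) := by
  rcases eq_or_eq_rev_of_fst_eq he with e | e
  · have hd : (c.len : ℤ) ∣ j - i := by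
      by_contra hd
      have h0 : (0 : ℤ) < c.len := by exact_mod_cast c.pos
      have h1 := Int.emod_nonneg i h0.ne'
      have h2 := Int.emod_nonneg j h0.ne'
      have h3 := Int.emod_lt_of_pos i h0
      have h4 := Int.emod_lt_of_pos j h0
      have e1 : ((i % c.len).toNat : ℤ) = i % c.len := Int.toNat_of_nonneg h1
      have e2 : ((j % c.len).toNat : ℤ) = j % c.len := Int.toNat_of_nonneg h2
      have := h.eq_of_dart_eq hℓ (i := (i % c.len).toNat) (j := (j % c.len).toNat) (by omega)
        (by omega) (by rw [e1, e2, c.dart_emod, c.dart_emod, e])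
      exact hd (Int.ModEq.dvd (show i % c.len = j % c.len by omega))
    rw [level_congr hd, level_congr (i := i + 1) (j := j + 1) (by simpa using hd)]
  · have e1 : c.level i = !c.level (j + 1) := by
      refine h.level_eq_not hℓ ?_ fun hd => ?_
      · rw [e, start_rev, (c.turn j).1]
      · exact (c.turn j).2 (by rw [← c.dart_congr hd, e])
    have e2 : c.level (i + 1) = !c.level j := by
      refine h.level_eq_not hℓ ?_ fun hd => ?_
      · rw [← (c.turn i).1, e, finish_rev]
      · exact (c.turn i).2 (by rw [c.dart_congr hd, e, rev_rev])
    rw [e1, e2]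
    cases c.level j <;> cases c.level (j + 1) <;> rfl

open Classical in
/-- The sheet changes of the double cover in which the visits of a shortest circuit to the same
vertex are separated. -/
noncomputable def unfold (c : Γ.Circuit) (e : E) : Bool :=
  if h : ∃ i, (c.dart i).1 = e then c.level h.choose ^^ c.level (h.choose + 1)
  -- Off the circuit, the coboundary of the indicator of the first vertex: an edge changes the sheet
  -- exactly when one of its ends, but not both, is that vertex. This pushes detours from that
  -- vertex to the other sheet.
  else decide (Γ.src e = Γ.start (c.dart 0)) ^^ decide (Γ.tgt e = Γ.start (c.dart 0))

theorem IsShortest.unfold_dart (h : c.IsShortest ℓ) (hℓ : ∀ e, 0 ≤ ℓ e) (i : ℤ) :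
    c.unfold (c.dart i).1 = (c.level i ^^ c.level (i + 1)) := by
  have hex : ∃ j, (c.dart j).1 = (c.dart i).1 := ⟨i, rfl⟩
  rw [unfold, dif_pos hex]
  exact h.level_xor_congr hℓ hex.choose_spec

open Classical in
theorem unfold_of_forall_ne {d : E × Bool} (hd : ∀ i, (c.dart i).1 ≠ d.1) :
    c.unfold d.1 = (decide (Γ.start d = Γ.start (c.dart 0)) ^^
      decide (Γ.finish d = Γ.start (c.dart 0))) := by
  rw [unfold, dif_neg (by simpa using hd)]
  exact apply_start_xor_apply_finish (fun v => decide (v = Γ.start (c.dart 0))) d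

/-- A path of length zero that leaves a shortest circuit at its first vertex arrives on the other
sheet. -/
theorem IsShortest.xorSum_unfold (h : c.IsShortest ℓ) (hℓ : IsForestMetric Γ ℓ)
    (W : List (E × Bool)) (hW : W ≠ []) (hc : W.IsChain Γ.Turn)
    (hs : Γ.start (W.head hW) = Γ.start (c.dart 0)) (hne : W.head hW ≠ c.dart 0)
    (hne' : W.head hW ≠ rev (c.dart (-1))) (h0 : ∀ d ∈ W, ℓ d.1 = 0) :
    xorSum c.unfold W = true ∧ Γ.finish (W.getLast hW) ≠ Γ.start (c.dart 0) ∧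
      ∀ j, Γ.start (c.dart j) = Γ.finish (W.getLast hW) → c.level j = false := by
  classical
  have hv : Γ.finish (W.getLast hW) ≠ Γ.start (c.dart 0) := by
    intro e
    obtain ⟨d, hd, hd0⟩ := hℓ.exists_ne_zero_of_closed W hW hc (by rw [e, hs])
    exact hd0 (h0 d hd)
  have hl : ∀ j, Γ.start (c.dart j) = Γ.finish (W.getLast hW) → c.level j = false := by
    intro j hj
    rw [← Bool.not_eq_true]
    intro hlev
    obtain ⟨a, b, hab, hb, h1, h2⟩ := exists_of_level hlev
    exact h.finish_ne hℓ W hW hc hs hne hne' h0 hab hb h1 (by rw [h2, hj])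
  refine ⟨?_, hv, hl⟩
  induction W using List.reverseRecOn with
  | nil => exact absurd rfl hW
  | append_singleton W d ih =>
    simp only [List.getLast_append_singleton] at hv hl
    rcases eq_or_ne W [] with rfl | hW'
    · simp only [List.nil_append, List.head_singleton, xorSum_cons, xorSum_nil,
        Bool.xor_false] at hs hne hne' ⊢
      -- If the edge lies on the circuit, it belongs to the other visit of the first vertex, of
      -- level `true`, since neither the first nor the reversed last edge is allowed. It arrives at
      -- level `false` by `hl`, so the sheet changes.
      by_cases hon : ∃ i, (c.dart i).1 = d.1
      · obtain ⟨i, hi⟩ := hon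
        rw [← hi, h.unfold_dart hℓ.1]
        rcases eq_or_eq_rev_of_fst_eq hi with e | e
        · have h1 : c.level i = true := by
            rw [h.level_eq_not hℓ.1 (j := 0) (by rw [e, hs]) fun hd => hne ?_, level_zero]
            · rfl
            · rw [← e, c.dart_congr hd]
          rw [h1, hl (i + 1) (by rw [← (c.turn i).1, e])]
          rfl
        · have h1 : c.level (i + 1) = true := by
            rw [h.level_eq_not hℓ.1 (j := 0) (by rw [← (c.turn i).1, e, finish_rev, hs])
              fun hd => hne' ?_, level_zero]
            · rfl
            · rw [← c.dart_congr (i := i) (j := -1), e, rev_rev]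
              convert hd using 1
              ring
          rw [h1, hl i (by rw [e, start_rev])]
          rfl
      · push Not at hon
        simp only [unfold_of_forall_ne hon, decide_eq_true hs, decide_eq_false hv]
        rfl
    · have hs' : Γ.start (W.head hW') = Γ.start (c.dart 0) := by
        rwa [List.head_append_of_ne_nil hW'] at hs
      rw [List.head_append_of_ne_nil hW'] at hne hne'
      have hc' := hc.left_of_append
      have h0' : ∀ d ∈ W, ℓ d.1 = 0 := fun d hd => h0 d (by simp [hd])
      have hv' : Γ.finish (W.getLast hW') ≠ Γ.start (c.dart 0) := by
        intro e
        obtain ⟨d, hd, hd0⟩ := hℓ.exists_ne_zero_of_closed W hW' hc' (by rw [e, hs'])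
        exact hd0 (h0' d hd)
      have hl' : ∀ j, Γ.start (c.dart j) = Γ.finish (W.getLast hW') → c.level j = false := by
        intro j hj
        rw [← Bool.not_eq_true]
        intro hlev
        obtain ⟨a, b, hab, hb, h1, h2⟩ := exists_of_level hlev
        exact h.finish_ne hℓ W hW' hc' hs' hne hne' h0' hab hb h1 (by rw [h2, hj])
      have key := ih hW' hc' hs' hne hne' h0' hv' hl'
      have hd := (hc.rel_getLast_head_of_append hW' (by simp)).1
      rw [List.head_singleton] at hd
      rw [hd] at hv' hl'
      have e1 : xorSum c.unfold (W ++ [d]) = (xorSum c.unfold W ^^ c.unfold d.1) := by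
        clear * -
        induction W with
        | nil => simp
        | cons a W ih => rw [List.cons_append, xorSum_cons, xorSum_cons, ih, Bool.xor_assoc]
      -- After the first edge the path stays away from the first vertex and from all vertices
      -- visited twice, so nothing changes the sheet any more.
      have e2 : c.unfold d.1 = false := by
        by_cases hon : ∃ i, (c.dart i).1 = d.1
        · obtain ⟨i, hi⟩ := hon
          rw [← hi, h.unfold_dart hℓ.1]
          rcases eq_or_eq_rev_of_fst_eq hi with e | e
          · rw [hl' i (by rw [e]), hl (i + 1) (by rw [← (c.turn i).1, e])]
            rfl
          · rw [hl i (by rw [e, start_rev]), hl' (i + 1) (by rw [← (c.turn i).1, e, finish_rev])]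
            rfl
        · push Not at hon
          simp only [unfold_of_forall_ne hon, decide_eq_false hv', decide_eq_false hv]
          rfl
      rw [e1, key, e2]
      rfl

/-- If the unfolding is a coboundary, the circuit is simple and no path of length zero that leaves
it at its first vertex returns to it. -/
theorem IsShortest.isSimple_of_coboundary (h : c.IsShortest ℓ) (hℓ : IsForestMetric Γ ℓ)
    {f : V → Bool} (hf : ∀ e, c.unfold e = (f (Γ.src e) ^^ f (Γ.tgt e))) :
    c.IsSimple ∧ ∀ W : List (E × Bool), ∀ hW : W ≠ [], W.IsChain Γ.Turn →
      Γ.start (W.head hW) = Γ.start (c.dart 0) → W.head hW ≠ c.dart 0 →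
      W.head hW ≠ rev (c.dart (-1)) → (∀ d ∈ W, ℓ d.1 = 0) →
      ∀ j, Γ.finish (W.getLast hW) ≠ Γ.start (c.dart j) := by
  -- Along the circuit the level and `f` change simultaneously, so their sum is constant. The level
  -- is then a function of the vertex, which excludes second visits, and a detour back to the
  -- circuit would have to arrive on the sheet of the circuit.
  have hstep : ∀ i, (c.level (i + 1) ^^ f (Γ.start (c.dart (i + 1)))) =
      (c.level i ^^ f (Γ.start (c.dart i))) := by
    intro i
    have h1 := h.unfold_dart hℓ.1 i
    rw [hf, apply_start_xor_apply_finish (Γ := Γ) f, (c.turn i).1] at h1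
    revert h1
    generalize c.level i = p
    generalize c.level (i + 1) = q
    generalize f (Γ.start (c.dart i)) = r
    generalize f (Γ.start (c.dart (i + 1))) = s
    revert p q r s
    decide
  have hconst : ∀ i, (c.level i ^^ f (Γ.start (c.dart i))) = f (Γ.start (c.dart 0)) := by
    intro i
    induction i using Int.induction_on with
    | zero => rw [level_zero, Bool.false_xor]
    | succ i ih => rw [hstep, ih]
    | pred i ih =>
      rw [← ih, ← hstep (-i - 1), sub_add_cancel]
  refine ⟨fun i j hs => ?_, fun W hW hc hs hne hne' h0 j hj => ?_⟩
  · by_contra hd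
    have h1 := h.level_eq_not hℓ.1 hs hd
    have h2 := (hconst i).trans (hconst j).symm
    rw [hs, h1] at h2
    revert h2
    cases c.level j <;> cases f (Γ.start (c.dart j)) <;> decide
  · obtain ⟨h1, -, h2⟩ := h.xorSum_unfold hℓ W hW hc hs hne hne' h0
    have h3 := xorSum_add_coboundary (w := fun _ => false) (f := f) (w' := c.unfold)
      (fun e => by rw [hf, Bool.false_xor]) W hW hc
    have h4 : xorSum (fun _ : E => false) W = false := by
      clear * -
      induction W with
      | nil => rfl
      | cons a W ih => rw [xorSum_cons, ih]; rfl
    have h5 := hconst j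
    rw [h2 j hj.symm] at h5
    rw [h1, h4, hs, hj, ← h5] at h3
    simp at h3

/-- There is a sheet change function which is not a coboundary and vanishes on a given simple
circuit. -/
theorem IsSimple.exists_not_coboundary [Fintype V] [Fintype E] (hc : c.IsSimple)
    (hVE : Fintype.card V < Fintype.card E) :
    ∃ w : E → Bool, (∀ i, w (c.dart i).1 = false) ∧
      ¬ ∃ f : V → Bool, ∀ e, w e = (f (Γ.src e) ^^ f (Γ.tgt e)) := by
  classical
  by_contra! hcon
  let A : Set E := Set.range fun i => (c.dart i).1
  let B : Set V := Set.range fun i => Γ.start (c.dart i)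
  -- extension by zero
  let ext : ((Aᶜ : Set E) → Bool) → E → Bool := fun w e => if he : e ∈ Aᶜ then w ⟨e, he⟩ else false
  -- A potential whose coboundary vanishes along `c` is constant on the vertices of `c`; subtracting
  -- the constant makes it vanish there.
  have hA : ∀ w, ∃ f : V → Bool, (∀ v ∈ B, f v = false) ∧
      ∀ e, ext w e = (f (Γ.src e) ^^ f (Γ.tgt e)) := by
    intro w
    have h0 : ∀ i, ext w (c.dart i).1 = false := fun i =>
      dif_neg (not_not.2 ⟨i, rfl⟩)
    obtain ⟨f, hf⟩ := hcon (ext w) h0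
    have hstep : ∀ i, f (Γ.start (c.dart (i + 1))) = f (Γ.start (c.dart i)) := by
      intro i
      have h1 := hf (c.dart i).1
      rw [h0, apply_start_xor_apply_finish (Γ := Γ) f, (c.turn i).1] at h1
      revert h1
      cases f (Γ.start (c.dart i)) <;> cases f (Γ.start (c.dart (i + 1))) <;> decide
    have hconst : ∀ i, f (Γ.start (c.dart i)) = f (Γ.start (c.dart 0)) := by
      intro i
      induction i using Int.induction_on with
      | zero => rfl
      | succ i ih => rw [hstep, ih]
      | pred i ih => rw [← ih, ← hstep (-i - 1), sub_add_cancel]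
    refine ⟨fun v => f v ^^ f (Γ.start (c.dart 0)), ?_, fun e => ?_⟩
    · rintro _ ⟨i, rfl⟩
      simp [hconst i]
    · rw [hf]
      beta_reduce
      generalize f (Γ.src e) = p
      generalize f (Γ.tgt e) = q
      generalize f (Γ.start (c.dart 0)) = r
      revert p q r
      decide
  choose F hF0 hF using hA
  have hinj : Function.Injective fun w (v : (Bᶜ : Set V)) => F w v := by
    intro w w' hww
    have hFF : F w = F w' := by
      funext v
      by_cases hv : v ∈ B
      · rw [hF0 w v hv, hF0 w' v hv]
      · exact congrFun hww ⟨v, hv⟩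
    funext e
    have h1 := hF w e
    rw [hFF, ← hF w' e] at h1
    simpa only [ext, dif_pos e.2] using h1
  -- Functions on the edges off `c` inject into functions on the vertices off `c`. But `c` has at
  -- most `c.len` edges and at least `c.len` vertices, so more edges than vertices are left over.
  have hcard := Fintype.card_le_of_injective _ hinj
  rw [Fintype.card_fun, Fintype.card_fun, Fintype.card_bool] at hcard
  have hle : Fintype.card (Aᶜ : Set E) ≤ Fintype.card (Bᶜ : Set V) :=
    (Nat.pow_le_pow_iff_right (by norm_num)).1 hcard
  rw [Fintype.card_compl_set, Fintype.card_compl_set] at hle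
  have hAlen : Fintype.card A ≤ c.len := by
    have : Function.Surjective (fun i : Fin c.len => (⟨(c.dart (i : ℕ)).1, i, rfl⟩ : A)) := by
      rintro ⟨_, i, rfl⟩
      obtain ⟨k, hk, hki⟩ := c.exists_nat i
      exact ⟨⟨k, hk⟩, Subtype.ext (congrArg Prod.fst hki)⟩
    simpa using Fintype.card_le_of_surjective _ this
  have hBlen : c.len ≤ Fintype.card B := by
    have : Function.Injective (fun i : Fin c.len => (⟨Γ.start (c.dart (i : ℕ)), i, rfl⟩ : B)) := by
      intro i j hij
      have h1 := hc (i : ℕ) (j : ℕ) (Subtype.ext_iff.1 hij)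
      have h2 : (i : ℕ) ≡ j [MOD c.len] := by
        rw [← Int.natCast_modEq_iff]
        exact Int.modEq_iff_dvd.2 h1
      exact Fin.ext (h2.eq_of_lt_of_lt i.2 j.2)
    simpa using Fintype.card_le_of_injective _ this
  have h3 := set_fintype_card_le_univ B
  have h4 := set_fintype_card_le_univ A
  omega

/-- A shortest circuit lifts to a simple circuit in some nontrivial double cover, in such a way
that the zero-length paths leaving it at its first vertex do not come back. -/
theorem IsShortest.exists_cover [Fintype V] [Fintype E] (h : c.IsShortest ℓ)
    (hℓ : IsForestMetric Γ ℓ) (hVE : Fintype.card V < Fintype.card E) :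
    ∃ (N : NontrivialCover Γ) (x : ℤ → Bool), (∀ i, x (i + c.len) = x i) ∧
      (∀ i, x (i + 1) = (x i ^^ (Quotient.out N.1).mono (c.dart i).1)) ∧
      (∀ i j, Γ.start (c.dart i) = Γ.start (c.dart j) → x i = x j → (c.len : ℤ) ∣ j - i) ∧
      ∀ W : List (E × Bool), ∀ hW : W ≠ [], W.IsChain Γ.Turn →
        Γ.start (W.head hW) = Γ.start (c.dart 0) → W.head hW ≠ c.dart 0 →
        W.head hW ≠ rev (c.dart (-1)) → (∀ d ∈ W, ℓ d.1 = 0) →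
        ∀ j, Γ.finish (W.getLast hW) = Γ.start (c.dart j) →
          x j ≠ (x 0 ^^ xorSum (Quotient.out N.1).mono W) := by
  -- If the unfolding cover is trivial, the circuit is already simple without zero-length returns,
  -- and any nontrivial cover to which it lifts will do. Otherwise the unfolding cover itself is
  -- used, with the level, corrected by the isomorphism `g` to the chosen representative, as the
  -- sheet.
  by_cases hw : ∃ f : V → Bool, ∀ e, c.unfold e = (f (Γ.src e) ^^ f (Γ.tgt e))
  · obtain ⟨f, hf⟩ := hw
    obtain ⟨h1, h2⟩ := h.isSimple_of_coboundary hℓ hf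
    obtain ⟨w, hw0, hw⟩ := h1.exists_not_coboundary hVE
    obtain ⟨N, g, hg⟩ := exists_nontrivialCover hw
    refine ⟨N, fun i => g (Γ.start (c.dart i)), fun i => by simp only [c.periodic], fun i => ?_,
      fun i j hs _ => h1 i j hs, fun W hW hc hs hne hne' h0 j hj =>
        absurd hj (h2 W hW hc hs hne hne' h0 j)⟩
    rw [hg, Bool.xor_assoc, apply_start_xor_apply_finish (Γ := Γ) g, hw0, (c.turn i).1]
    simp
  · obtain ⟨N, g, hg⟩ := exists_nontrivialCover hw
    refine ⟨N, fun i => c.level i ^^ g (Γ.start (c.dart i)), fun i => ?_, fun i => ?_,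
      fun i j hs hx => ?_, fun W hW hc hs hne hne' h0 j hj => ?_⟩
    · simp only
      rw [c.periodic, level_congr (i := i + c.len) (j := i) (by simp)]
    · beta_reduce
      rw [hg, Bool.xor_assoc (c.unfold _), apply_start_xor_apply_finish (Γ := Γ) g,
        h.unfold_dart hℓ.1, (c.turn i).1]
      generalize c.level i = p
      generalize c.level (i + 1) = q
      generalize g (Γ.start (c.dart i)) = r
      generalize g (Γ.start (c.dart (i + 1))) = s
      revert p q r s
      decide
    · by_contra hd
      simp only [hs] at hx
      rw [h.level_eq_not hℓ.1 hs hd] at hx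
      revert hx
      cases c.level j <;> cases g (Γ.start (c.dart j)) <;> decide
    · obtain ⟨h1, -, h2⟩ := h.xorSum_unfold hℓ W hW hc hs hne hne' h0
      beta_reduce
      rw [xorSum_add_coboundary hg W hW hc, h1, h2 j hj.symm, hs, hj, level_zero]
      cases g (Γ.start (c.dart 0)) <;> cases g (Γ.start (c.dart j)) <;> decide

end Circuit

end Unfolding

end CellGraph

namespace CellGraph

open Finset

/-! ### Homology classes that force a turn -/

section LiftedClasses

variable {V E : Type*} {Γ : CellGraph V E} {ℓ : E → ℝ}

theorem DoubleCover.isSimple_liftCircuit (D : DoubleCover Γ) {c : Γ.Circuit} {x : ℤ → Bool}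
    (hp : ∀ i, x (i + c.len) = x i) (hx : ∀ i, x (i + 1) = (x i ^^ D.mono (c.dart i).1))
    (hs : ∀ i j, Γ.start (c.dart i) = Γ.start (c.dart j) → x i = x j → (c.len : ℤ) ∣ j - i) :
    (D.liftCircuit c x hp hx).IsSimple := by
  intro i j hij
  have h1 : (Γ.start (c.dart i), x i) = (Γ.start (c.dart j), x j) := by
    rw [← D.start_lift, ← D.start_lift]
    exact hij
  rw [Prod.mk.injEq] at h1
  exact hs i j h1.1 h1.2

theorem DoubleCover.finish_ne_start_liftCircuit (D : DoubleCover Γ) {c : Γ.Circuit} {x : ℤ → Bool}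
    (hp : ∀ i, x (i + c.len) = x i) (hx : ∀ i, x (i + 1) = (x i ^^ D.mono (c.dart i).1))
    (hw : ∀ W : List (E × Bool), ∀ hW : W ≠ [], W.IsChain Γ.Turn →
        Γ.start (W.head hW) = Γ.start (c.dart 0) → W.head hW ≠ c.dart 0 →
        W.head hW ≠ rev (c.dart (-1)) → (∀ d ∈ W, ℓ d.1 = 0) →
        ∀ j, Γ.finish (W.getLast hW) = Γ.start (c.dart j) →
          x j ≠ (x 0 ^^ xorSum D.mono W))
    (W : List ((E × Bool) × Bool)) (hW : W ≠ []) (hc : W.IsChain D.total.Turn)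
    (hs : D.total.start (W.head hW) = D.total.start ((D.liftCircuit c x hp hx).dart 0))
    (hne : W.head hW ≠ (D.liftCircuit c x hp hx).dart 0)
    (hne' : W.head hW ≠ rev ((D.liftCircuit c x hp hx).dart (-1)))
    (h0 : ∀ d ∈ W, pullback ℓ d.1 = 0) (j : ℤ) :
    D.total.finish (W.getLast hW) ≠ D.total.start ((D.liftCircuit c x hp hx).dart j) := by
  intro hj
  have e0 : D.total.start ((D.liftCircuit c x hp hx).dart 0) = (Γ.start (c.dart 0), x 0) :=
    D.start_lift _ _
  have ej : D.total.start ((D.liftCircuit c x hp hx).dart j) = (Γ.start (c.dart j), x j) :=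
    D.start_lift _ _
  have hsnd := D.finish_getLast_snd W hW hc
  rw [hj, ej, hs, e0] at hsnd
  refine hw (W.map proj) (by simpa using hW) ?_ ?_ ?_ ?_ ?_ j ?_ hsnd
  · rw [List.isChain_map]
    exact hc.imp fun _ _ h => D.turn_proj h
  · rw [List.head_map, ← D.start_fst, hs, e0]
  · rw [List.head_map]
    intro h
    exact hne (D.eq_of_proj_eq h (by rw [hs]))
  · rw [List.head_map]
    intro h
    refine hne' (D.eq_of_proj_eq h ?_)
    rw [hs, start_rev, ((D.liftCircuit c x hp hx).turn (-1)).1]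
    rfl
  · intro d hd
    obtain ⟨d', hd', rfl⟩ := List.mem_map.1 hd
    exact h0 d' hd'
  · rw [List.getLast_map, ← D.finish_fst, hj, ej]

variable [DecidableEq V] [DecidableEq E] [Fintype E]

/-- The homology class of a simple circuit `c` in a double cover is nonzero, it is not longer than
`c`, and all loops realizing it make the first turn of `c`, if `c` satisfies the condition of
`Circuit.exists_turnAt_of_forced`. -/
theorem DoubleCover.exists_class (D : DoubleCover Γ) (hℓ : IsForestMetric Γ ℓ)
    {c : D.total.Circuit} (hc : c.IsSimple)
    (hw : ∀ W : List ((E × Bool) × Bool), ∀ hW : W ≠ [], W.IsChain D.total.Turn →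
      D.total.start (W.head hW) = D.total.start (c.dart 0) → W.head hW ≠ c.dart 0 →
      W.head hW ≠ rev (c.dart (-1)) → (∀ d ∈ W, pullback ℓ d.1 = 0) →
      ∀ j, D.total.finish (W.getLast hW) ≠ D.total.start (c.dart j)) :
    ∃ a : D.total.H1, a ≠ 0 ∧ (∀ e, (a : E × Bool → ZMod 2) e = c.edges.count e) ∧
      classLength (pullback ℓ) a ≤ c.sum (pullback ℓ) ∧
      ∀ α : D.total.Loop, α.Realizes (pullback ℓ) a → ∀ β : D.total.Circuit, β.edges = α.edges →
        1 ≤ (D.projCircuit β).turnCount ((D.projCircuit c).turnAt (-1)) +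
          (D.projCircuit β).turnCount (revTurn ((D.projCircuit c).turnAt (-1))) := by
  have hℓ' := D.isForestMetric hℓ
  obtain ⟨γ, hγ⟩ := c.exists_loop
  have hnd := hc.nodup_edges
  have hcoe : ∀ e, γ.chain e = c.edges.count e := fun e => by rw [γ.chain_apply, hγ]
  have hle : classLength (pullback ℓ) (⟨γ.chain, γ.chain_mem_H1⟩ : D.total.H1) ≤
      c.sum (pullback ℓ) := by
    refine csInf_le ⟨0, ?_⟩ ⟨γ, rfl, Loop.weight_eq hγ _⟩
    rintro _ ⟨α, -, rfl⟩
    exact (hℓ'.weight_pos α).le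
  refine ⟨⟨γ.chain, γ.chain_mem_H1⟩, fun h0 => ?_, hcoe, hle, fun α hα β hβ => ?_⟩
  · have h1 := congrFun (congrArg Subtype.val h0) (c.dart 0).1
    have h2 := Multiset.count_eq_one_of_mem hnd (c.mem_edges 0)
    change γ.chain _ = 0 at h1
    rw [hcoe, h2] at h1
    exact absurd h1 (by decide)
  · have hpar : ∀ e, (β.edges.count e : ZMod 2) = c.edges.count e := by
      intro e
      rw [hβ, ← α.chain_apply, ← hcoe]
      exact congrFun hα.1 e
    have hsum : β.sum (pullback ℓ) = c.sum (pullback ℓ) := by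
      refine le_antisymm ?_ (Circuit.sum_le_of_parity hℓ'.1 hnd hpar)
      rw [← Loop.weight_eq hβ.symm, hα.2]
      exact hle
    -- Equal chains make `β` cross every edge of `c`, and equal lengths confine its edges of
    -- positive length to `c`.
    obtain ⟨k, hk⟩ := Circuit.exists_turnAt_of_forced (β := β) hℓ' hc hw
      (fun i hi => by
        obtain ⟨j, -, hj⟩ := c.exists_of_mem_edges
          (Circuit.mem_edges_of_parity hℓ'.1 hnd hpar hsum (β.mem_edges i) hi)
        exact ⟨j, hj.symm⟩)
      (by
        obtain ⟨i, -, hi⟩ := β.exists_of_mem_edges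
          (Circuit.mem_edges_of_parity' hnd hpar (c.mem_edges (-1)))
        exact ⟨i, hi⟩)
    rcases hk with hk | hk
    · have := Circuit.turnCount_pos (c := D.projCircuit β) (i := k)
        (t := (D.projCircuit c).turnAt (-1)) (by
          rw [D.turnAt_projCircuit, D.turnAt_projCircuit, hk])
      omega
    · have := Circuit.turnCount_pos (c := D.projCircuit β) (i := k)
        (t := revTurn ((D.projCircuit c).turnAt (-1))) (by
          rw [D.turnAt_projCircuit, D.turnAt_projCircuit, hk]
          rfl)
      omega

variable [Fintype V]

/-- The first turn of a shortest circuit is made by all realizations of two different homology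
classes in double covers, which are not longer than the circuit. -/
theorem Circuit.IsShortest.exists_summands {c : Γ.Circuit} (h : c.IsShortest ℓ)
    (hℓ : IsForestMetric Γ ℓ) (hVE : Fintype.card V < Fintype.card E) :
    ∃ s : Bool → Γ.Summand, Function.Injective s ∧ ∀ b,
      classLength (pullback ℓ) (s b).2.1 ≤ c.sum ℓ ∧
      ∀ α : (s b).1.space.Loop, α.Realizes (pullback ℓ) (s b).2.1 →
        ∀ β : (s b).1.space.Circuit, β.edges = α.edges →
          1 ≤ ((Quotient.out (s b).1.1).projCircuit β).turnCount (c.turnAt (-1)) +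
            ((Quotient.out (s b).1.1).projCircuit β).turnCount (revTurn (c.turnAt (-1))) := by
  obtain ⟨N, x, hp, hx, hs, hw⟩ := h.exists_cover hℓ hVE
  let D := Quotient.out N.1
  -- The two lifts, exchanged by the deck transformation.
  let y : Bool → ℤ → Bool := fun b i => b ^^ x i
  have hyp : ∀ b i, y b (i + c.len) = y b i := fun b i => congrArg (b ^^ ·) (hp i)
  have hyx : ∀ b i, y b (i + 1) = (y b i ^^ D.mono (c.dart i).1) := fun b i => by
    simp only [y, hx, Bool.xor_assoc, D]
  have hys : ∀ b i j, Γ.start (c.dart i) = Γ.start (c.dart j) → y b i = y b j →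
      (c.len : ℤ) ∣ j - i := fun b i j h1 h2 => hs i j h1 (by simpa [y] using h2)
  let C : Bool → D.total.Circuit := fun b => D.liftCircuit c (y b) (hyp b) (hyx b)
  have key := fun b => D.exists_class hℓ (c := C b)
    (D.isSimple_liftCircuit (hyp b) (hyx b) (hys b))
    (D.finish_ne_start_liftCircuit (hyp b) (hyx b) fun W hW hc h1 h2 h3 h4 j h5 h6 =>
      hw W hW hc h1 h2 h3 h4 j h5 (by
        simp only [y, Bool.xor_assoc] at h6
        simpa using h6))
  choose a ha0 ha hal har using key
  refine ⟨fun b => ⟨N, a b, ha0 b⟩, ?_, fun b => ⟨hal b, har b⟩⟩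
  have hne : a true ≠ a false := by
    intro hab
    -- Over an edge crossed only once, each lift of the circuit contains exactly one of the two
    -- lifted edges, and not the same one.
    obtain ⟨i, hi, honce⟩ := h.exists_edge_once hℓ.1
    have hnd := (D.isSimple_liftCircuit (hyp true) (hyx true) (hys true)).nodup_edges
    have hpar : ∀ e, ((C false).edges.count e : ZMod 2) = (C true).edges.count e := fun e => by
      rw [← ha, ← ha, hab]
    obtain ⟨k, hk, he⟩ := (C false).exists_of_mem_edges
      (Circuit.mem_edges_of_parity' hnd hpar ((C true).mem_edges i))
    have h1 : (c.dart k).1 = (c.dart i).1 := (Prod.ext_iff.1 he).1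
    obtain rfl := honce k hk h1
    have h2 := congrArg Prod.snd he
    change (y false k ^^ _) = (y true k ^^ _) at h2
    simp [y] at h2
  have hinj : ∀ b b', a b = a b' → b = b' := by
    rintro (_ | _) (_ | _) hb
    · rfl
    · exact absurd hb.symm hne
    · exact absurd hb hne
    · rfl
  intro b b' hb
  refine hinj b b' ?_
  have := eq_of_heq (Sigma.mk.inj_iff.1 hb).2
  exact congrArg Subtype.val this

end LiftedClasses

end CellGraph

namespace CellGraph

open Finset

/-! ### Moving a turn to the base point; existence of realizations -/

theorem Circuit.sum_shift_natCast {V E : Type*} {Γ : CellGraph V E} (c : Γ.Circuit) (f : E → ℝ)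
    (k : ℕ) : (c.shift k).sum f = c.sum f := by
  induction k with
  | zero => simp [sum, shift]
  | succ k ih =>
    rw [← ih, sum, sum]
    let g : ℕ → ℝ := fun i => f ((c.shift k).dart i).1
    have h1 := Finset.sum_range_succ g c.len
    rw [Finset.sum_range_succ'] at h1
    have h2 : g c.len = g 0 := congrArg (fun d : E × Bool => f d.1) (c.shift k).dart_len
    rw [h2] at h1
    have h3 := add_right_cancel h1
    refine Eq.trans (Finset.sum_congr rfl fun i _ => ?_) h3
    change f (c.dart (i + ((k + 1 : ℕ) : ℤ))).1 = f (c.dart (((i + 1 : ℕ) : ℤ) + k)).1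
    congr 3
    push_cast
    rw [add_assoc, add_comm (1 : ℤ)]

theorem Circuit.exists_isShortest_turnAt {V E : Type*} [Fintype E] {Γ : CellGraph V E} {ℓ : E → ℝ}
    (hℓ : IsForestMetric Γ ℓ) (c : Γ.Circuit) (k : ℕ) :
    ∃ c' : Γ.Circuit, c'.IsShortest ℓ ∧ c'.turnAt (-1) = c.turnAt k ∧ c'.sum ℓ ≤ c.sum ℓ := by
  obtain ⟨c', h0, h1, h2, h3⟩ := exists_isShortest hℓ (c.shift ((k + 1 : ℕ) : ℤ))
  rw [sum_shift_natCast] at h2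
  refine ⟨c', h3, ?_, h2⟩
  rw [turnAt, turnAt, h1, neg_add_cancel, h0]
  simp only [shift]
  push_cast
  congr 2 <;> ring

theorem nonempty_ratios {V E : Type*} [Finite E] {Γ : CellGraph V E} [Nonempty V] (hv : ∀ v, 2 < Γ.valence v) (ℓ τ : E → ℝ) :
    (Γ.ratios ℓ τ).Nonempty := by
  obtain ⟨e⟩ := nonempty_edges hv
  obtain ⟨c, -⟩ := exists_circuit_through hv (e, true)
  obtain ⟨α, -⟩ := c.exists_loop
  exact ⟨_, α, rfl⟩

section Realizations

variable {V E : Type*} [DecidableEq V] [DecidableEq E] [Fintype E] {Γ : CellGraph V E} {ℓ : E → ℝ}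

/-- Only finitely many loops are no longer than a given representative, so one of them is shortest
in the class. -/
theorem IsForestMetric.isLeast_classLength (hℓ : IsForestMetric Γ ℓ) {a : Γ.H1}
    (ha : ∃ α : Γ.Loop, α.Represents a) :
    IsLeast {x | ∃ α : Γ.Loop, α.Represents a ∧ α.weight ℓ = x} (classLength ℓ a) := by
  obtain ⟨α₀, h₀⟩ := ha
  have hfin : {α : Γ.Loop | α.Represents a ∧ α.weight ℓ ≤ α₀.weight ℓ}.Finite :=
    (hℓ.finite_loops (α₀.weight ℓ)).subset fun α hα => hα.2
  obtain ⟨α₁, h₁, hmin⟩ := Set.exists_min_image _ (fun α => α.weight ℓ) hfin ⟨α₀, h₀, le_rfl⟩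
  have hleast : IsLeast {x | ∃ α : Γ.Loop, α.Represents a ∧ α.weight ℓ = x} (α₁.weight ℓ) := by
    refine ⟨⟨α₁, h₁.1, rfl⟩, ?_⟩
    rintro _ ⟨α, hα, rfl⟩
    by_cases hle : α.weight ℓ ≤ α₀.weight ℓ
    · exact hmin α ⟨hα, hle⟩
    · exact h₁.2.trans (not_le.1 hle).le
  have e : classLength ℓ a = α₁.weight ℓ := hleast.csInf_eq
  rwa [e]

theorem IsForestMetric.classLength_pos (hℓ : IsForestMetric Γ ℓ) {a : Γ.H1}
    (ha : ∃ α : Γ.Loop, α.Represents a) : 0 < classLength ℓ a := by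
  obtain ⟨α, -, h⟩ := (hℓ.isLeast_classLength ha).1
  rw [← h]
  exact hℓ.weight_pos α

theorem IsForestMetric.isGreatest_realizedValues (hℓ : IsForestMetric Γ ℓ) (τ : E → ℝ) {a : Γ.H1}
    (ha : ∃ α : Γ.Loop, α.Represents a) :
    IsGreatest (realizedValues ℓ τ a) (sSup (realizedValues ℓ τ a)) := by
  have hfin : (realizedValues ℓ τ a).Finite := by
    refine ((hℓ.finite_loops (classLength ℓ a)).image fun α => α.weight τ).subset ?_
    rintro _ ⟨α, hα, rfl⟩
    exact ⟨α, hα.2.le, rfl⟩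
  obtain ⟨α, h1, h2⟩ := (hℓ.isLeast_classLength ha).1
  exact ⟨Set.Nonempty.csSup_mem ⟨_, α, ⟨h1, h2⟩, rfl⟩ hfin, fun x hx => le_csSup hfin.bddAbove hx⟩

end Realizations

/-! ### The estimates for the corrected norm -/

section Estimate

variable {V E : Type*} [Fintype E] [DecidableEq V] [DecidableEq E] {Γ : CellGraph V E} {ℓ τ : E → ℝ}

/-- The maxima in the definition of the correction term are realized. -/
theorem exists_realizations (hℓ : IsForestMetric Γ ℓ) (τ : E → ℝ)
    (hrep : ∀ i : Γ.Summand, ∃ α : i.1.space.Loop, α.Represents i.2.1) :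
    ∃ β : ∀ i : Γ.Summand, i.1.space.Circuit,
      ∀ i, (∃ α : i.1.space.Loop, α.Realizes (pullback ℓ) i.2.1 ∧ (β i).edges = α.edges) ∧
        ((Quotient.out i.1.1).projCircuit (β i)).sum ℓ = classLength (pullback ℓ) i.2.1 ∧
        ((Quotient.out i.1.1).projCircuit (β i)).sum τ =
          sSup (realizedValues (pullback ℓ) (pullback τ) i.2.1) := by
  have : ∀ i : Γ.Summand, ∃ β : i.1.space.Circuit,
      (∃ α : i.1.space.Loop, α.Realizes (pullback ℓ) i.2.1 ∧ β.edges = α.edges) ∧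
        ((Quotient.out i.1.1).projCircuit β).sum ℓ = classLength (pullback ℓ) i.2.1 ∧
        ((Quotient.out i.1.1).projCircuit β).sum τ =
          sSup (realizedValues (pullback ℓ) (pullback τ) i.2.1) := by
    intro i
    have hℓ' : IsForestMetric i.1.space (pullback ℓ) := (Quotient.out i.1.1).isForestMetric hℓ
    obtain ⟨α, h1, h2⟩ := (hℓ'.isGreatest_realizedValues (pullback τ) (hrep i)).1
    obtain ⟨β, hβ⟩ := α.exists_circuit
    refine ⟨β, ⟨α, h1, hβ⟩, ?_, ?_⟩
    · rw [← h1.2, Loop.weight_eq hβ.symm]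
      rfl
    · rw [← h2, Loop.weight_eq hβ.symm]
      rfl
  choose β hβ using this
  exact ⟨β, hβ⟩

variable [Fintype V]

/-- The weight `M ℓ - τ` of any circuit is controlled by its weights on the chosen realizations:
every turn of the circuit is made by the realizations of at least two classes that are no longer
than the circuit. -/
theorem sum_le_correction_mul (hℓ : IsForestMetric Γ ℓ)
    (hVE : Fintype.card V < Fintype.card E)
    (hrep : ∀ i : Γ.Summand, ∃ α : i.1.space.Loop, α.Represents i.2.1)
    (c : Γ.Circuit) :
    Γ.normL ℓ τ * c.sum ℓ - c.sum τ ≤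
      (Fintype.card Γ.Summand * Γ.normL ℓ τ + Γ.correction ℓ τ) * c.sum ℓ := by
  classical
  obtain ⟨β, hβ⟩ := exists_realizations hℓ τ hrep
  set M := Γ.normL ℓ τ with hM
  let L : Γ.Summand → ℝ := fun i => classLength (pullback ℓ) i.2.1
  let S : Γ.Summand → ℝ := fun i => sSup (realizedValues (pullback ℓ) (pullback τ) i.2.1)
  have hL : ∀ i, 0 < L i := fun i =>
    IsForestMetric.classLength_pos ((Quotient.out i.1.1).isForestMetric hℓ) (hrep i)
  have hg : ∀ c : Γ.Circuit, 0 ≤ c.sum fun e => M * ℓ e - τ e := fun c => by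
    rw [Circuit.sum_sub, Circuit.sum_const_mul]
    exact sub_nonneg.2 (hℓ.sum_le_normL_mul τ c)
  have hQ : ∑ i, 1 / L i * ((Quotient.out i.1.1).projCircuit (β i)).sum (fun e => M * ℓ e - τ e) =
      Fintype.card Γ.Summand * M + Γ.correction ℓ τ := by
    have e : ∀ i, 1 / L i * ((Quotient.out i.1.1).projCircuit (β i)).sum
        (fun e => M * ℓ e - τ e) = M - S i / L i := by
      intro i
      rw [Circuit.sum_sub, Circuit.sum_const_mul, (hβ i).2.1, (hβ i).2.2]
      change 1 / L i * (M * L i - S i) = _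
      field_simp [(hL i).ne']
    rw [Finset.sum_congr rfl fun i _ => e i, Finset.sum_sub_distrib, Finset.sum_const,
      Finset.card_univ, nsmul_eq_mul, correction, sub_eq_add_neg]
  -- The claim is additive under splitting, so circuits without repeated oriented edges suffice;
  -- only for these are the turn multiplicities bounded.
  have key := Circuit.sum_nonneg_of_nodup (Γ := Γ)
    (g := fun e => (Fintype.card Γ.Summand * M + Γ.correction ℓ τ) * ℓ e - (M * ℓ e - τ e)) ?_ c
  · rw [Circuit.sum_sub, Circuit.sum_const_mul, Circuit.sum_sub, Circuit.sum_const_mul] at key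
    linarith
  · intro c hc
    have hc0 := hℓ.sum_pos c
    have h1 := Circuit.mul_sum_le_of_turnCount hg c hc
      (fun i => (Quotient.out i.1.1).projCircuit (β i)) (1 / c.sum ℓ) (fun i => 1 / L i)
      (by positivity) (fun i => one_div_nonneg.2 (hL i).le) fun k => ?_
    · rw [hQ, one_div_mul_eq_div, div_le_iff₀ hc0] at h1
      rw [Circuit.sum_sub, Circuit.sum_const_mul]
      linarith
    · obtain ⟨c', h1, h2, h3⟩ := c.exists_isShortest_turnAt hℓ k
      obtain ⟨s, hs, hs'⟩ := h1.exists_summands hℓ hVE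
      rw [h2] at hs'
      have hterm : ∀ i : Γ.Summand, (0 : ℝ) ≤ 1 / L i *
          (((Quotient.out i.1.1).projCircuit (β i)).turnCount (c.turnAt k) +
            ((Quotient.out i.1.1).projCircuit (β i)).turnCount (revTurn (c.turnAt k))) :=
        fun i => mul_nonneg (one_div_nonneg.2 (hL i).le) (by positivity)
      -- Keep only the two summands forced by the turn. Each contributes at least `1 / c.sum ℓ`,
      -- because its class is no longer than `c'`, hence than `c`.
      refine le_trans ?_ (Finset.sum_le_sum_of_subset_of_nonneg
        (Finset.subset_univ (Finset.univ.image s)) fun i _ _ => hterm i)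
      rw [Finset.sum_image fun b _ b' _ h => hs h, Fintype.sum_bool, two_mul]
      have hb : ∀ b, 1 / c.sum ℓ ≤ 1 / L (s b) *
          (((Quotient.out (s b).1.1).projCircuit (β (s b))).turnCount (c.turnAt k) +
            ((Quotient.out (s b).1.1).projCircuit (β (s b))).turnCount (revTurn (c.turnAt k))) := by
        intro b
        obtain ⟨α, hα, hαβ⟩ := (hβ (s b)).1
        have h4 := (hs' b).2 α hα _ hαβ
        have h5 : 1 / c.sum ℓ ≤ 1 / L (s b) :=
          one_div_le_one_div_of_le (hL _) ((hs' b).1.trans h3)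
        refine h5.trans (le_mul_of_one_le_right (one_div_nonneg.2 (hL _).le) ?_)
        exact_mod_cast h4
      exact add_le_add (hb true) (hb false)

/-- Each summand is a ratio for `-τ` along an actual loop, the projected realization, and so is
bounded by the norm. `neg_correction_le` is the same with `τ`. -/
theorem correction_le (hℓ : IsForestMetric Γ ℓ)
    (hrep : ∀ i : Γ.Summand, ∃ α : i.1.space.Loop, α.Represents i.2.1) :
    Γ.correction ℓ τ ≤ Fintype.card Γ.Summand * Γ.normL ℓ (-τ) := by
  obtain ⟨β, hβ⟩ := exists_realizations hℓ τ hrep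
  rw [correction, ← Finset.sum_neg_distrib, ← nsmul_eq_mul, ← Finset.card_univ]
  refine Finset.sum_le_card_nsmul _ _ _ fun i _ => ?_
  have hL := IsForestMetric.classLength_pos ((Quotient.out i.1.1).isForestMetric hℓ) (hrep i)
  have h1 := hℓ.sum_le_normL_mul (-τ) ((Quotient.out i.1.1).projCircuit (β i))
  have h2 : ((Quotient.out i.1.1).projCircuit (β i)).sum (-τ) =
      -sSup (realizedValues (pullback ℓ) (pullback τ) i.2.1) := by
    rw [← (hβ i).2.2]
    exact Finset.sum_neg_distrib ..
  rw [h2, (hβ i).2.1] at h1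
  rw [← neg_div]
  exact (div_le_iff₀ hL).2 h1

theorem neg_correction_le (hℓ : IsForestMetric Γ ℓ)
    (hrep : ∀ i : Γ.Summand, ∃ α : i.1.space.Loop, α.Represents i.2.1) :
    -Γ.correction ℓ τ ≤ Fintype.card Γ.Summand * Γ.normL ℓ τ := by
  obtain ⟨β, hβ⟩ := exists_realizations hℓ τ hrep
  rw [correction, neg_neg, ← nsmul_eq_mul, ← Finset.card_univ]
  refine Finset.sum_le_card_nsmul _ _ _ fun i _ => ?_
  have hL := IsForestMetric.classLength_pos ((Quotient.out i.1.1).isForestMetric hℓ) (hrep i)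
  have h1 := hℓ.sum_le_normL_mul τ ((Quotient.out i.1.1).projCircuit (β i))
  rw [(hβ i).2.1, (hβ i).2.2] at h1
  exact (div_le_iff₀ hL).2 h1

theorem normL_neg_le (hℓ : IsForestMetric Γ ℓ) (hVE : Fintype.card V < Fintype.card E)
    (hrep : ∀ i : Γ.Summand, ∃ α : i.1.space.Loop, α.Represents i.2.1)
    [Nonempty V] (hv : ∀ v, 2 < Γ.valence v) :
    Γ.normL ℓ (-τ) ≤ Fintype.card Γ.Summand * Γ.normL ℓ τ + Γ.correction ℓ τ - Γ.normL ℓ τ := by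
  refine csSup_le (nonempty_ratios hv ℓ (-τ)) ?_
  rintro _ ⟨α, rfl⟩
  obtain ⟨c, hc⟩ := α.exists_circuit
  have h1 := sum_le_correction_mul (τ := τ) hℓ hVE hrep c
  have h2 : c.sum (-τ) = -c.sum τ := Finset.sum_neg_distrib ..
  simp only [Loop.weight_eq hc.symm, h2]
  rw [div_le_iff₀ (hℓ.sum_pos c)]
  linarith

theorem normN_bounds (hℓ : IsForestMetric Γ ℓ) (hVE : Fintype.card V < Fintype.card E)
    (hrep : ∀ i : Γ.Summand, ∃ α : i.1.space.Loop, α.Represents i.2.1)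
    [Nonempty V] (hv : ∀ v, 2 < Γ.valence v) (h1 : ∑ e, ℓ e = 1)
    (hτ : ∑ e, τ e = 0) {n : ℕ} (hcard : Fintype.card Γ.Summand = numSummands n) :
    1 / ((numSummands n : ℝ) + 1) * max (Γ.normL ℓ τ) (Γ.normL ℓ (-τ)) ≤ Γ.normN n ℓ τ ∧
      Γ.normN n ℓ τ ≤ 2 * Γ.normL ℓ τ + Γ.normL ℓ (-τ) := by
  have hM := normL_nonneg hv hℓ h1 hτ
  have hm := normL_nonneg hv hℓ h1 (τ := -τ) (by simp [hτ])
  have a1 := correction_le (τ := τ) hℓ hrep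
  have a2 := neg_correction_le (τ := τ) hℓ hrep
  have a3 := normL_neg_le (τ := τ) hℓ hVE hrep hv
  rw [hcard] at a1 a2 a3
  have hK : (0 : ℝ) ≤ numSummands n := Nat.cast_nonneg _
  have hK1 : (0 : ℝ) < numSummands n + 1 := by linarith
  have e : Γ.normN n ℓ τ = ((numSummands n + 1) * Γ.normL ℓ τ + Γ.correction ℓ τ) /
      (numSummands n + 1) := by
    rw [normN]
    field_simp
  rw [e, one_div_mul_eq_div]
  constructor
  · refine div_le_div_of_nonneg_right (max_le ?_ ?_) hK1.le
    · linarith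
    · linarith
  · rw [div_le_iff₀ hK1]
    nlinarith

end Estimate

end CellGraph

namespace CellGraph

open Finset

/-! ### Representing homology classes by loops -/

section Paths

variable {V E : Type*} (Γ : CellGraph V E)

/-- The list of oriented edges is a path, possibly with backtracking, between two vertices. -/
def IsPath : V → List (E × Bool) → V → Prop
  | u, [], v => u = v
  | u, d :: W, v => Γ.start d = u ∧ IsPath (Γ.finish d) W v

variable {Γ}

theorem IsPath.append {u v w : V} {A B : List (E × Bool)} (hA : Γ.IsPath u A v)
    (hB : Γ.IsPath v B w) : Γ.IsPath u (A ++ B) w := by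
  induction A generalizing u with
  | nil =>
    obtain rfl : u = v := hA
    exact hB
  | cons d A ih => exact ⟨hA.1, ih hA.2⟩

theorem IsPath.exists_of_append {u w : V} {A B : List (E × Bool)} (h : Γ.IsPath u (A ++ B) w) :
    ∃ v, Γ.IsPath u A v ∧ Γ.IsPath v B w := by
  induction A generalizing u with
  | nil => exact ⟨u, rfl, h⟩
  | cons d A ih =>
    obtain ⟨v, h1, h2⟩ := ih h.2
    exact ⟨v, ⟨h.1, h1⟩, h2⟩

theorem IsPath.reverse {u v : V} {W : List (E × Bool)} (h : Γ.IsPath u W v) :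
    Γ.IsPath v (W.map rev).reverse u := by
  induction W generalizing u with
  | nil => exact Eq.symm h
  | cons d W ih =>
    rw [List.map_cons, List.reverse_cons]
    exact (ih h.2).append ⟨by rw [start_rev], by rw [finish_rev]; exact h.1⟩

theorem IsConnected.exists_isPath (h : Γ.IsConnected) (u v : V) : ∃ W, Γ.IsPath u W v := by
  have := h.2 u v
  induction this with
  | rel x y hxy =>
    obtain ⟨e, rfl, rfl⟩ := hxy
    exact ⟨[(e, true)], rfl, rfl⟩
  | refl x => exact ⟨[], rfl⟩
  | symm x y _ ih =>
    obtain ⟨W, hW⟩ := ih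
    exact ⟨_, hW.reverse⟩
  | trans x y z _ _ ih1 ih2 =>
    obtain ⟨W, hW⟩ := ih1
    obtain ⟨W', hW'⟩ := ih2
    exact ⟨_, hW.append hW'⟩

theorem add_self_eq_zero_of_zmod_two (f : E → ZMod 2) : f + f = 0 := by
  funext e
  exact CharTwo.add_self_eq_zero (f e)

variable [DecidableEq E]

/-- The mod `2` chain of a list of oriented edges. -/
def listChain (W : List (E × Bool)) : E → ZMod 2 := (W.map fun d => Pi.single d.1 1).sum

@[simp] theorem listChain_nil : listChain ([] : List (E × Bool)) = 0 := rfl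

@[simp] theorem listChain_cons (d : E × Bool) (W : List (E × Bool)) :
    listChain (d :: W) = Pi.single d.1 1 + listChain W := by
  simp [listChain]

@[simp] theorem listChain_append (A B : List (E × Bool)) :
    listChain (A ++ B) = listChain A + listChain B := by
  simp [listChain]

@[simp] theorem listChain_reverse (W : List (E × Bool)) :
    listChain (W.map rev).reverse = listChain W := by
  induction W with
  | nil => rfl
  | cons d W ih => simp [ih, add_comm]

/-- A closed path with nonzero chain reduces to a loop with the same chain. -/
theorem IsPath.exists_loop {v : V} {W : List (E × Bool)} (h : Γ.IsPath v W v)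
    (h0 : listChain W ≠ 0) : ∃ α : Γ.Loop, α.chain = listChain W := by
  -- Cancel backtracks, including one across the base point. A cancelled pair contributes twice the
  -- same edge, so the chain mod 2 is unchanged; as it is nonzero, the path never becomes empty.
  induction hn : W.length using Nat.strong_induction_on generalizing W v with
  | _ n ih =>
    have hW : W ≠ [] := fun e => h0 (by rw [e]; rfl)
    have hcomp : W.IsChain fun d d' => Γ.finish d = Γ.start d' := by
      rw [List.isChain_iff_forall_rel_of_append_cons_cons]
      rintro a b A B rfl
      obtain ⟨u, -, h1⟩ := h.exists_of_append
      exact h1.2.1.symm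
    have hclosed : Γ.finish (W.getLast hW) = Γ.start (W.head hW) := by
      have e1 : Γ.start (W.head hW) = v := by
        obtain ⟨d, W', rfl⟩ := List.exists_cons_of_ne_nil hW
        exact h.1
      obtain ⟨W', d, rfl⟩ := (List.eq_nil_or_concat' W).resolve_left hW
      obtain ⟨u, -, h1⟩ := h.exists_of_append
      rw [e1, List.getLast_append_singleton]
      exact h1.2
    by_cases hc : W.IsChain Γ.Turn
    · by_cases hl : Γ.Turn (W.getLast hW) (W.head hW)
      · obtain ⟨α, hα⟩ := (Circuit.ofList W hW hc hl).exists_loop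
        refine ⟨α, ?_⟩
        rw [Loop.chain, Loop.weight_eq hα, Circuit.sum_ofList]
        rfl
      · have hrev : W.head hW = rev (W.getLast hW) := by
          by_contra hne
          exact hl ⟨hclosed, hne⟩
        obtain ⟨d, W', rfl⟩ := List.exists_cons_of_ne_nil hW
        rcases List.eq_nil_or_concat' W' with rfl | ⟨W'', d', rfl⟩
        · exact absurd hrev.symm (rev_ne d)
        · have hd : d = rev d' := by simpa using hrev
          obtain ⟨u, h1, h2⟩ := h.2.exists_of_append
          have hu : u = Γ.finish d := by rw [← h2.1, hd, finish_rev]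
          subst hu
          have e : listChain (d :: (W'' ++ [d'])) = listChain W'' := by
            rw [listChain_cons, listChain_append, listChain_cons, listChain_nil, add_zero, hd,
              rev_fst, add_left_comm, add_self_eq_zero_of_zmod_two, add_zero]
          rw [e] at h0 ⊢
          refine ih W''.length ?_ h1 h0 rfl
          rw [← hn, List.length_cons, List.length_append]
          omega
    · rw [List.isChain_iff_forall_rel_of_append_cons_cons] at hc
      push Not at hc
      obtain ⟨a, b, A, B, rfl, hab⟩ := hc
      have hrev : b = rev a := by
        by_contra hne
        exact hab ⟨(List.isChain_iff_forall_rel_of_append_cons_cons.1 hcomp) rfl, hne⟩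
      obtain ⟨u, h1, h2⟩ := h.exists_of_append
      have h3 : Γ.IsPath u B v := by
        have := h2.2.2
        rwa [hrev, finish_rev, h2.1] at this
      have e : listChain (A ++ a :: b :: B) = listChain (A ++ B) := by
        rw [listChain_append, listChain_cons, listChain_cons, listChain_append, hrev, rev_fst,
          ← add_assoc (Pi.single _ _), add_self_eq_zero_of_zmod_two, zero_add]
      rw [e] at h0 ⊢
      refine ih (A ++ B).length ?_ (h1.append h3) h0 rfl
      rw [← hn, List.length_append, List.length_append, List.length_cons, List.length_cons]
      omega

variable [Fintype V] [Fintype E] [DecidableEq V]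

/-- In a connected graph every nonzero class is represented by a loop. -/
theorem IsConnected.exists_represents (h : Γ.IsConnected) (a : Γ.H1) (ha : a ≠ 0) :
    ∃ α : Γ.Loop, α.Represents a := by
  obtain ⟨v₀⟩ := h.1
  choose P hP using h.exists_isPath v₀
  let S : Submodule (ZMod 2) (E → ZMod 2) :=
    { carrier := {b | ∃ W, Γ.IsPath v₀ W v₀ ∧ listChain W = b}
      zero_mem' := ⟨[], rfl, rfl⟩
      add_mem' := by
        rintro _ _ ⟨A, hA, rfl⟩ ⟨B, hB, rfl⟩
        exact ⟨A ++ B, hA.append hB, listChain_append A B⟩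
      smul_mem' := by
        rintro r _ ⟨A, hA, rfl⟩
        obtain rfl | rfl : r = 0 ∨ r = 1 := by revert r; decide
        · exact ⟨[], rfl, by simp⟩
        · exact ⟨A, hA, by simp⟩ }
  let Q : (V → ZMod 2) →ₗ[ZMod 2] (E → ZMod 2) :=
    ∑ v, (LinearMap.proj v).smulRight (listChain (P v))
  have hQ : ∀ v, Q (Pi.single v 1) = listChain (P v) := by
    intro v
    rw [LinearMap.sum_apply, Finset.sum_eq_single v]
    · simp
    · intro w _ hw
      simp [Pi.single_eq_of_ne hw]
    · simp
  -- Adding `Q` of the boundary completes each edge to a closed path at `v₀`, by chosen paths to its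
  -- two ends. On cycles the added term vanishes, so every cycle is the chain of a closed path at
  -- `v₀`.
  have hS : ∀ b, b + Q (Γ.boundary b) ∈ S := by
    intro b
    have hb : b = ∑ e, b e • (Pi.single e 1 : E → ZMod 2) := by
      funext e
      simp [Finset.sum_apply, Pi.single_apply]
    rw [hb, map_sum, map_sum, ← Finset.sum_add_distrib]
    refine Submodule.sum_mem _ fun e _ => ?_
    rw [map_smul, map_smul, ← smul_add]
    refine Submodule.smul_mem _ _ ?_
    rw [boundary_single, map_sub, hQ, hQ]
    refine ⟨P (Γ.src e) ++ ((e, true) :: ((P (Γ.tgt e)).map rev).reverse), ?_, ?_⟩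
    · exact (hP _).append ⟨rfl, (hP _).reverse⟩
    · rw [listChain_append, listChain_cons, listChain_reverse]
      funext e'
      simp only [Pi.add_apply, Pi.sub_apply]
      rw [CharTwo.sub_eq_add]
      ring
  have h1 := hS a
  rw [LinearMap.mem_ker.1 a.2, map_zero, add_zero] at h1
  obtain ⟨W, hW, hWa⟩ := h1
  obtain ⟨α, hα⟩ := hW.exists_loop (by
    rw [hWa]
    exact fun h0 => ha (Subtype.ext h0))
  exact ⟨α, hα.trans hWa⟩

end Paths

/-! ### Nontrivial double covers are connected -/

section ConnectedCovers

variable {V E : Type*} {Γ : CellGraph V E}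

/-- Being in the same component. -/
abbrev Joined (Γ : CellGraph V E) : V → V → Prop :=
  Relation.EqvGen fun x y => ∃ e, Γ.src e = x ∧ Γ.tgt e = y

theorem DoubleCover.joined_edge (D : DoubleCover Γ) (e : E) (x : Bool) :
    D.total.Joined (Γ.src e, x) (Γ.tgt e, x ^^ D.mono e) :=
  .rel _ _ ⟨(D.lift (e, true) x).1, D.start_lift (e, true) x, D.finish_lift (e, true) x⟩

theorem DoubleCover.exists_joined (D : DoubleCover Γ) {u v : V} (h : Γ.Joined u v) :
    (∀ x, ∃ y, D.total.Joined (u, x) (v, y)) ∧ ∀ y, ∃ x, D.total.Joined (u, x) (v, y) := by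
  induction h with
  | rel u v h =>
    obtain ⟨e, rfl, rfl⟩ := h
    refine ⟨fun x => ⟨_, D.joined_edge e x⟩, fun y => ⟨y ^^ D.mono e, ?_⟩⟩
    simpa using D.joined_edge e (y ^^ D.mono e)
  | refl u => exact ⟨fun x => ⟨x, .refl _⟩, fun x => ⟨x, .refl _⟩⟩
  | symm u v _ ih =>
    exact ⟨fun x => (ih.2 x).imp fun _ => .symm _ _, fun x => (ih.1 x).imp fun _ => .symm _ _⟩
  | trans u v w _ _ ih1 ih2 =>
    refine ⟨fun x => ?_, fun x => ?_⟩
    · obtain ⟨y, hy⟩ := ih1.1 x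
      exact (ih2.1 y).imp fun _ => .trans _ _ _ hy
    · obtain ⟨y, hy⟩ := ih2.2 x
      exact (ih1.2 y).imp fun _ h => .trans _ _ _ h hy

/-- If the two points over `v₀` were not joined, exactly one point over each vertex would lie in the
component of `(v₀, false)`. This section would exhibit the sheet changes as a coboundary. -/
theorem NontrivialCover.isConnected_space (h : Γ.IsConnected) (N : NontrivialCover Γ) :
    N.space.IsConnected := by
  classical
  let D := Quotient.out N.1
  obtain ⟨v₀⟩ := h.1
  have hbase : D.total.Joined (v₀, true) (v₀, false) := by
    by_contra hcon
    have huniq : ∀ v, ¬ (D.total.Joined (v, true) (v₀, false) ∧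
        D.total.Joined (v, false) (v₀, false)) := by
      rintro v ⟨h1, h2⟩
      obtain ⟨y, hy⟩ := (D.exists_joined (h.2 v₀ v)).1 true
      refine hcon (.trans _ _ _ hy ?_)
      cases y
      · exact h2
      · exact h1
    have hf : ∀ v y, D.total.Joined (v, y) (v₀, false) →
        y = decide (D.total.Joined (v, true) (v₀, false)) := by
      intro v y hy
      cases y
      · exact (decide_eq_false fun h1 => huniq v ⟨h1, hy⟩).symm
      · exact (decide_eq_true hy).symm
    refine N.mono_ne ⟨fun v => decide (D.total.Joined (v, true) (v₀, false)), fun e => ?_⟩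
    obtain ⟨x, hx⟩ := (D.exists_joined (h.2 (Γ.src e) v₀)).2 false
    have h1 := hf _ _ hx
    have h2 := hf _ _ (.trans _ _ _ (.symm _ _ (D.joined_edge e x)) hx)
    beta_reduce
    rw [← h1, ← h2]
    change D.mono e = _
    simp
  have hall : ∀ w : V × Bool, D.total.Joined w (v₀, false) := by
    rintro ⟨v, x⟩
    obtain ⟨y, hy⟩ := (D.exists_joined (h.2 v v₀)).1 x
    refine .trans _ _ _ hy ?_
    cases y
    · exact .refl _
    · exact hbase
  exact ⟨⟨(v₀, false)⟩, fun u w => .trans _ _ _ (hall u) (.symm _ _ (hall w))⟩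

end ConnectedCovers

/-! ### Counting covers and classes -/

section Counting

variable {V E : Type*} {Γ : CellGraph V E}

/-- The valences add up to twice the number of edges and are at least `3`. -/
theorem card_vertices_lt_card_edges [Fintype V] [Fintype E] [Nonempty V] (hv : ∀ v, 2 < Γ.valence v) :
    Fintype.card V < Fintype.card E := by
  have h1 : ∑ v, Γ.valence v = Nat.card (E × Bool) := by
    rw [← Nat.card_congr (Equiv.sigmaFiberEquiv Γ.start), Nat.card_sigma]
    rfl
  rw [Nat.card_eq_fintype_card, Fintype.card_prod, Fintype.card_bool] at h1
  have h2 : ∑ _v : V, 3 ≤ ∑ v, Γ.valence v := Finset.sum_le_sum fun v _ => hv v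
  rw [Finset.sum_const, Finset.card_univ, smul_eq_mul] at h2
  have h3 := Fintype.card_pos (α := V)
  omega

/-- The coboundary map with `ℤ/2` coefficients. -/
def coboundary (Γ : CellGraph V E) : (V → ZMod 2) →ₗ[ZMod 2] (E → ZMod 2) :=
  LinearMap.funLeft (ZMod 2) (ZMod 2) Γ.src + LinearMap.funLeft (ZMod 2) (ZMod 2) Γ.tgt

/-- The element of `ℤ/2` given by a Boolean. -/
def boolEquivZMod : Bool ≃ ZMod 2 where
  toFun b := if b then 1 else 0
  invFun r := decide (r = 1)
  left_inv b := by cases b <;> decide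
  right_inv r := by revert r; decide

theorem DoubleCover.iso_iff_mk_eq {D D' : DoubleCover Γ} : D.Iso D' ↔
    (LinearMap.range Γ.coboundary).mkQ (fun e => boolEquivZMod (D.mono e)) =
      (LinearMap.range Γ.coboundary).mkQ (fun e => boolEquivZMod (D'.mono e)) := by
  rw [Submodule.mkQ_apply, Submodule.mkQ_apply, Submodule.Quotient.eq, DoubleCover.iso_iff]
  constructor
  · rintro ⟨f, hf⟩
    refine ⟨fun v => boolEquivZMod (f v), funext fun e => ?_⟩
    change boolEquivZMod (f (Γ.src e)) + boolEquivZMod (f (Γ.tgt e)) =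
      boolEquivZMod (D.mono e) - boolEquivZMod (D'.mono e)
    rw [hf]
    generalize f (Γ.src e) = p
    generalize f (Γ.tgt e) = q
    generalize D.mono e = r
    revert p q r
    decide
  · rintro ⟨f, hf⟩
    refine ⟨fun v => boolEquivZMod.symm (f v), fun e => ?_⟩
    have h1 : f (Γ.src e) + f (Γ.tgt e) = boolEquivZMod (D.mono e) - boolEquivZMod (D'.mono e) :=
      congrFun hf e
    revert h1
    beta_reduce
    generalize f (Γ.src e) = p
    generalize f (Γ.tgt e) = q
    generalize D.mono e = r
    generalize D'.mono e = s
    revert p q r s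
    decide

variable [Fintype V]

/-- By connectedness the kernel consists of the constant functions. -/
theorem finrank_range_coboundary (h : Γ.IsConnected) :
    Module.finrank (ZMod 2) (LinearMap.range Γ.coboundary) + 1 = Fintype.card V := by
  obtain ⟨v₀⟩ := h.1
  have h1 := Γ.coboundary.finrank_range_add_finrank_ker
  rw [Module.finrank_fintype_fun_eq_card] at h1
  have h2 : Module.finrank (ZMod 2) (LinearMap.ker Γ.coboundary) = 1 := by
    refine finrank_eq_one (⟨fun _ => 1, ?_⟩ : LinearMap.ker Γ.coboundary) ?_ ?_
    · rw [LinearMap.mem_ker]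
      funext e
      exact CharTwo.add_self_eq_zero (1 : ZMod 2)
    · intro h0
      have : (1 : ZMod 2) = 0 := congrFun (congrArg Subtype.val h0) v₀
      exact absurd this (by decide)
    · rintro ⟨f, hf⟩
      refine ⟨f v₀, Subtype.ext (funext fun v => ?_)⟩
      have h3 : ∀ u v, Γ.Joined u v → f u = f v := by
        intro u v huv
        induction huv with
        | rel u v huv =>
          obtain ⟨e, rfl, rfl⟩ := huv
          exact CharTwo.add_eq_zero.1 (congrFun (LinearMap.mem_ker.1 hf) e)
        | refl u => rfl
        | symm u v _ ih => exact ih.symm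
        | trans u v w _ _ ih1 ih2 => exact ih1.trans ih2
      simpa using h3 v₀ v (h.2 v₀ v)
  omega

variable [Fintype E]

/-- By connectedness the boundaries are exactly the `0`-chains with coordinate sum zero, a subspace
of codimension one. -/
theorem finrank_H1 [DecidableEq V] [DecidableEq E] (h : Γ.IsConnected) :
    Module.finrank (ZMod 2) Γ.H1 + Fintype.card V = Fintype.card E + 1 := by
  obtain ⟨v₀⟩ := h.1
  have h1 := Γ.boundary.finrank_range_add_finrank_ker
  rw [Module.finrank_fintype_fun_eq_card] at h1
  let σ : (V → ZMod 2) →ₗ[ZMod 2] ZMod 2 := ∑ v, LinearMap.proj v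
  have hσ : ∀ f, σ f = ∑ v, f v := fun f => by simp [σ]
  have hσs : ∀ v, σ (Pi.single v 1) = 1 := fun v => by simp [hσ]
  have h2 := σ.finrank_range_add_finrank_ker
  have h3 : LinearMap.range σ = ⊤ := by
    rw [LinearMap.range_eq_top]
    exact fun r => ⟨r • Pi.single v₀ 1, by rw [map_smul, hσs, smul_eq_mul, mul_one]⟩
  rw [h3, finrank_top, Module.finrank_self, Module.finrank_fintype_fun_eq_card] at h2
  have h4 : LinearMap.ker σ = LinearMap.range Γ.boundary := by
    apply le_antisymm
    · intro f hf
      have hj : ∀ u v, Γ.Joined u v →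
          (Pi.single v 1 - Pi.single u 1 : V → ZMod 2) ∈ LinearMap.range Γ.boundary := by
        intro u v huv
        induction huv with
        | rel u v huv =>
          obtain ⟨e, rfl, rfl⟩ := huv
          exact ⟨_, boundary_single e⟩
        | refl u => simp
        | symm u v _ ih => simpa using Submodule.neg_mem _ ih
        | trans u v w _ _ ih1 ih2 => simpa using Submodule.add_mem _ ih2 ih1
      have hf' : f = ∑ v, f v • (Pi.single v 1 - Pi.single v₀ 1 : V → ZMod 2) := by
        simp only [smul_sub, Finset.sum_sub_distrib, ← Finset.sum_smul]
        rw [← hσ, LinearMap.mem_ker.1 hf, zero_smul, sub_zero]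
        funext v
        simp [Finset.sum_apply, Pi.single_apply]
      rw [hf']
      exact Submodule.sum_mem _ fun v _ => Submodule.smul_mem _ _ (hj _ _ (h.2 v₀ v))
    · rintro _ ⟨b, rfl⟩
      rw [LinearMap.mem_ker]
      have hb : b = ∑ e, b e • (Pi.single e 1 : E → ZMod 2) := by
        funext e
        simp [Finset.sum_apply, Pi.single_apply]
      rw [hb, map_sum, map_sum]
      refine Finset.sum_eq_zero fun e _ => ?_
      rw [map_smul, map_smul, boundary_single, map_sub, hσs, hσs, sub_self, smul_zero]
  rw [h4] at h2
  change Module.finrank (ZMod 2) (LinearMap.ker Γ.boundary) + _ = _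
  omega

/-- A connected graph of rank `n` has `2 ^ n` double covers up to isomorphism. -/
theorem card_quotient_doubleCover (h : Γ.IsConnected) {n : ℕ}
    (hn : Fintype.card V + n = Fintype.card E + 1) :
    Nat.card (Quotient (DoubleCover.isoSetoid Γ)) = 2 ^ n := by
  let φ : Quotient (DoubleCover.isoSetoid Γ) → (E → ZMod 2) ⧸ LinearMap.range Γ.coboundary :=
    Quotient.lift (fun D => (LinearMap.range Γ.coboundary).mkQ fun e => boolEquivZMod (D.mono e))
      fun D D' hD => DoubleCover.iso_iff_mk_eq.1 hD
  have hφ : Function.Bijective φ := by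
    constructor
    · rintro ⟨D⟩ ⟨D'⟩ hD
      exact Quotient.sound (DoubleCover.iso_iff_mk_eq.2 hD)
    · intro q
      obtain ⟨w, rfl⟩ := Submodule.mkQ_surjective _ q
      refine ⟨Quotient.mk _ (DoubleCover.ofMono fun e => boolEquivZMod.symm (w e)), ?_⟩
      change (LinearMap.range Γ.coboundary).mkQ _ = _
      simp
  rw [Nat.card_congr (Equiv.ofBijective φ hφ), Module.natCard_eq_pow_finrank (K := ZMod 2),
    Nat.card_zmod]
  congr 1
  have h1 := (LinearMap.range Γ.coboundary).finrank_quotient_add_finrank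
  rw [Module.finrank_fintype_fun_eq_card] at h1
  have h2 := finrank_range_coboundary h
  omega

/-- A nontrivial cover is connected with twice as many vertices and edges, so its rank is `2 * n -
1`. The trivial cover and the zero class account for the two subtractions of `1`. -/
theorem card_summand [DecidableEq V] [DecidableEq E] (h : Γ.IsConnected) {n : ℕ}
    (hn : Fintype.card V + n = Fintype.card E + 1) :
    Fintype.card Γ.Summand = numSummands n := by
  have h1 : ∀ N : NontrivialCover Γ, Nat.card {a : N.space.H1 // a ≠ 0} = 2 ^ (2 * n - 1) - 1 := by
    intro N
    have e1 := finrank_H1 (N.isConnected_space h)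
    rw [Fintype.card_prod, Fintype.card_prod, Fintype.card_bool] at e1
    have e2 : Module.finrank (ZMod 2) N.space.H1 = 2 * n - 1 := by omega
    classical
    have : Fintype N.space.H1 := Fintype.ofFinite _
    rw [Nat.card_eq_fintype_card, Fintype.card_subtype_compl, Fintype.card_subtype_eq,
      ← Nat.card_eq_fintype_card, Module.natCard_eq_pow_finrank (K := ZMod 2), Nat.card_zmod, e2]
  have h2 : Nat.card (NontrivialCover Γ) = 2 ^ n - 1 := by
    classical
    have : Fintype (Quotient (DoubleCover.isoSetoid Γ)) := Fintype.ofFinite _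
    rw [← card_quotient_doubleCover h hn, NontrivialCover, Nat.card_eq_fintype_card,
      Fintype.card_subtype_compl, Fintype.card_subtype_eq, Nat.card_eq_fintype_card]
  rw [← Nat.card_eq_fintype_card, Nat.card_sigma, Finset.sum_congr rfl fun N _ => h1 N,
    Finset.sum_const, Finset.card_univ, smul_eq_mul, ← Nat.card_eq_fintype_card, h2, numSummands]

end Counting

end CellGraph

/-! ### The main theorem -/

theorem mainTheorem4 {V E : Type*} [Fintype V] [Fintype E] [DecidableEq V] [DecidableEq E]
    (n : ℕ) (Γ : CellGraph V E) (hΓ : Γ.IsGraphOfRank n)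
    (ℓ τ : E → ℝ) (hℓ : Γ.IsMetric ℓ) (hτ : CellGraph.IsTangent τ) :
    -- the supremum, the minima and the maxima in the definitions exist,
    -- and `K` is the number of summands
    ((Γ.ratios ℓ τ).Nonempty ∧ BddAbove (Γ.ratios ℓ τ)) ∧
    (∀ i : Γ.Summand,
      IsLeast {x | ∃ α : i.1.space.Loop, α.Represents i.2.1 ∧
          α.weight (CellGraph.pullback ℓ) = x}
        (CellGraph.classLength (CellGraph.pullback ℓ) i.2.1) ∧
      0 < CellGraph.classLength (CellGraph.pullback ℓ) i.2.1 ∧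
      IsGreatest (CellGraph.realizedValues (CellGraph.pullback ℓ) (CellGraph.pullback τ) i.2.1)
        (sSup (CellGraph.realizedValues (CellGraph.pullback ℓ) (CellGraph.pullback τ) i.2.1))) ∧
    Fintype.card Γ.Summand = CellGraph.numSummands n ∧
    -- the two-sided estimate
    1 / ((CellGraph.numSummands n : ℝ) + 1) * max (Γ.normL ℓ τ) (Γ.normL ℓ (-τ))
      ≤ Γ.normN n ℓ τ ∧
    Γ.normN n ℓ τ ≤ 2 * Γ.normL ℓ τ + Γ.normL ℓ (-τ) ∧
    -- quasi-symmetry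
    Γ.normN n ℓ τ ≤ 3 * ((CellGraph.numSummands n : ℝ) + 1) * Γ.normN n ℓ (-τ) := by
  have hℓ' := hℓ.isForestMetric
  have : Nonempty V := hΓ.1.1
  have hv := hΓ.2.1
  have hVE := CellGraph.card_vertices_lt_card_edges hv
  have hcard := CellGraph.card_summand hΓ.1 hΓ.2.2
  have hrep : ∀ i : Γ.Summand, ∃ α : i.1.space.Loop, α.Represents i.2.1 := fun i =>
    (i.1.isConnected_space hΓ.1).exists_represents i.2.1 i.2.2
  have hcov : ∀ i : Γ.Summand, CellGraph.IsForestMetric i.1.space (CellGraph.pullback ℓ) :=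
    fun i => (Quotient.out i.1.1).isForestMetric hℓ'
  have h1 := CellGraph.normN_bounds hℓ' hVE hrep hv hℓ.2.1 hτ hcard
  have hτ' : ∑ e, (-τ) e = 0 := by
    have h0 : ∑ e, τ e = 0 := hτ
    simpa using h0
  have h2 := (CellGraph.normN_bounds hℓ' hVE hrep hv hℓ.2.1 hτ' hcard).1
  refine ⟨⟨CellGraph.nonempty_ratios hv ℓ τ, hℓ'.bddAbove_ratios τ⟩,
    fun i => ⟨(hcov i).isLeast_classLength (hrep i), (hcov i).classLength_pos (hrep i),
      (hcov i).isGreatest_realizedValues _ (hrep i)⟩, hcard, h1.1, h1.2, ?_⟩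
  have hK : (0 : ℝ) < CellGraph.numSummands n + 1 := by positivity
  -- The upper bound for `τ` is at most three times the larger of the two Lipschitz norms, which the
  -- lower bound for `-τ` controls.
  rw [neg_neg, one_div_mul_eq_div, div_le_iff₀ hK] at h2
  have h3 := le_max_left (Γ.normL ℓ (-τ)) (Γ.normL ℓ τ)
  have h4 := le_max_right (Γ.normL ℓ (-τ)) (Γ.normL ℓ τ)
  linarith [h1.2]
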